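/- **Convergence of FPR, TPR, and bit accuracy.** *Setting.* Let $K,d,D$ be positive integers with $d<D-K$, $B\in\mathbb R^{D\times d}$ of full column rank, $\Sigma_{\bm Z}$ a positive definite $d\times d$ matrix, $\sigma_\epsilon>0$, $\beta>0$, and let $P_0$ be the law of $\bm X=B\bm Z+\bm\epsilon$ with $\bm Z\sim\mathcal N(0,\Sigma_{\bm Z})$ and $\bm\epsilon\sim\mathcal N(0,\sigma_\epsilon^2\mathbf I_D)$ independent; put $\Sigma_{\bm X}=B\Sigma_{\bm Z}B^\top+\sigma_\epsilon^2\mathbf I_D$. Let either $V(x)=(1-x)_+$ with $\sigma_\epsilon^2<4$ and $\beta<1$, or $V(x)=\log(1+e^{-x})$ with $\sigma_\epsilon^2<-4+2\sqrt6$ and $\beta<\frac12-\frac{\sigma_\epsilon^2}8$. Let $L>0$ be such that $V$ is $L$-Lipschitz, or such that all subgradients of $V$ lie in $[-L,0]$. For $\bm w_{1:K}\in(\mathbb R^D)^K$ and training images $\bm x_1,\dots,\bm x_n$, $n\ge1$, let $$\mathcal L_n(\bm w_{1:K})=\frac1n\sum_{i=1}^n\frac1{2^K}\sum_{\bm m\in\{\pm1\}^K}\sum_{k=1}^K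 V\Big(m_k\Big\langle\bm w_k,\bm x_i+\sum_{j=1}^K m_j\bm w_j\Big\rangle\Big)+\beta\sum_{k=1}^K\|\bm w_k\|^2 .$$ Let $r_\star$ be the minimizer over $r\ge0$ of $h_{\rm pop}(r)=\mathbb E\,V(r+\sigma_\epsilon\sqrt r\,Z)+\beta r$, $Z\sim\mathcal N(0,1)$. An *oracle watermark* is a $\bm w_{1:K}$ with $B^\top\bm w_k=0$, $\|\bm w_k\|^2=r_\star>0$ and $\langle\bm w_k,\bm w_j\rangle=0$ for all $j\ne k$. With $R^2=K(V(0)-\inf V)/\beta$, let $$\varepsilon_n(\delta)=LR\sqrt{K\,\mathrm{tr}(\Sigma_{\bm X})}\left(\frac{4+\frac{25}3\sqrt{\log(4/\delta)}}{\sqrt n}+\frac{75\log(2e)}{2\log2}\,\frac{\log(4n/\delta)\log(4/\delta)}{n}\right).$$ For a watermark $\bm w_{1:K}$ and an image $\bm x$ put $\Gamma_k=\langle\bm w_k,\bm x\rangle$, $S=\sum_{k}|\Gamma_k|$, $S_{\mathcal D}=\max_{\bm m\in\mathcal D}\langle\bm m,\bm\Gamma\rangle$ for a non-empty dictionary $\mathcal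 D\subset\{\pm1\}^K$, $\widehat{\bm m}^{\rm sign}=(\mathrm{sign}(\Gamma_k))_k$ with $\mathrm{sign}(0)=1$, and $\widehat{\bm m}^{\mathcal D}\in\arg\max_{\bm m\in\mathcal D}\langle\bm m,\bm\Gamma\rangle$ (any measurable selection, the same for all watermarks). Under $H_0$ the test image $\bm x$ has law $P_0$, and given the message $\bm m$ under $H_1$ it has the law of $\bm X+\sum_k m_k\bm w_k$; it is independent of the training sample. The bit accuracy is $\mathrm{BA}(\widehat{\bm m},\bm m)=\frac1K\sum_k\mathbf 1\{\widehat m_k=m_k\}$. Let $\alpha(s)=\mathbb P(S>s\mid H_0)$, $\pi(s)=\inf_{\bm m\in\{\pm1\}^K}\mathbb P(S>s\mid H_1,\bm m)$, $\alpha_{\mathcal D}(t)=\mathbb P(S_{\mathcal D}>t\mid H_0)$ and $\pi_{\mathcal D}(t)=\inf_{\bm m\in\mathcal D}\mathbb P(S_{\mathcal D}>t\mid H_1,\bm m)$. A subscript $n$ denotes these quantities for a minimizer of $\mathcal L_n$, the training sample being held fixed; the subscript "orc", or no subscript in (iii), denotes them for an oracle watermark. *Claim.* There exist constants $\tau_1,C>0$,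 depending only on $K,D,d,B,\Sigma_{\bm Z},\sigma_\epsilon,\beta,V,L$, such that for every $n\ge1$ and every $\delta\in(0,1)$ with $\varepsilon_n:=\varepsilon_n(\delta)\le\tau_1$, the following hold with probability at least $1-\delta$ over the i.i.d. training sample $\bm x_1,\dots,\bm x_n\sim P_0$, for any minimizer of $\mathcal L_n$ over $(\mathbb R^D)^K$ and any oracle watermark. Write $\rho=\varepsilon_n^{1/4}+\varepsilon_n^{1/2}+\varepsilon_n$. (i) For all $s\in\mathbb R$: $|\alpha_n(s)-\alpha_{\rm orc}(s)|\le C\rho$ and $|\pi_n(s)-\pi_{\rm orc}(s)|\le C\rho$. (ii) For every non-empty $\mathcal D\subset\{\pm1\}^K$ and all $t\in\mathbb R$: $|\alpha_{\mathcal D,n}(t)-\alpha_{\mathcal D,\rm orc}(t)|\le C\rho$ and $|\pi_{\mathcal D,n}(t)-\pi_{\mathcal D,\rm orc}(t)|\le C\rho$. (iii) $\sup_{\bm m\in\{\pm1\}^K}\big|\mathbb E[\mathrm{BA}(\widehat{\bm m}^{\rm sign}_n,\bm m)\mid H_1,\bm m]-\mathbb E[\mathrm{BA}(\widehat{\bm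 m}^{\rm sign},\bm m)\mid H_1,\bm m]\big|\le C\rho$, and for every non-empty $\mathcal D\subset\{\pm1\}^K$, $\sup_{\bm m\in\mathcal D}\big|\mathbb E[\mathrm{BA}(\widehat{\bm m}^{\mathcal D}_n,\bm m)\mid H_1,\bm m]-\mathbb E[\mathrm{BA}(\widehat{\bm m}^{\mathcal D},\bm m)\mid H_1,\bm m]\big|\le C\rho$. -/

import Mathlib

open MeasureTheory ProbabilityTheory
open scoped Matrix

noncomputable section

namespace Watermark

/-- The space `ℝ^D` of images, with the Euclidean norm. -/
abbrev Img (D : ℕ) := EuclideanSpace ℝ (Fin D)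

/-- The messages `{-1, 1}^K`. -/
abbrev Message (K : ℕ) := Fin K → ℤˣ

/-- The `k`-th bit of a message as a real number, `1` or `-1`. -/
def bit {K : ℕ} (m : Message K) (k : Fin K) : ℝ := ((m k : ℤ) : ℝ)

/-- The additive embedding `W_m (x) = x + ∑ k, m_k w_k`. -/
def embed {K D : ℕ} (w : Fin K → Img D) (m : Message K) (x : Img D) : Img D :=
  x + ∑ k, bit m k • w k

/-! ### The image model -/

/-- The law `P₀` of `X = B Z + ε`, with independent `Z ∼ N(0, Σ_Z)` and `ε ∼ N(0, σ² I_D)`. -/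
def imageLaw {D d : ℕ} (B : Matrix (Fin D) (Fin d) ℝ) (SZ : Matrix (Fin d) (Fin d) ℝ) (σ : ℝ) :
    Measure (Img D) :=
  ((multivariateGaussian (0 : EuclideanSpace ℝ (Fin d)) SZ).prod
      (multivariateGaussian (0 : Img D) (σ ^ 2 • (1 : Matrix (Fin D) (Fin D) ℝ)))).map
    (fun p => WithLp.toLp 2 (B *ᵥ p.1.ofLp) + p.2)

/-- The covariance matrix `Σ_X = B Σ_Z Bᵀ + σ² I_D` of the image. -/
def imageCov {D d : ℕ} (B : Matrix (Fin D) (Fin d) ℝ) (SZ : Matrix (Fin d) (Fin d) ℝ) (σ : ℝ) :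
    Matrix (Fin D) (Fin D) ℝ :=
  B * SZ * Bᵀ + σ ^ 2 • (1 : Matrix (Fin D) (Fin D) ℝ)

/-- The law `P_{W|m}` of the watermarked image `W_m (X)`. -/
def watermarkedLaw {K D : ℕ} (P₀ : Measure (Img D)) (w : Fin K → Img D) (m : Message K) :
    Measure (Img D) :=
  P₀.map (embed w m)

/-! ### Losses and training objective -/

/-- The hinge loss `(1 - x)₊`. -/
def hinge (x : ℝ) : ℝ := max (1 - x) 0

/-- The logistic loss `log (1 + exp (-x))`. -/
def logistic (x : ℝ) : ℝ := Real.log (1 + Real.exp (-x))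

/-- `V` is the hinge loss or the logistic loss, with the noise level and the regularization
in the corresponding range. -/
def HingeOrLogistic (V : ℝ → ℝ) (σ β : ℝ) : Prop :=
  (V = hinge ∧ σ ^ 2 < 4 ∧ β < 1) ∨
    (V = logistic ∧ σ ^ 2 < -4 + 2 * Real.sqrt 6 ∧ β < 1 / 2 - σ ^ 2 / 8)

/-- `V` is `L`-Lipschitz, or all its subgradients lie in `[-L, 0]`. -/
def SlopeBound (V : ℝ → ℝ) (L : ℝ) : Prop :=
  (∀ a b, |V a - V b| ≤ L * |a - b|) ∨
    (∀ t g, (∀ s, V t + g * (s - t) ≤ V s) → g ∈ Set.Icc (-L) 0)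

/-- The finite-sample objective `ℒ_n`; the expectation over the uniform message is the average
over all `2 ^ K` messages. -/
def empLoss {K D n : ℕ} (V : ℝ → ℝ) (β : ℝ) (x : Fin n → Img D) (w : Fin K → Img D) : ℝ :=
  (1 / (n : ℝ)) * ∑ i, (1 / (2 : ℝ) ^ K) * ∑ m : Message K,
      ∑ k, V (bit m k * inner ℝ (w k) (embed w m (x i)))
    + β * ∑ k, ‖w k‖ ^ 2

/-- The one-dimensional population loss `h_pop (r) = 𝔼 V (r + σ √r Z) + β r`, `Z ∼ N(0, 1)`. -/
def hPop (V : ℝ → ℝ) (σ β : ℝ) (r : ℝ) : ℝ :=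
  (∫ z, V (r + σ * Real.sqrt r * z) ∂(gaussianReal 0 1)) + β * r

/-- `R`, where `R² = K (V 0 - inf V) / β`. -/
def radius (K : ℕ) (V : ℝ → ℝ) (β : ℝ) : ℝ :=
  Real.sqrt (K * (V 0 - ⨅ t, V t) / β)

/-- The error level `ε_n (δ)`. -/
def epsN {D d : ℕ} (K : ℕ) (B : Matrix (Fin D) (Fin d) ℝ) (SZ : Matrix (Fin d) (Fin d) ℝ)
    (σ β : ℝ) (V : ℝ → ℝ) (L : ℝ) (n : ℕ) (δ : ℝ) : ℝ :=
  L * radius K V β * Real.sqrt (K * (imageCov B SZ σ).trace) *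
    ((4 + 25 / 3 * Real.sqrt (Real.log (4 / δ))) / Real.sqrt n
      + 75 * Real.log (2 * Real.exp 1) / (2 * Real.log 2)
        * (Real.log (4 * n / δ) * Real.log (4 / δ) / n))

/-- The oracle watermark: every `w_k` lies in `𝒰^⊥`, the null space of `Bᵀ`, has squared norm
`r > 0`, and the `w_k` are mutually orthogonal. -/
structure IsOracle {K D d : ℕ} (B : Matrix (Fin D) (Fin d) ℝ) (r : ℝ) (w : Fin K → Img D) :
    Prop where
  r_pos : 0 < r
  mem_orth : ∀ k, Bᵀ *ᵥ (w k).ofLp = 0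
  sq_norm : ∀ k, ‖w k‖ ^ 2 = r
  orth : ∀ j k, j ≠ k → inner ℝ (w k) (w j) = 0

/-! ### Detection and decoding with a watermark `w` -/

/-- The inner products `Γ_k = ⟨w_k, x⟩`. -/
def Γ {K D : ℕ} (w : Fin K → Img D) (x : Img D) : Fin K → ℝ := fun k => inner ℝ (w k) x

/-- `⟨m, γ⟩ = ∑ k, m_k γ_k`. -/
def score {K : ℕ} (m : Message K) (γ : Fin K → ℝ) : ℝ := ∑ k, bit m k * γ k

/-- The statistic `S = ∑ k, |Γ_k|`. -/
def stat {K D : ℕ} (w : Fin K → Img D) (x : Img D) : ℝ := ∑ k, |Γ w x k|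

/-- The statistic `S_𝒟 = max_{m ∈ 𝒟} ⟨m, Γ⟩`. -/
def statD {K D : ℕ} (𝒟 : Finset (Message K)) (h𝒟 : 𝒟.Nonempty) (w : Fin K → Img D)
    (x : Img D) : ℝ :=
  𝒟.sup' h𝒟 (fun m => score m (Γ w x))

/-- The false positive rate of the test that rejects when `S > s`. -/
def fpr {K D : ℕ} (P₀ : Measure (Img D)) (w : Fin K → Img D) (s : ℝ) : ℝ :=
  P₀.real {x | s < stat w x}

/-- The true positive rate of the test that rejects when `S > s`, in the worst case over all
messages. -/
def tpr {K D : ℕ} (P₀ : Measure (Img D)) (w : Fin K → Img D) (s : ℝ) : ℝ :=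
  ⨅ m : Message K, (watermarkedLaw P₀ w m).real {x | s < stat w x}

/-- The false positive rate of the test that rejects when `S_𝒟 > t`. -/
def fprD {K D : ℕ} (P₀ : Measure (Img D)) (𝒟 : Finset (Message K)) (h𝒟 : 𝒟.Nonempty)
    (w : Fin K → Img D) (t : ℝ) : ℝ :=
  P₀.real {x | t < statD 𝒟 h𝒟 w x}

/-- The true positive rate of the test that rejects when `S_𝒟 > t`, in the worst case over the
messages of the dictionary. -/
def tprD {K D : ℕ} (P₀ : Measure (Img D)) (𝒟 : Finset (Message K)) (h𝒟 : 𝒟.Nonempty)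
    (w : Fin K → Img D) (t : ℝ) : ℝ :=
  ⨅ m : 𝒟, (watermarkedLaw P₀ w m.1).real {x | t < statD 𝒟 h𝒟 w x}

/-- The sign decoder; a zero inner product is decoded as `1`. -/
def signDec {K : ℕ} (γ : Fin K → ℝ) : Message K := fun k => if 0 ≤ γ k then 1 else -1

/-- `dec` is a dictionary decoder: a measurable selection of `argmax_{m ∈ 𝒟} ⟨m, γ⟩`. -/
structure IsDictDec {K : ℕ} (𝒟 : Finset (Message K)) (dec : (Fin K → ℝ) → Message K) :
    Prop where
  measurable : Measurable dec
  mem : ∀ γ, dec γ ∈ 𝒟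
  isMax : ∀ γ, ∀ m ∈ 𝒟, score m γ ≤ score (dec γ) γ

/-- The bit accuracy: the fraction of the bits on which two messages agree. -/
def bitAcc {K : ℕ} (m' m : Message K) : ℝ := (1 / (K : ℝ)) * ∑ k, if m' k = m k then 1 else 0

/-- The expected bit accuracy of the decoder `dec`, applied to the inner products of the
watermarked image with the watermark, when the embedded message is `m`. -/
def expBitAcc {K D : ℕ} (P₀ : Measure (Img D)) (dec : (Fin K → ℝ) → Message K)
    (w : Fin K → Img D) (m : Message K) : ℝ :=
  ∫ x, bitAcc (dec (Γ w x)) m ∂(watermarkedLaw P₀ w m)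

/-- The rate `ε^{1/4} + ε^{1/2} + ε`. -/
def rate (ε : ℝ) : ℝ := ε ^ (1 / 4 : ℝ) + ε ^ (1 / 2 : ℝ) + ε

end Watermark

end

/-! Under the Gaussian image model the population objective sees a watermark only through the
squared norms `‖w k‖ ^ 2`, the latent variances `latentForm B SZ (w k) (w k)`, and the cross inner
products, which shift each margin by a message-dependent amount. Pairing every message with its flip
in bit `k`, `popLoss_sub_eq` writes the excess over `K * hPop V σ β r` as a sum over `k` of three
nonnegative parts: the excess of `hPop` at `‖w k‖ ^ 2`, the price of the latent variance, and second
differences of the Gaussian-smoothed loss, which measure interference between bits. All three vanish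
at an oracle watermark.

Each part is coercive. `hPop` is locally strongly convex on `(0, ∞)`, hence grows quadratically
around a positive minimizer (`exists_quadratic_growth`; explicit second derivatives for the two
losses). Smoothing by a Gaussian spreads the curvature of `V`, so the smoothed loss grows linearly
in the variance (`exists_gaussLoss_var_growth`) and has second differences bounded below
quadratically near zero (`exists_gaussLoss_curved`). So excess at most `e` forces norms, latent
variances and offsets to within `O(√e)` of their oracle values (`exists_excess_bounds`).

The excess of an empirical minimizer is at most twice the uniform deviation of the empirical
objective. Subgaussian concentration and a union bound over a grid of mesh `1 / n` bound this
deviation (`exists_uniform_deviation`). The level `ε` is at least a constant times `(1 + √log (4 /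
δ)) / √n`, so the deviation `√(M ε)` already has failure probability at most `δ` for a large
constant `M`. The excess is thus `O(√ε)`, and its square root gives the rate `ε ^ (1 / 4)`.

Finally, error rates and bit accuracies depend only on the law of `Γ w x`. This law is Gaussian, its
mean and covariance are close to those of the oracle, and the latter covariance is a nonzero
multiple of the identity. Hence the two laws are close in total variation
(`exists_multivariateGaussian_tv`), which handles all thresholds, dictionaries and decoders at once.
-/

namespace Watermark

/-! ### Total variation of Gaussian laws near the standard one -/

section TotalVariation

variable {E : Type*} [NormedAddCommGroup E] [InnerProductSpace ℝ E]

variable (E) in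
/-- The Lebesgue density of the standard Gaussian law on `E`. -/
noncomputable def stdDensity (x : E) : ℝ :=
  (2 * Real.pi) ^ (-(Module.finrank ℝ E : ℝ) / 2) * Real.exp (-‖x‖ ^ 2 / 2)

lemma stdDensity_pos (x : E) : 0 < stdDensity E x := by
  unfold stdDensity; positivity

lemma continuous_stdDensity : Continuous (stdDensity E) := by
  unfold stdDensity; fun_prop

variable [FiniteDimensional ℝ E] [MeasurableSpace E] [BorelSpace E]

lemma integrable_exp_neg_mul_norm_sq {b : ℝ} (hb : 0 < b) :
    Integrable (fun x : E => Real.exp (-b * ‖x‖ ^ 2)) := by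
  have h := GaussianFourier.integrable_cexp_neg_mul_sq_norm_add (V := E) (b := (b : ℂ))
    (by simpa using hb) 0 0
  refine h.norm.congr (.of_forall fun x => ?_)
  simp only [zero_mul, add_zero, Complex.norm_exp]
  congr 1
  have : (-(b : ℂ) * (‖x‖ : ℂ) ^ 2) = ((-b * ‖x‖ ^ 2 : ℝ) : ℂ) := by push_cast; ring
  rw [this, Complex.ofReal_re]

lemma integrable_stdDensity : Integrable (stdDensity E) := by
  have := (integrable_exp_neg_mul_norm_sq (E := E) (b := 1 / 2) (by norm_num)).const_mul
    ((2 * Real.pi) ^ (-(Module.finrank ℝ E : ℝ) / 2))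
  refine this.congr (.of_forall fun x => ?_)
  simp only [stdDensity]
  ring_nf

lemma integral_stdDensity : ∫ x, stdDensity E x = 1 := by
  have h := GaussianFourier.integral_rexp_neg_mul_sq_norm (V := E) (b := 1 / 2) (by norm_num)
  have h2 : ∀ x : E, stdDensity E x = (2 * Real.pi) ^ (-(Module.finrank ℝ E : ℝ) / 2) *
      Real.exp (-(1 / 2) * ‖x‖ ^ 2) := fun x => by simp only [stdDensity]; ring_nf
  simp_rw [h2]
  rw [integral_const_mul, h, show Real.pi / (1 / 2) = 2 * Real.pi by ring,
    ← Real.rpow_add (by positivity)]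
  rw [show -(Module.finrank ℝ E : ℝ) / 2 + (Module.finrank ℝ E : ℝ) / 2 = 0 by ring, Real.rpow_zero]

-- Both sides are finite measures with the same characteristic function, by the Fourier transform of
-- a Gaussian.
variable (E) in
lemma stdGaussian_eq_withDensity :
    stdGaussian E = volume.withDensity (fun x => ENNReal.ofReal (stdDensity E x)) := by
  have hfin : IsFiniteMeasure (volume.withDensity (fun x => ENNReal.ofReal (stdDensity E x))) :=
    isFiniteMeasure_withDensity_ofReal integrable_stdDensity.2
  refine Measure.ext_of_charFun ?_
  ext t
  rw [charFun_stdGaussian, charFun_apply,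
    integral_withDensity_eq_integral_toReal_smul
      (by exact continuous_stdDensity.measurable.ennreal_ofReal)
      (.of_forall fun x => ENNReal.ofReal_lt_top)]
  have h := GaussianFourier.integral_cexp_neg_mul_sq_norm_add (V := E) (b := 1 / 2)
    (by norm_num) Complex.I t
  have h2 : ∀ x : E, (ENNReal.ofReal (stdDensity E x)).toReal •
      Complex.exp ((inner ℝ x t : ℝ) * Complex.I) =
      (((2 * Real.pi) ^ (-(Module.finrank ℝ E : ℝ) / 2) : ℝ) : ℂ) *
      Complex.exp (-(1 / 2) * ‖x‖ ^ 2 + Complex.I * (inner ℝ t x : ℝ)) := fun x => by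
    rw [ENNReal.toReal_ofReal (stdDensity_pos x).le, Complex.exp_add, stdDensity,
      real_inner_comm, Complex.real_smul]
    push_cast
    rw [mul_assoc]
    ring_nf
  simp_rw [h2]
  rw [integral_const_mul, h]
  have h3 : ((Real.pi : ℂ) / (1 / 2)) ^ ((Module.finrank ℝ E : ℂ) / 2) =
      (((2 * Real.pi) ^ ((Module.finrank ℝ E : ℝ) / 2) : ℝ) : ℂ) := by
    rw [Complex.ofReal_cpow (by positivity)]
    push_cast
    congr 1
    ring
  rw [h3, ← mul_assoc, ← Complex.ofReal_mul, ← Real.rpow_add (by positivity),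
    show -(Module.finrank ℝ E : ℝ) / 2 + (Module.finrank ℝ E : ℝ) / 2 = 0 by ring, Real.rpow_zero,
    Complex.I_sq]
  push_cast
  rw [one_mul]
  ring_nf

/-- The constant `∫ exp ((1 + ‖x‖²) / 4) dγ` of the total variation bound. -/
noncomputable def tvConst (E : Type*) [NormedAddCommGroup E] [InnerProductSpace ℝ E]
    [FiniteDimensional ℝ E] [MeasurableSpace E] [BorelSpace E] : ℝ :=
  8 * ∫ x : E, Real.exp ((1 + ‖x‖ ^ 2) / 4) * stdDensity E x

lemma integrable_exp_mul_stdDensity :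
    Integrable (fun x : E => Real.exp ((1 + ‖x‖ ^ 2) / 4) * stdDensity E x) := by
  have := (integrable_exp_neg_mul_norm_sq (E := E) (b := 1 / 4) (by norm_num)).const_mul
    (Real.exp (1 / 4) * (2 * Real.pi) ^ (-(Module.finrank ℝ E : ℝ) / 2))
  refine this.congr (.of_forall fun x => ?_)
  simp only [stdDensity]
  rw [show Real.exp (1 / 4) * (2 * Real.pi) ^ (-(Module.finrank ℝ E : ℝ) / 2) *
      Real.exp (-(1 / 4) * ‖x‖ ^ 2) = (2 * Real.pi) ^ (-(Module.finrank ℝ E : ℝ) / 2) *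
      (Real.exp (1 / 4) * Real.exp (-(1 / 4) * ‖x‖ ^ 2)) by ring, ← Real.exp_add,
    show Real.exp ((1 + ‖x‖ ^ 2) / 4) * ((2 * Real.pi) ^ (-(Module.finrank ℝ E : ℝ) / 2) *
      Real.exp (-‖x‖ ^ 2 / 2)) = (2 * Real.pi) ^ (-(Module.finrank ℝ E : ℝ) / 2) *
      (Real.exp ((1 + ‖x‖ ^ 2) / 4) * Real.exp (-‖x‖ ^ 2 / 2)) by ring, ← Real.exp_add]
  ring_nf

lemma tvConst_nonneg : 0 ≤ tvConst E :=
  mul_nonneg (by norm_num) (integral_nonneg fun x => by have := stdDensity_pos x; positivity)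

/-- Use `|1 - exp (-g)| ≤ |g| exp |g|`. Smallness of `η` gives `|g| ≤ (1 + q) / 8`, and the
remaining linear factor is absorbed into a second such exponential. With `q = ‖x‖ ^ 2` the resulting
exponent `(1 + q) / 4` stays integrable against the standard Gaussian, and the factor 8 is the one
in `tvConst`. -/
lemma abs_one_sub_exp_neg_le {g η q : ℝ} (hη : η ≤ 1 / 8) (hq : 0 ≤ q) (hg : |g| ≤ η * (1 + q)) :
    |1 - Real.exp (-g)| ≤ 8 * η * Real.exp ((1 + q) / 4) := by
  have hη0 : 0 ≤ η := by
    by_contra h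
    have := abs_nonneg g
    nlinarith
  have h1 : |1 - Real.exp (-g)| ≤ |g| * Real.exp |g| := by
    rcases le_total 0 g with h | h
    · rw [abs_of_nonneg h, abs_of_nonneg (by simp [h])]
      have h2 := Real.add_one_le_exp (-g)
      have h3 := Real.one_le_exp h
      nlinarith
    · rw [abs_of_nonpos h, abs_of_nonpos (by simp [h])]
      have h2 := Real.add_one_le_exp g
      have h3 : Real.exp (-g) * Real.exp g = 1 := by rw [← Real.exp_add]; simp
      have h4 := Real.exp_pos (-g)
      nlinarith
  have h2 : |g| ≤ (1 + q) / 8 := hg.trans (by nlinarith)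
  have h3 : (1 + q) / 8 ≤ Real.exp ((1 + q) / 8) := by
    linarith [Real.add_one_le_exp ((1 + q) / 8)]
  calc |1 - Real.exp (-g)| ≤ |g| * Real.exp |g| := h1
    _ ≤ (η * (1 + q)) * Real.exp ((1 + q) / 8) := by gcongr
    _ = 8 * η * (((1 + q) / 8) * Real.exp ((1 + q) / 8)) := by ring
    _ ≤ 8 * η * (Real.exp ((1 + q) / 8) * Real.exp ((1 + q) / 8)) := by gcongr
    _ = 8 * η * Real.exp ((1 + q) / 4) := by rw [← Real.exp_add]; ring_nf

/-- If an affine bijection distorts `‖x‖² / 2` by at most `η (1 + ‖x‖²)`, then it changes the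
standard Gaussian law by `O(η)` in total variation. -/
theorem stdGaussian_affine_tv {μ : E} {T : E →L[ℝ] E} (hT : T.det ≠ 0) {η : ℝ} (hη : η ≤ 1 / 8)
    (hη2 : tvConst E * η ≤ 1 / 2)
    (hg : ∀ x, |‖μ + T x‖ ^ 2 / 2 - ‖x‖ ^ 2 / 2| ≤ η * (1 + ‖x‖ ^ 2))
    {A : Set E} (hA : MeasurableSet A) :
    |((stdGaussian E).map (fun x => μ + T x)).real A - (stdGaussian E).real A|
      ≤ 4 * tvConst E * η := by
  have hη0 : 0 ≤ η := by
    have := (abs_nonneg _).trans (hg 0); simpa using this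
  set J : ℝ := |T.det| with hJ
  have hJ0 : 0 < J := abs_pos.2 hT
  have hinj : Function.Injective (fun x => μ + T x) := by
    intro x y hxy
    have : T x = T y := by simpa using hxy
    exact (LinearMap.equivOfDetNeZero (T : E →ₗ[ℝ] E) hT).injective this
  have hsurj : Function.Surjective (fun x => μ + T x) := by
    intro y
    obtain ⟨x, hx⟩ := (LinearMap.equivOfDetNeZero (T : E →ₗ[ℝ] E) hT).surjective (y - μ)
    refine ⟨x, ?_⟩
    have : T x = y - μ := hx
    simp [this]
  have hcov : ∀ g : E → ℝ, ∫ x, g x = ∫ x, J * g (μ + T x) := by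
    intro g
    have := integral_image_eq_integral_abs_det_fderiv_smul (volume : Measure E) (s := Set.univ)
      MeasurableSet.univ (f := fun x => μ + T x) (f' := fun _ => T)
      (fun x _ => (T.hasFDerivAt.const_add μ).hasFDerivWithinAt) hinj.injOn g
    simpa [Set.image_univ, hsurj.range_eq] using this
  have hmeas : Measurable (fun x => μ + T x) := by fun_prop
  have hreal : ∀ B : Set E, MeasurableSet B →
      (stdGaussian E).real B = ∫ x, B.indicator (stdDensity E) x := by
    intro B hB
    rw [stdGaussian_eq_withDensity E, measureReal_def, withDensity_apply _ hB,
      integral_indicator hB, integral_eq_lintegral_of_nonneg_ae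
        (.of_forall fun x => (stdDensity_pos x).le)
        continuous_stdDensity.aestronglyMeasurable]
  set g : E → ℝ := fun x => ‖μ + T x‖ ^ 2 / 2 - ‖x‖ ^ 2 / 2 with hgdef
  have hden : ∀ x, stdDensity E (μ + T x) = Real.exp (-g x) * stdDensity E x := by
    intro x
    simp only [stdDensity, hgdef]
    rw [mul_left_comm, ← Real.exp_add]
    ring_nf
  have hbd : ∀ x, |1 - Real.exp (-g x)| * stdDensity E x ≤
      8 * η * (Real.exp ((1 + ‖x‖ ^ 2) / 4) * stdDensity E x) := fun x => by
    have := abs_one_sub_exp_neg_le hη (by positivity : 0 ≤ ‖x‖ ^ 2) (hg x)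
    nlinarith [stdDensity_pos x]
  have hcont : Continuous g := by fun_prop
  have hi : Integrable (fun x => (1 - Real.exp (-g x)) * stdDensity E x) := by
    refine (integrable_exp_mul_stdDensity.const_mul (8 * η)).mono'
      (by have := continuous_stdDensity (E := E); fun_prop) (.of_forall fun x => ?_)
    rw [Real.norm_eq_abs, abs_mul, abs_of_pos (stdDensity_pos x)]
    exact hbd x
  have hiB : ∫ x, |1 - Real.exp (-g x)| * stdDensity E x ≤ tvConst E * η := by
    have := integral_mono (μ := volume) (by
      refine hi.abs.congr (.of_forall fun x => ?_)
      simp only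
      rw [abs_mul, abs_of_pos (stdDensity_pos x)]) (integrable_exp_mul_stdDensity.const_mul (8 * η))
      hbd
    rw [integral_const_mul] at this
    unfold tvConst
    linarith
  have hie : Integrable (fun x => Real.exp (-g x) * stdDensity E x) := by
    refine (integrable_stdDensity.sub hi).congr (.of_forall fun x => ?_)
    simp only [Pi.sub_apply]; ring
  set I : ℝ := ∫ x, Real.exp (-g x) * stdDensity E x with hI
  -- The determinant needs no direct estimate: changing variables in the total mass of the density
  -- gives `J * I = 1`, and `I` is within `tvConst E * η` of 1.
  have hJI : J * I = 1 := by
    rw [← integral_stdDensity (E := E), hcov (stdDensity E), integral_const_mul]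
    simp_rw [hden]
    rw [hI]
  have h1I : |1 - I| ≤ tvConst E * η := by
    have : 1 - I = ∫ x, (1 - Real.exp (-g x)) * stdDensity E x := by
      simp_rw [sub_mul, one_mul]
      rw [integral_sub integrable_stdDensity hie, integral_stdDensity]
    rw [this]
    refine (abs_integral_le_integral_abs).trans (le_trans (le_of_eq ?_) hiB)
    congr 1; ext x
    rw [abs_mul, abs_of_pos (stdDensity_pos x)]
  have hI2 : 1 / 2 ≤ I := by linarith [(abs_le.1 h1I).2]
  have hJ2 : J ≤ 2 := by nlinarith
  have h1J : |1 - J| ≤ tvConst E * η * J := by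
    have : 1 - J = -(J * (1 - I)) := by linear_combination -hJI
    rw [this, abs_neg, abs_mul, abs_of_pos hJ0, mul_comm]
    gcongr
  -- After the change of variables both probabilities are integrals over the same preimage of `A`.
  -- The integrands differ by `(1 - J)` times the density plus `J (1 - exp (-g))` times the density.
  rw [map_measureReal_apply hmeas hA, hreal _ (hmeas hA), hreal _ hA,
    hcov (A.indicator (stdDensity E)), ← integral_sub]
  · have hb2 : ∀ x, |((fun x => μ + T x) ⁻¹' A).indicator (stdDensity E) x
        - J * A.indicator (stdDensity E) (μ + T x)| ≤
        |1 - J| * stdDensity E x + J * (|1 - Real.exp (-g x)| * stdDensity E x) := by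
      intro x
      have hp := stdDensity_pos x
      by_cases hx : μ + T x ∈ A
      · rw [Set.indicator_of_mem (by exact hx), Set.indicator_of_mem hx, hden]
        rw [show stdDensity E x - J * (Real.exp (-g x) * stdDensity E x) =
          (1 - J) * stdDensity E x + J * ((1 - Real.exp (-g x)) * stdDensity E x) by ring]
        refine (abs_add_le _ _).trans (le_of_eq ?_)
        rw [abs_mul, abs_mul, abs_mul, abs_of_pos hp, abs_of_pos hJ0]
      · rw [Set.indicator_of_notMem (by exact hx), Set.indicator_of_notMem hx]
        simp only [mul_zero, sub_zero, abs_zero]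
        positivity
    have hi' : Integrable (fun x => |1 - Real.exp (-g x)| * stdDensity E x) := by
      refine hi.abs.congr (.of_forall fun x => ?_)
      simp only
      rw [abs_mul, abs_of_pos (stdDensity_pos x)]
    refine (abs_integral_le_integral_abs).trans ?_
    refine (integral_mono_of_nonneg (.of_forall fun x => abs_nonneg _)
      ((integrable_stdDensity.const_mul |1 - J|).add (hi'.const_mul J)) (.of_forall hb2)).trans ?_
    have h0 := tvConst_nonneg (E := E)
    simp only [Pi.add_apply]
    rw [integral_add (integrable_stdDensity.const_mul |1 - J|) (hi'.const_mul J),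
      integral_const_mul, integral_const_mul, integral_stdDensity]
    have := mul_nonneg h0 hη0
    nlinarith [mul_le_mul_of_nonneg_left hiB hJ0.le, mul_le_mul_of_nonneg_left hJ2 this]
  · exact integrable_stdDensity.indicator (hmeas hA)
  · have : (fun x => J * A.indicator (stdDensity E) (μ + T x)) =
        ((fun x => μ + T x) ⁻¹' A).indicator
          (fun x => J * (Real.exp (-g x) * stdDensity E x)) := by
      ext x
      by_cases hx : μ + T x ∈ A
      · have hx' : x ∈ (fun x => μ + T x) ⁻¹' A := hx
        rw [Set.indicator_of_mem hx, Set.indicator_of_mem hx', hden]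
      · have hx' : x ∉ (fun x => μ + T x) ⁻¹' A := hx
        rw [Set.indicator_of_notMem hx, Set.indicator_of_notMem hx', mul_zero]
    rw [this]
    exact (hie.const_mul J).indicator (hmeas hA)

open scoped MatrixOrder in
/-- Total variation distance of `N(μ, S)` from the standard Gaussian law, when `μ` is close to `0`
and `S` is close to the identity. -/
theorem exists_multivariateGaussian_tv (K : ℕ) : ∃ C > (0 : ℝ), ∀ (ζ : ℝ)
    (μ : EuclideanSpace ℝ (Fin K)) (S : Matrix (Fin K) (Fin K) ℝ), S.PosSemidef → ‖μ‖ ≤ ζ →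
    (∀ x : EuclideanSpace ℝ (Fin K), |x.ofLp ⬝ᵥ S *ᵥ x.ofLp - ‖x‖ ^ 2| ≤ ζ * ‖x‖ ^ 2) →
    ∀ A : Set (EuclideanSpace ℝ (Fin K)), MeasurableSet A →
      |(multivariateGaussian μ S).real A - (stdGaussian (EuclideanSpace ℝ (Fin K))).real A|
        ≤ C * ζ := by
  set c := tvConst (EuclideanSpace ℝ (Fin K)) with hc
  have hc0 : 0 ≤ c := tvConst_nonneg
  -- The term `8 * c` is the affine bound with `η = 2 * ζ`. The terms `16` and `4 * c` make the
  -- bound exceed 1, hence trivial, as soon as one of the two smallness conditions on `ζ` fails.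
  refine ⟨8 * c + 16 + 4 * c, by positivity, fun ζ μ S hS hμ hSx A hA => ?_⟩
  have hζ : 0 ≤ ζ := (norm_nonneg _).trans hμ
  by_cases hsmall : ζ ≤ 1 / 16 ∧ c * (2 * ζ) ≤ 1 / 2
  swap
  · have h1 : |(multivariateGaussian μ S).real A -
        (stdGaussian (EuclideanSpace ℝ (Fin K))).real A| ≤ 1 := by
      rw [abs_le]
      constructor <;>
      linarith [measureReal_le_one (μ := multivariateGaussian μ S) (s := A),
        measureReal_le_one (μ := stdGaussian (EuclideanSpace ℝ (Fin K))) (s := A),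
        measureReal_nonneg (μ := multivariateGaussian μ S) (s := A),
        measureReal_nonneg (μ := stdGaussian (EuclideanSpace ℝ (Fin K))) (s := A)]
    refine h1.trans ?_
    rw [not_and_or, not_le, not_le] at hsmall
    rcases hsmall with h | h <;> nlinarith [mul_nonneg hc0 hζ]
  obtain ⟨hs1, hs2⟩ := hsmall
  -- `multivariateGaussian μ S` is the image of the standard Gaussian under `x ↦ μ + √S x`. The
  -- closeness of `S` to the identity makes `√S` injective.
  set T := Matrix.toEuclideanCLM (𝕜 := ℝ) (CFC.sqrt S) with hT
  have hTsq : ∀ x, ‖T x‖ ^ 2 = x.ofLp ⬝ᵥ S *ᵥ x.ofLp := by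
    intro x
    rw [← real_inner_self_eq_norm_sq, ← ContinuousLinearMap.adjoint_inner_right,
      IsSelfAdjoint.adjoint_eq, ← ContinuousLinearMap.comp_apply, ← ContinuousLinearMap.mul_def,
      hT, ← map_mul, CFC.sqrt_mul_sqrt_self _ hS.nonneg, Matrix.inner_toEuclideanCLM]
    exact (CFC.sqrt_nonneg S).isSelfAdjoint.map _
  have hinj : Function.Injective (T : EuclideanSpace ℝ (Fin K) →ₗ[ℝ] EuclideanSpace ℝ (Fin K)) := by
    rw [← LinearMap.ker_eq_bot, LinearMap.ker_eq_bot']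
    intro x hx
    have h0 : ‖T x‖ ^ 2 = 0 := by
      rw [show T x = 0 from hx]; simp
    have h1 := (abs_le.1 (hSx x)).1
    rw [← hTsq, h0] at h1
    have : ‖x‖ ^ 2 ≤ 0 := by nlinarith [sq_nonneg ‖x‖]
    have : ‖x‖ = 0 := by nlinarith [sq_nonneg ‖x‖]
    simpa using this
  have hdet : T.det ≠ 0 := by
    have := (LinearEquiv.ofInjectiveEndo _ hinj).isUnit_det'
    exact this.ne_zero
  have := stdGaussian_affine_tv (μ := μ) hdet (η := 2 * ζ) (by linarith) hs2 (fun x => by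
    have h1 := abs_le.1 (hSx x)
    rw [← hTsq] at h1
    have h2 : ‖μ + T x‖ ^ 2 = ‖μ‖ ^ 2 + 2 * inner ℝ μ (T x) + ‖T x‖ ^ 2 := norm_add_sq_real μ (T x)
    have h3 := abs_le.1 (abs_real_inner_le_norm μ (T x))
    have h4 : ‖T x‖ ≤ 1 + ‖x‖ ^ 2 := by
      nlinarith [sq_nonneg (‖T x‖ - 1), sq_nonneg ‖x‖, norm_nonneg (T x)]
    have h5 : ‖μ‖ * ‖T x‖ ≤ ζ * (1 + ‖x‖ ^ 2) := by gcongr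
    have h6 : ‖μ‖ ^ 2 ≤ ζ := by nlinarith [norm_nonneg μ]
    have h7 : 0 ≤ ζ * ‖x‖ ^ 2 := by positivity
    rw [abs_le]
    constructor <;> nlinarith [sq_nonneg ‖μ‖]) hA
  refine this.trans ?_
  nlinarith [mul_nonneg hc0 hζ]

end TotalVariation

/-! ### Laws of linear statistics of the image -/

section Law

variable {K D d : ℕ} (B : Matrix (Fin D) (Fin d) ℝ) (SZ : Matrix (Fin d) (Fin d) ℝ) (σ : ℝ)

/-- The covariance form of the signal part `B Z` of the image. -/
noncomputable def latentForm : LinearMap.BilinForm ℝ (Img D) :=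
  LinearMap.mk₂ ℝ (fun a b => (Bᵀ *ᵥ a.ofLp) ⬝ᵥ SZ *ᵥ (Bᵀ *ᵥ b.ofLp))
    (fun a a' b => by simp [Matrix.mulVec_add, add_dotProduct])
    (fun c a b => by simp [Matrix.mulVec_smul])
    (fun a b b' => by simp [Matrix.mulVec_add, dotProduct_add])
    (fun c a b => by simp [Matrix.mulVec_smul])

/-- The covariance form of the image. -/
noncomputable def imageForm : LinearMap.BilinForm ℝ (Img D) :=
  latentForm B SZ + σ ^ 2 • innerₗ (Img D)

lemma latentForm_apply (a b : Img D) :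
    latentForm B SZ a b = (Bᵀ *ᵥ a.ofLp) ⬝ᵥ SZ *ᵥ (Bᵀ *ᵥ b.ofLp) := rfl

lemma imageForm_apply (a b : Img D) :
    imageForm B SZ σ a b = latentForm B SZ a b + σ ^ 2 * inner ℝ a b := rfl

variable {B SZ σ}

lemma latentForm_nonneg (hSZ : SZ.PosSemidef) (a : Img D) : 0 ≤ latentForm B SZ a a := by
  rw [latentForm_apply]
  simpa using hSZ.dotProduct_mulVec_nonneg (Bᵀ *ᵥ a.ofLp)

lemma latentForm_comm (hSZ : SZ.PosSemidef) (a b : Img D) :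
    latentForm B SZ a b = latentForm B SZ b a := by
  have h : SZᵀ = SZ := by simpa using hSZ.isHermitian.eq
  rw [latentForm_apply, latentForm_apply, dotProduct_comm, ← Matrix.vecMul_transpose, h,
    ← Matrix.dotProduct_mulVec]

/-- Nonnegativity of the form at `a + b` and `a - b`. It bounds the off-diagonal latent covariances
by the diagonal ones. -/
lemma two_mul_abs_latentForm_le (hSZ : SZ.PosSemidef) (a b : Img D) :
    2 * |latentForm B SZ a b| ≤ latentForm B SZ a a + latentForm B SZ b b := by
  have h1 := latentForm_nonneg (B := B) hSZ (a + b)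
  have h2 := latentForm_nonneg (B := B) hSZ (a - b)
  have h3 := latentForm_comm (B := B) hSZ a b
  simp only [map_add, map_sub, LinearMap.add_apply, LinearMap.sub_apply] at h1 h2
  rcases abs_cases (latentForm B SZ a b) with h | h <;> linarith

lemma imageForm_nonneg (hSZ : SZ.PosSemidef) (a : Img D) : 0 ≤ imageForm B SZ σ a a := by
  rw [imageForm_apply, real_inner_self_eq_norm_sq]
  have := latentForm_nonneg (B := B) hSZ a
  positivity

lemma imageForm_comm (hSZ : SZ.PosSemidef) (a b : Img D) :
    imageForm B SZ σ a b = imageForm B SZ σ b a := by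
  rw [imageForm_apply, imageForm_apply, latentForm_comm hSZ, real_inner_comm]

instance isProbabilityMeasure_imageLaw : IsProbabilityMeasure (imageLaw B SZ σ) := by
  unfold imageLaw
  refine Measure.isProbabilityMeasure_map (Measurable.aemeasurable ?_)
  have : Measurable (fun z : EuclideanSpace ℝ (Fin d) => WithLp.toLp 2 (B *ᵥ z.ofLp)) := by
    have := (Matrix.toEuclideanLin (𝕜 := ℝ) B).toContinuousLinearMap.continuous.measurable
    exact this
  exact (this.comp measurable_fst).add measurable_snd

/-- The image law is the convolution of the law of `B Z` with that of the noise, so characteristic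
functions multiply. The laws of all linear statistics follow from this formula. -/
lemma charFun_imageLaw (hSZ : SZ.PosSemidef) (t : Img D) :
    charFun (imageLaw B SZ σ) t = Complex.exp (-(imageForm B SZ σ t t : ℝ) / 2) := by
  have hm : Measurable (fun z : EuclideanSpace ℝ (Fin d) => WithLp.toLp 2 (B *ᵥ z.ofLp)) := by
    have := (Matrix.toEuclideanLin (𝕜 := ℝ) B).toContinuousLinearMap.continuous.measurable
    exact this
  have h1 : imageLaw B SZ σ =
      ((multivariateGaussian (0 : EuclideanSpace ℝ (Fin d)) SZ).map
        (fun z => WithLp.toLp 2 (B *ᵥ z.ofLp))) ∗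
      (multivariateGaussian (0 : Img D) (σ ^ 2 • (1 : Matrix (Fin D) (Fin D) ℝ))) := by
    have h := Measure.map_prod_map
      (multivariateGaussian (0 : EuclideanSpace ℝ (Fin d)) SZ)
      (multivariateGaussian (0 : Img D) (σ ^ 2 • (1 : Matrix (Fin D) (Fin D) ℝ))) hm measurable_id
    rw [Measure.map_id] at h
    rw [Measure.conv, h, Measure.map_map (by fun_prop) (by fun_prop)]
    rfl
  have : IsProbabilityMeasure ((multivariateGaussian (0 : EuclideanSpace ℝ (Fin d)) SZ).map
        (fun z => WithLp.toLp 2 (B *ᵥ z.ofLp))) :=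
    Measure.isProbabilityMeasure_map hm.aemeasurable
  have h2 : charFun ((multivariateGaussian (0 : EuclideanSpace ℝ (Fin d)) SZ).map
        (fun z => WithLp.toLp 2 (B *ᵥ z.ofLp))) t =
      charFun (multivariateGaussian (0 : EuclideanSpace ℝ (Fin d)) SZ)
        (WithLp.toLp 2 (Bᵀ *ᵥ t.ofLp)) := by
    rw [charFun_apply, charFun_apply, integral_map hm.aemeasurable (by fun_prop)]
    congr 1
    ext z
    congr 3
    rw [EuclideanSpace.inner_eq_star_dotProduct, EuclideanSpace.inner_eq_star_dotProduct]
    simp only [star_trivial]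
    rw [Matrix.dotProduct_mulVec, ← Matrix.mulVec_transpose]
  have hI : (σ ^ 2 • (1 : Matrix (Fin D) (Fin D) ℝ)).PosSemidef :=
    Matrix.PosSemidef.one.smul (sq_nonneg σ)
  rw [h1, charFun_conv, h2, charFun_multivariateGaussian hSZ, charFun_multivariateGaussian hI,
    ← Complex.exp_add, imageForm_apply, latentForm_apply]
  congr 1
  have h3 : t.ofLp ⬝ᵥ (σ ^ 2 • (1 : Matrix (Fin D) (Fin D) ℝ)) *ᵥ t.ofLp = σ ^ 2 * inner ℝ t t := by
    rw [Matrix.smul_mulVec, Matrix.one_mulVec, dotProduct_smul,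
      EuclideanSpace.inner_eq_star_dotProduct]
    simp
  rw [h3]
  simp only [inner_zero_right]
  push_cast
  ring

/-- A linear functional of the image is Gaussian. -/
lemma map_inner_imageLaw (hSZ : SZ.PosSemidef) (a : Img D) :
    (imageLaw B SZ σ).map (fun x => inner ℝ a x) =
      gaussianReal 0 (imageForm B SZ σ a a).toNNReal := by
  have : IsProbabilityMeasure ((imageLaw B SZ σ).map (fun x => inner ℝ a x)) :=
    Measure.isProbabilityMeasure_map (by fun_prop)
  refine Measure.ext_of_charFun ?_
  ext u
  have h : charFun ((imageLaw B SZ σ).map (fun x => inner ℝ a x)) u =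
      charFun (imageLaw B SZ σ) (u • a) := by
    rw [charFun_apply, charFun_apply, integral_map (by fun_prop) (by fun_prop)]
    congr 1
    ext x
    congr 3
    rw [real_inner_smul_right, real_inner_comm x a, RCLike.inner_apply]
    simp
  rw [h, charFun_imageLaw hSZ, charFun_gaussianReal, Real.coe_toNNReal _ (imageForm_nonneg hSZ a)]
  congr 1
  simp only [map_smul, LinearMap.smul_apply, smul_eq_mul]
  push_cast
  ring

/-- The quadratic form of the Gram matrix at `x` is the image form at `∑ k, x k • w k`. -/
lemma gram_posSemidef (hSZ : SZ.PosSemidef) (w : Fin K → Img D) :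
    (Matrix.of fun j k => imageForm B SZ σ (w j) (w k)).PosSemidef := by
  refine Matrix.PosSemidef.of_dotProduct_mulVec_nonneg ?_ fun x => ?_
  · ext j k
    simpa using imageForm_comm hSZ (w k) (w j)
  · have h := imageForm_nonneg (B := B) (σ := σ) hSZ (∑ k, x k • w k)
    refine h.trans (le_of_eq ?_)
    simp only [dotProduct, Matrix.mulVec, map_sum, LinearMap.sum_apply, map_smul,
      LinearMap.smul_apply, Finset.mul_sum, Matrix.of_apply, smul_eq_mul, Pi.star_apply,
      star_trivial]
    rw [Finset.sum_comm]
    refine Finset.sum_congr rfl fun j _ => Finset.sum_congr rfl fun k _ => ?_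
    ring

/-- The law of an affine image of the inner products of the image with a watermark. -/
lemma map_Γ_imageLaw (hSZ : SZ.PosSemidef) (w : Fin K → Img D) (c : ℝ)
    (μ : EuclideanSpace ℝ (Fin K)) :
    (imageLaw B SZ σ).map (fun x => μ + c • WithLp.toLp 2 (Γ w x)) =
      multivariateGaussian μ (Matrix.of fun j k => imageForm B SZ σ (c • w j) (c • w k)) := by
  have hm : Measurable (fun x : Img D => μ + c • WithLp.toLp 2 (Γ w x)) := by
    unfold Γ; fun_prop
  have : IsProbabilityMeasure
      ((imageLaw B SZ σ).map (fun x => μ + c • WithLp.toLp 2 (Γ w x))) :=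
    Measure.isProbabilityMeasure_map hm.aemeasurable
  refine Measure.ext_of_charFun ?_
  ext t
  rw [charFun_multivariateGaussian (gram_posSemidef hSZ fun k => c • w k), charFun_apply,
    integral_map hm.aemeasurable (by fun_prop)]
  have h : ∀ x, (inner ℝ (μ + c • WithLp.toLp 2 (Γ w x)) t : ℝ) =
      inner ℝ t μ + inner ℝ x (∑ k, t k • c • w k) := by
    intro x
    rw [inner_add_left, real_inner_comm, inner_smul_left, inner_sum]
    congr 1
    rw [PiLp.inner_apply, Finset.mul_sum]
    refine Finset.sum_congr rfl fun k _ => ?_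
    rw [inner_smul_right, inner_smul_right, real_inner_comm (w k) x, RCLike.inner_apply]
    simp only [Γ, conj_trivial]
    ring
  simp_rw [h]
  push_cast
  simp_rw [add_mul, Complex.exp_add]
  rw [integral_const_mul, ← charFun_apply, charFun_imageLaw hSZ, ← Complex.exp_add]
  congr 1
  have h2 : imageForm B SZ σ (∑ k, t k • c • w k) (∑ k, t k • c • w k) =
      t.ofLp ⬝ᵥ (Matrix.of fun j k => imageForm B SZ σ (c • w j) (c • w k)) *ᵥ t.ofLp := by
    simp only [dotProduct, Matrix.mulVec, map_sum, LinearMap.sum_apply, map_smul,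
      LinearMap.smul_apply, Finset.mul_sum, Matrix.of_apply, smul_eq_mul]
    rw [Finset.sum_comm]
    refine Finset.sum_congr rfl fun j _ => Finset.sum_congr rfl fun k _ => ?_
    ring
  rw [h2]
  ring

end Law

/-! ### Gaussian averages of convex losses -/

/-- A nonnegative convex `1`-Lipschitz function that is curved near the origin, in an averaged
sense. -/
structure RegularLoss (V : ℝ → ℝ) : Prop where
  lipschitz : LipschitzWith 1 V
  convex : ConvexOn ℝ Set.univ V
  nonneg : ∀ x, 0 ≤ V x
  curved : ∃ κ > 0, ∀ c, |c| ≤ 1 →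
    κ * c ^ 2 ≤ ∫ x in Set.Icc (-2) 2, (V (x + c) + V (x - c) - 2 * V x)

/-- The Gaussian average `𝔼 V (u + √v Z)`. -/
noncomputable def gaussLoss (V : ℝ → ℝ) (u : ℝ) (v : NNReal) : ℝ := ∫ x, V x ∂gaussianReal u v

section GaussLoss

open scoped NNReal

variable {V : ℝ → ℝ}

lemma abs_sub_le_of_lipschitz (hV : LipschitzWith 1 V) (a b : ℝ) : |V a - V b| ≤ |a - b| := by
  simpa [Real.dist_eq] using hV.dist_le_mul a b

lemma integrable_of_lipschitz (hV : LipschitzWith 1 V) {μ : Measure ℝ} [IsFiniteMeasure μ]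
    (hμ : Integrable id μ) : Integrable V μ := by
  refine ((integrable_const |V 0|).add hμ.abs).mono' hV.continuous.aestronglyMeasurable
    (.of_forall fun x => ?_)
  have := abs_sub_le_of_lipschitz hV x 0
  simp only [Pi.add_apply, id_eq, Real.norm_eq_abs]
  have h2 := abs_sub_abs_le_abs_sub (V x) (V 0)
  simp only [sub_zero] at this
  linarith

lemma integrable_id_gaussianReal (u : ℝ) (v : ℝ≥0) : Integrable id (gaussianReal u v) :=
  memLp_one_iff_integrable.1 (memLp_id_gaussianReal 1)

lemma integrable_gaussianReal_of_lipschitz (hV : LipschitzWith 1 V) (u : ℝ) (v : ℝ≥0) :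
    Integrable V (gaussianReal u v) :=
  integrable_of_lipschitz hV (integrable_id_gaussianReal u v)

lemma lipschitz_comp_add (hV : LipschitzWith 1 V) (c : ℝ) : LipschitzWith 1 (fun x => V (x + c)) :=
  LipschitzWith.of_dist_le_mul fun a b => by
    simpa [Real.dist_eq] using abs_sub_le_of_lipschitz hV (a + c) (b + c)

lemma gaussLoss_add (hV : LipschitzWith 1 V) (u c : ℝ) (v : ℝ≥0) :
    gaussLoss V (u + c) v = ∫ x, V (x + c) ∂gaussianReal u v := by
  unfold gaussLoss
  rw [← gaussianReal_map_add_const, integral_map (by fun_prop)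
    hV.continuous.aestronglyMeasurable]

lemma lipschitz_gaussLoss (hV : LipschitzWith 1 V) (v : ℝ≥0) :
    LipschitzWith 1 (fun u => gaussLoss V u v) := by
  refine LipschitzWith.of_dist_le_mul fun a b => ?_
  have ha := gaussLoss_add hV 0 a v
  have hb := gaussLoss_add hV 0 b v
  rw [zero_add] at ha hb
  rw [Real.dist_eq, Real.dist_eq, ha, hb, ← integral_sub
    (integrable_gaussianReal_of_lipschitz (lipschitz_comp_add hV a) 0 v)
    (integrable_gaussianReal_of_lipschitz (lipschitz_comp_add hV b) 0 v)]
  refine abs_integral_le_integral_abs.trans ?_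
  refine (integral_mono_of_nonneg (g := fun _ => |a - b|) (.of_forall fun x => abs_nonneg _)
    (integrable_const _) (.of_forall fun x => ?_)).trans (by simp)
  simpa using abs_sub_le_of_lipschitz hV (x + a) (x + b)

/-- Extra variance is an independent centered Gaussian shift of the mean, because Gaussian laws
convolve. -/
lemma gaussLoss_add_var (hV : LipschitzWith 1 V) (u : ℝ) (v τ : ℝ≥0) :
    gaussLoss V u (v + τ) = ∫ y, gaussLoss V (u + y) v ∂gaussianReal 0 τ := by
  have h : gaussianReal u (v + τ) = gaussianReal 0 τ ∗ gaussianReal u v := by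
    rw [gaussianReal_conv_gaussianReal, zero_add, add_comm]
  rw [gaussLoss, h, integral_conv]
  · congr 1
    ext y
    rw [gaussLoss_add hV]
    simp_rw [add_comm y]
  · rw [← h]
    exact integrable_gaussianReal_of_lipschitz hV _ _

lemma second_diff_nonneg (hV : ConvexOn ℝ Set.univ V) (x c : ℝ) :
    0 ≤ V (x + c) + V (x - c) - 2 * V x := by
  have := hV.2 (Set.mem_univ (x + c)) (Set.mem_univ (x - c)) (by norm_num : (0 : ℝ) ≤ 1 / 2)
    (by norm_num : (0 : ℝ) ≤ 1 / 2) (by norm_num)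
  simp only [smul_eq_mul] at this
  rw [show 1 / 2 * (x + c) + 1 / 2 * (x - c) = x by ring] at this
  linarith

/-- For `c ≥ 1` the points `x ± 1` are convex combinations of `x ± c`, with weights `(1 ± c⁻¹) / 2`.
-/
lemma second_diff_mono (hV : ConvexOn ℝ Set.univ V) (x : ℝ) {c : ℝ} (hc : 1 ≤ c) :
    V (x + 1) + V (x - 1) ≤ V (x + c) + V (x - c) := by
  have hc0 : 0 < c := by linarith
  have hc1 : c⁻¹ ≤ 1 := inv_le_one_of_one_le₀ hc
  have hc2 : 0 < c⁻¹ := inv_pos.2 hc0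
  have hcc : c⁻¹ * c = 1 := inv_mul_cancel₀ hc0.ne'
  have h1 := hV.2 (Set.mem_univ (x + c)) (Set.mem_univ (x - c))
    (by linarith : 0 ≤ (1 + c⁻¹) / 2) (by linarith : 0 ≤ (1 - c⁻¹) / 2) (by ring)
  have h2 := hV.2 (Set.mem_univ (x + c)) (Set.mem_univ (x - c))
    (by linarith : 0 ≤ (1 - c⁻¹) / 2) (by linarith : 0 ≤ (1 + c⁻¹) / 2) (by ring)
  simp only [smul_eq_mul] at h1 h2
  rw [show (1 + c⁻¹) / 2 * (x + c) + (1 - c⁻¹) / 2 * (x - c) = x + c⁻¹ * c by ring, hcc] at h1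
  rw [show (1 - c⁻¹) / 2 * (x + c) + (1 + c⁻¹) / 2 * (x - c) = x - c⁻¹ * c by ring, hcc] at h2
  linarith

lemma second_diff_unit_le (hV : ConvexOn ℝ Set.univ V) (x : ℝ) {c : ℝ} (hc : 1 ≤ |c|) :
    V (x + 1) + V (x - 1) - 2 * V x ≤ V (x + c) + V (x - c) - 2 * V x := by
  have := second_diff_mono hV x hc
  rcases abs_cases c with ⟨h, -⟩ | ⟨h, -⟩ <;> rw [h] at this
  · linarith
  · rw [sub_neg_eq_add, ← sub_eq_add_neg] at this; linarith

/-- For `|c| ≥ 1` the second difference dominates the one at step 1, so the quadratic bound survives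
once it is capped at 1. -/
lemma RegularLoss.curved_all (hV : RegularLoss V) : ∃ κ > 0, ∀ c,
    κ * min (c ^ 2) 1 ≤ ∫ x in Set.Icc (-2) 2, (V (x + c) + V (x - c) - 2 * V x) := by
  obtain ⟨κ, hκ, h⟩ := hV.curved
  refine ⟨κ, hκ, fun c => ?_⟩
  have hcont := hV.lipschitz.continuous
  have hint : ∀ c, IntegrableOn (fun x => V (x + c) + V (x - c) - 2 * V x) (Set.Icc (-2) 2) :=
    fun c => (by fun_prop : Continuous fun x =>
      V (x + c) + V (x - c) - 2 * V x).continuousOn.integrableOn_compact isCompact_Icc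
  rcases le_total |c| 1 with hc | hc
  · have h1 : c ^ 2 ≤ 1 := by rw [← sq_abs]; nlinarith [abs_nonneg c]
    rw [min_eq_left h1]
    exact h c hc
  · have h1 : 1 ≤ c ^ 2 := by rw [← sq_abs]; nlinarith [abs_nonneg c]
    rw [min_eq_right h1]
    have h2 := h 1 (by simp)
    rw [one_pow] at h2
    exact h2.trans (setIntegral_mono (hint 1) (hint c) fun x => second_diff_unit_le hV.convex x hc)

lemma gaussLoss_second_diff (hV : LipschitzWith 1 V) (u c : ℝ) (v : ℝ≥0) :
    gaussLoss V (u + c) v + gaussLoss V (u - c) v - 2 * gaussLoss V u v =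
      ∫ x, (V (x + c) + V (x - c) - 2 * V x) ∂gaussianReal u v := by
  rw [sub_eq_add_neg u c, gaussLoss_add hV, gaussLoss_add hV]
  have h1 := integrable_gaussianReal_of_lipschitz (lipschitz_comp_add hV c) u v
  have h2 := integrable_gaussianReal_of_lipschitz (lipschitz_comp_add hV (-c)) u v
  have h3 := integrable_gaussianReal_of_lipschitz hV u v
  simp_rw [sub_eq_add_neg _ c]
  rw [integral_sub (f := fun x => V (x + c) + V (x + -c)) (h1.add h2) (h3.const_mul 2),
    integral_add h1 h2, integral_const_mul]
  rfl

lemma gaussLoss_second_diff_nonneg (hV : RegularLoss V) (u c : ℝ) (v : ℝ≥0) :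
    0 ≤ gaussLoss V (u + c) v + gaussLoss V (u - c) v - 2 * gaussLoss V u v := by
  rw [gaussLoss_second_diff hV.lipschitz]
  exact integral_nonneg fun x => second_diff_nonneg hV.convex x c

/-- A density bound uniform over bounded means and over variances in `[v₀, v₁]`. It transfers
curvature from Lebesgue measure on the window `[-2, 2]` to every such Gaussian average. -/
lemma gaussianPDFReal_ge {U v₀ v₁ : ℝ} (hv₀ : 0 < v₀) {u : ℝ} {v : ℝ≥0} (hu : |u| ≤ U)
    (h0 : v₀ ≤ v) (h1 : v ≤ v₁) {x : ℝ} (hx : x ∈ Set.Icc (-2) (2 : ℝ)) :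
    (Real.sqrt (2 * Real.pi * v₁))⁻¹ * Real.exp (-(2 + U) ^ 2 / (2 * v₀)) ≤
      gaussianPDFReal u v x := by
  have hv : 0 < (v : ℝ) := hv₀.trans_le h0
  have hU : 0 ≤ U := (abs_nonneg u).trans hu
  have hxu : (x - u) ^ 2 ≤ (2 + U) ^ 2 := by
    rw [← sq_abs (x - u)]
    have : |x - u| ≤ 2 + U := (abs_sub x u).trans (add_le_add (abs_le.2 ⟨hx.1, hx.2⟩) hu)
    gcongr
  unfold gaussianPDFReal
  have h3 : -(2 + U) ^ 2 / (2 * v₀) ≤ -(x - u) ^ 2 / (2 * v) := by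
    rw [neg_div, neg_div, neg_le_neg_iff]
    gcongr
  gcongr

/-- Uniform curvature of the Gaussian averages of a regular loss. -/
lemma exists_gaussLoss_curved (hV : RegularLoss V) {U v₀ v₁ : ℝ} (hv₀ : 0 < v₀) :
    ∃ κ > 0, ∀ (u : ℝ) (v : ℝ≥0), |u| ≤ U → v₀ ≤ v → v ≤ v₁ → ∀ c,
      κ * min (c ^ 2) 1 ≤ gaussLoss V (u + c) v + gaussLoss V (u - c) v - 2 * gaussLoss V u v := by
  by_cases hv01 : v₀ ≤ v₁
  swap
  · exact ⟨1, one_pos, fun u v _ h0 h1 => absurd (h0.trans h1) hv01⟩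
  have hv₁ : 0 < v₁ := hv₀.trans_le hv01
  obtain ⟨κ, hκ, h⟩ := hV.curved_all
  set p := (Real.sqrt (2 * Real.pi * v₁))⁻¹ * Real.exp (-(2 + U) ^ 2 / (2 * v₀)) with hp
  have hp0 : 0 < p := by positivity
  refine ⟨p * κ, by positivity, fun u v hu h0 h1 c => ?_⟩
  have hv : v ≠ 0 := by
    rintro rfl
    simp only [NNReal.coe_zero] at h0
    linarith
  have hcont := hV.lipschitz.continuous
  set F : ℝ → ℝ := fun x => V (x + c) + V (x - c) - 2 * V x with hF
  have hFc : Continuous F := by fun_prop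
  have hF0 : ∀ x, 0 ≤ F x := fun x => second_diff_nonneg hV.convex x c
  have hFi : Integrable F (gaussianReal u v) :=
    ((integrable_gaussianReal_of_lipschitz (lipschitz_comp_add hV.lipschitz c) u v).add
      (integrable_gaussianReal_of_lipschitz (lipschitz_comp_add hV.lipschitz (-c)) u v)).sub
      ((integrable_gaussianReal_of_lipschitz hV.lipschitz u v).const_mul 2)
  rw [gaussLoss_second_diff hV.lipschitz, integral_gaussianReal_eq_integral_smul hv]
  have hFi' : Integrable (fun x => gaussianPDFReal u v x • F x) := by
    rw [gaussianReal_of_var_ne_zero _ hv, integrable_withDensity_iff_integrable_smul'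
      (measurable_gaussianPDF u v) (.of_forall fun x => gaussianPDF_lt_top)] at hFi
    simpa [toReal_gaussianPDF] using hFi
  -- By convexity `F` is nonnegative, so the part of the integral outside the window may be dropped.
  calc p * κ * min (c ^ 2) 1 ≤ p * ∫ x in Set.Icc (-2) 2, F x := by
        rw [mul_assoc]; exact mul_le_mul_of_nonneg_left (h c) hp0.le
    _ = ∫ x in Set.Icc (-2) 2, p * F x := by rw [integral_const_mul]
    _ ≤ ∫ x in Set.Icc (-2) 2, gaussianPDFReal u v x • F x := by
        refine setIntegral_mono_on ?_ hFi'.integrableOn measurableSet_Icc fun x hx => ?_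
        · exact (hFc.continuousOn.integrableOn_compact isCompact_Icc).const_mul p
        · exact mul_le_mul_of_nonneg_right (gaussianPDFReal_ge hv₀ hu h0 h1 hx) (hF0 x)
    _ ≤ ∫ x, gaussianPDFReal u v x • F x :=
        setIntegral_le_integral hFi' (.of_forall fun x =>
          mul_nonneg (gaussianPDFReal_nonneg _ _ _) (hF0 x))

/-- The random shift that adds variance is symmetric. Averaging over `y` and `-y` therefore turns
the gain into a Gaussian average of second differences. -/
lemma integral_gaussLoss_sub (hV : RegularLoss V) (u : ℝ) (v τ : ℝ≥0) :
    2 * (gaussLoss V u (v + τ) - gaussLoss V u v) =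
      ∫ y, (gaussLoss V (u + y) v + gaussLoss V (u - y) v - 2 * gaussLoss V u v)
        ∂gaussianReal 0 τ := by
  have hl : LipschitzWith 1 (fun y => gaussLoss V (u + y) v) := by
    simpa [add_comm] using lipschitz_comp_add (lipschitz_gaussLoss hV.lipschitz v) u
  have hneg : (gaussianReal 0 τ).map (fun y => -y) = gaussianReal 0 τ := by
    rw [gaussianReal_map_neg, neg_zero]
  have hl' : LipschitzWith 1 (fun y => gaussLoss V (u - y) v) :=
    LipschitzWith.of_dist_le_mul fun a b => by
      have := abs_sub_le_of_lipschitz hl (-a) (-b)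
      rw [Real.dist_eq, Real.dist_eq, NNReal.coe_one, one_mul, ← abs_neg (a - b), neg_sub]
      simpa [sub_eq_add_neg, add_comm] using this
  have h1 := integrable_gaussianReal_of_lipschitz hl 0 τ
  have h2 := integrable_gaussianReal_of_lipschitz hl' 0 τ
  have h3 : ∫ y, gaussLoss V (u - y) v ∂gaussianReal 0 τ =
      ∫ y, gaussLoss V (u + y) v ∂gaussianReal 0 τ := by
    conv_rhs => rw [← hneg, integral_map (by fun_prop) hl.continuous.aestronglyMeasurable]
    simp [sub_eq_add_neg]
  rw [integral_sub (f := fun y => gaussLoss V (u + y) v + gaussLoss V (u - y) v) (h1.add h2)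
    (integrable_const _), integral_add h1 h2, h3,
    ← gaussLoss_add_var hV.lipschitz]
  simp
  ring

lemma gaussLoss_mono_var (hV : RegularLoss V) (u : ℝ) {v v' : ℝ≥0} (h : v ≤ v') :
    gaussLoss V u v ≤ gaussLoss V u v' := by
  obtain ⟨τ, rfl⟩ := exists_add_of_le h
  have := integral_gaussLoss_sub hV u v τ
  have h2 : 0 ≤ ∫ y, (gaussLoss V (u + y) v + gaussLoss V (u - y) v - 2 * gaussLoss V u v)
        ∂gaussianReal 0 τ := integral_nonneg fun y => gaussLoss_second_diff_nonneg hV u y v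
  linarith

/-- Scale `y = √τ z`. Then `min (τ z²) 1 ≥ τ min (z²) (1 / T')` because `τ ≤ T'`, and the remaining
integral is a positive constant. -/
lemma exists_integral_min_sq_ge (T : ℝ) : ∃ κ > 0, ∀ τ : ℝ≥0, τ ≤ T →
    κ * τ ≤ ∫ y, min (y ^ 2) 1 ∂gaussianReal 0 τ := by
  set T' := max T 1 with hT'
  have hT0 : 0 < T' := by positivity
  have hi : Integrable (fun z : ℝ => min (z ^ 2) (1 / T')) (gaussianReal 0 1) := by
    refine Integrable.of_bound (C := 1 / T') (by fun_prop) (.of_forall fun z => ?_)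
    rw [Real.norm_eq_abs, abs_of_nonneg (by positivity)]
    exact min_le_right _ _
  refine ⟨∫ z, min (z ^ 2) (1 / T') ∂gaussianReal 0 1, ?_, fun τ hτ => ?_⟩
  · rw [gt_iff_lt, integral_pos_iff_support_of_nonneg (fun z => by positivity) hi]
    have : Function.support (fun z : ℝ => min (z ^ 2) (1 / T')) = {0}ᶜ := by
      ext z
      simp only [Function.mem_support, Set.mem_compl_iff, Set.mem_singleton_iff]
      constructor
      · rintro h rfl
        apply h
        rw [min_eq_left] <;> simp [hT0.le]
      · intro hz
        have : 0 < min (z ^ 2) (1 / T') := lt_min (by positivity) (by positivity)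
        exact this.ne'
    rw [this]
    have := nullSingletonClass_gaussianReal (μ := 0) (v := 1) one_ne_zero
    rw [measure_compl (measurableSet_singleton 0) (measure_ne_top _ _)]
    simp
  · have h : gaussianReal 0 τ = (gaussianReal 0 1).map (Real.sqrt τ * ·) := by
      rw [gaussianReal_map_const_mul]
      congr 1
      · simp
      · ext; simp
    rw [h, integral_map (by fun_prop) (by fun_prop), mul_comm, ← integral_const_mul]
    refine integral_mono (hi.const_mul _) ?_ fun z => ?_
    · refine Integrable.of_bound (C := 1) (by fun_prop) (.of_forall fun z => ?_)
      rw [Real.norm_eq_abs, abs_of_nonneg (by positivity)]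
      exact min_le_right _ _
    · simp only
      rw [mul_pow, Real.sq_sqrt (NNReal.coe_nonneg τ)]
      have hτ0 : (0 : ℝ) ≤ τ := τ.2
      refine le_min (mul_le_mul_of_nonneg_left (min_le_left _ _) hτ0) ?_
      refine (mul_le_mul_of_nonneg_left (min_le_right _ _) hτ0).trans ?_
      rw [mul_one_div, div_le_one hT0]
      exact hτ.trans (le_max_left _ _)

/-- The Gaussian averages of a regular loss grow at least linearly in the variance. -/
lemma exists_gaussLoss_var_growth (hV : RegularLoss V) {U v₀ v₁ : ℝ} (hv₀ : 0 < v₀) :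
    ∃ κ > 0, ∀ (u : ℝ) (v τ : ℝ≥0), |u| ≤ U → v₀ ≤ v → v + τ ≤ v₁ →
      κ * τ ≤ gaussLoss V u (v + τ) - gaussLoss V u v := by
  obtain ⟨κ, hκ, h⟩ := exists_gaussLoss_curved hV (U := U) (v₁ := v₁) hv₀
  obtain ⟨κ', hκ', h'⟩ := exists_integral_min_sq_ge v₁
  refine ⟨κ * κ' / 2, by positivity, fun u v τ hu h0 h1 => ?_⟩
  have hτ : (τ : ℝ) ≤ v₁ := by linarith
  have hv : (v : ℝ) ≤ v₁ := by linarith [τ.2]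
  have hs := integral_gaussLoss_sub hV u v τ
  have hi : Integrable (fun y : ℝ => κ * min (y ^ 2) 1) (gaussianReal 0 τ) := by
    refine Integrable.const_mul (Integrable.of_bound (C := 1) (by fun_prop)
      (.of_forall fun z => ?_)) κ
    rw [Real.norm_eq_abs, abs_of_nonneg (by positivity)]
    exact min_le_right _ _
  have hl : LipschitzWith 1 (fun y => gaussLoss V (u + y) v) := by
    simpa [add_comm] using lipschitz_comp_add (lipschitz_gaussLoss hV.lipschitz v) u
  have hl' : LipschitzWith 1 (fun y => gaussLoss V (u - y) v) :=
    LipschitzWith.of_dist_le_mul fun a b => by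
      have := abs_sub_le_of_lipschitz hl (-a) (-b)
      rw [Real.dist_eq, Real.dist_eq, NNReal.coe_one, one_mul, ← abs_neg (a - b), neg_sub]
      simpa [sub_eq_add_neg, add_comm] using this
  have hm := integral_mono hi (((integrable_gaussianReal_of_lipschitz hl 0 τ).add
    (integrable_gaussianReal_of_lipschitz hl' 0 τ)).sub
    (integrable_const (2 * gaussLoss V u v))) (fun y => h u v hu h0 hv y)
  rw [integral_const_mul] at hm
  simp only [Pi.sub_apply, Pi.add_apply] at hm
  rw [← hs] at hm
  nlinarith [mul_le_mul_of_nonneg_left (h' τ hτ) hκ.le]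

end GaussLoss

/-! ### Strong convexity -/

section StrongConvexity

lemma convexOn_sub_sq {f f' f'' : ℝ → ℝ} {a b m : ℝ}
    (hf : ∀ x ∈ Set.Icc a b, HasDerivAt f (f' x) x)
    (hf' : ∀ x ∈ Set.Icc a b, HasDerivAt f' (f'' x) x) (hm : ∀ x ∈ Set.Icc a b, m ≤ f'' x) :
    ConvexOn ℝ (Set.Icc a b) (fun x => f x - m / 2 * x ^ 2) := by
  have hsub : interior (Set.Icc a b) ⊆ Set.Icc a b := interior_subset
  have h1 : ∀ x ∈ Set.Icc a b, HasDerivAt (fun x => f x - m / 2 * x ^ 2) (f' x - m * x) x := by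
    intro x hx
    have := (hf x hx).sub ((hasDerivAt_pow 2 x).const_mul (m / 2))
    convert! this using 1
    push_cast
    ring
  refine convexOn_of_hasDerivWithinAt2_nonneg (convex_Icc a b) (f' := fun x => f' x - m * x)
    (f'' := fun x => f'' x - m) (fun x hx => (h1 x hx).continuousAt.continuousWithinAt)
    (fun x hx => (h1 x (hsub hx)).hasDerivWithinAt) (fun x hx => ?_)
    (fun x hx => sub_nonneg.2 (hm x (hsub hx)))
  have := (hf' x (hsub hx)).sub ((hasDerivAt_id x).const_mul m)
  rw [mul_one] at this
  exact this.hasDerivWithinAt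

lemma midpoint_le_of_convexOn_sub_sq {f : ℝ → ℝ} {s : Set ℝ} {m : ℝ}
    (h : ConvexOn ℝ s (fun x => f x - m / 2 * x ^ 2)) {x y : ℝ} (hx : x ∈ s) (hy : y ∈ s) :
    f ((x + y) / 2) ≤ (f x + f y) / 2 - m / 8 * (x - y) ^ 2 := by
  have := h.2 hx hy (by norm_num : (0 : ℝ) ≤ 1 / 2) (by norm_num : (0 : ℝ) ≤ 1 / 2) (by norm_num)
  simp only [smul_eq_mul] at this
  rw [show 1 / 2 * x + 1 / 2 * y = (x + y) / 2 by ring] at this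
  nlinarith

/-- Quadratic growth at a positive minimizer over `[0, ∞)` of a function that is locally strongly
convex on `(0, ∞)`. -/
lemma exists_quadratic_growth {h : ℝ → ℝ} {r : ℝ} (hr : 0 < r) (hmin : IsMinOn h (Set.Ici 0) r)
    (hconv : ∀ a b, 0 < a → a < b → ∃ m > 0,
      ConvexOn ℝ (Set.Icc a b) (fun x => h x - m / 2 * x ^ 2))
    (hcont : ContinuousWithinAt h (Set.Ioi 0) 0) {R : ℝ} (hR : 0 < R) :
    ∃ κ > 0, ∀ x, 0 ≤ x → x ≤ R → κ * (x - r) ^ 2 ≤ h x - h r := by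
  have hle : ∀ x, 0 ≤ x → h r ≤ h x := fun x hx => hmin hx
  set b := max R r + 1 with hb
  have hrb : r ≤ b := by have := le_max_right R r; linarith
  have hRb : R ≤ b := by have := le_max_left R r; linarith
  obtain ⟨m, hm, hcm⟩ := hconv (r / 2) b (by linarith) (by linarith)
  -- Midpoint strong convexity between `x` and `r`, together with minimality of `r` at the midpoint.
  have hbase : ∀ x, r / 2 ≤ x → x ≤ b → m / 4 * (x - r) ^ 2 ≤ h x - h r := by
    intro x hx1 hx2
    have h1 := midpoint_le_of_convexOn_sub_sq hcm (x := x) (y := r) ⟨hx1, hx2⟩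
      ⟨by linarith, hrb⟩
    have h2 := hle ((x + r) / 2) (by linarith)
    linarith
  have hpos : ∀ x, 0 < x → x ≤ R → m / 16 * (x - r) ^ 2 ≤ h x - h r := by
    intro x hx hxR
    rcases le_total (r / 2) x with hx1 | hx1
    · have := hbase x hx1 (hxR.trans hRb)
      nlinarith [sq_nonneg (x - r)]
    -- The modulus of strong convexity may degenerate as `x → 0`, so here only plain convexity on
    -- `[x, b]` is used. The point `r / 2` lies between `x` and `r`, hence `h x - h r ≥ h (r / 2) -
    -- h r ≥ m r² / 16`, and `|x - r| ≤ r`.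
    · obtain ⟨m', hm', hc'⟩ := hconv x b hx (by linarith)
      have hd : 0 < r - x := by linarith
      set l := (r / 2) / (r - x) with hl
      have hl0 : 0 ≤ l := by positivity
      have hl1 : l ≤ 1 := by rw [hl, div_le_one hd]; linarith
      have hlx : l * (r - x) = r / 2 := div_mul_cancel₀ _ hd.ne'
      have h1 := hc'.2 (x := x) (y := r) ⟨le_rfl, by linarith⟩ ⟨by linarith, hrb⟩ hl0
        (by linarith : 0 ≤ 1 - l) (by ring)
      simp only [smul_eq_mul] at h1
      have hmid : l * x + (1 - l) * r = r / 2 := by linear_combination -hlx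
      have h2 : (l * x + (1 - l) * r) ^ 2 ≤ l * x ^ 2 + (1 - l) * r ^ 2 := by
        nlinarith [mul_nonneg (mul_nonneg hl0 (by linarith : 0 ≤ 1 - l)) (sq_nonneg (x - r))]
      have h3 : h (r / 2) ≤ l * h x + (1 - l) * h r := by
        rw [hmid] at h1 h2
        nlinarith
      have h4 := hbase (r / 2) le_rfl (by linarith)
      have h5 := hle x hx.le
      have h6 : h (r / 2) - h r ≤ h x - h r := by nlinarith
      have h7 : (x - r) ^ 2 ≤ r ^ 2 := by nlinarith
      nlinarith
  refine ⟨m / 16, by positivity, fun x hx hxR => ?_⟩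
  rcases hx.lt_or_eq with hx | rfl
  · exact hpos x hx hxR
  -- The endpoint `x = 0` follows by letting `x` tend to 0 from the right.
  have ht1 : Filter.Tendsto (fun x => m / 16 * (x - r) ^ 2) (nhdsWithin 0 (Set.Ioi 0))
      (nhds (m / 16 * (0 - r) ^ 2)) :=
    ((by fun_prop : Continuous fun x : ℝ => m / 16 * (x - r) ^ 2).tendsto 0).mono_left
      nhdsWithin_le_nhds
  refine le_of_tendsto_of_tendsto ht1 (hcont.tendsto.sub_const (h r)) ?_
  filter_upwards [Ioc_mem_nhdsGT hR] with y hy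
  exact hpos y hy.1 hy.2

end StrongConvexity

/-! ### The one-dimensional population loss -/

section HPop

open scoped NNReal

lemma hPop_eq_gaussLoss {V : ℝ → ℝ} (hV : Continuous V) {σ β r : ℝ} (hr : 0 ≤ r) :
    hPop V σ β r = gaussLoss V r (σ ^ 2 * r).toNNReal + β * r := by
  unfold hPop gaussLoss
  have h : gaussianReal r (σ ^ 2 * r).toNNReal =
      (gaussianReal 0 1).map (fun z => r + σ * Real.sqrt r * z) := by
    have h1 : (fun z : ℝ => r + σ * Real.sqrt r * z) =
      (fun y => r + y) ∘ (fun z => σ * Real.sqrt r * z) := rfl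
    rw [h1, ← Measure.map_map (by fun_prop) (by fun_prop), gaussianReal_map_const_mul,
      gaussianReal_map_const_add]
    congr 1
    · simp
    · ext
      rw [Real.coe_toNNReal _ (by positivity)]
      simp only [NNReal.coe_mk, mul_one]
      rw [mul_pow, Real.sq_sqrt hr]
  rw [h, integral_map (by fun_prop) hV.aestronglyMeasurable]

lemma continuous_hPop {V : ℝ → ℝ} (hV : LipschitzWith 1 V) (σ β : ℝ) :
    Continuous (hPop V σ β) := by
  refine Continuous.add ?_ (by fun_prop)
  rw [continuous_iff_continuousAt]
  intro r₀
  have hc := hV.continuous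
  have hb : ∀ᶠ r in nhds r₀, r ∈ Set.Ioo (r₀ - 1) (r₀ + 1) :=
    Ioo_mem_nhds (by linarith) (by linarith)
  refine continuousAt_of_dominated
    (bound := fun z => |V 0| + (|r₀| + 1) + |σ| * Real.sqrt (|r₀| + 1) * |z|)
    (.of_forall fun r => (by fun_prop : Continuous fun z =>
      V (r + σ * Real.sqrt r * z)).aestronglyMeasurable) ?_ ?_ ?_
  · filter_upwards [hb] with r hr
    refine .of_forall fun z => ?_
    have hr' : |r| ≤ |r₀| + 1 := by
      rw [abs_le]
      constructor <;> linarith [hr.1, hr.2, le_abs_self r₀, neg_abs_le r₀]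
    have h1 := abs_sub_le_of_lipschitz hV (r + σ * Real.sqrt r * z) 0
    rw [sub_zero] at h1
    have h2 := abs_sub_abs_le_abs_sub (V (r + σ * Real.sqrt r * z)) (V 0)
    have h3 : |r + σ * Real.sqrt r * z| ≤ |r| + |σ| * Real.sqrt r * |z| := by
      refine (abs_add_le _ _).trans (le_of_eq ?_)
      rw [abs_mul, abs_mul, abs_of_nonneg (Real.sqrt_nonneg r)]
    have h4 : Real.sqrt r ≤ Real.sqrt (|r₀| + 1) :=
      Real.sqrt_le_sqrt ((le_abs_self r).trans hr')
    have h5 : |σ| * Real.sqrt r * |z| ≤ |σ| * Real.sqrt (|r₀| + 1) * |z| := by gcongr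
    rw [Real.norm_eq_abs]
    linarith
  · exact (integrable_const _).add ((integrable_id_gaussianReal 0 1).abs.const_mul _)
  · exact .of_forall fun z => (by fun_prop : Continuous fun r =>
      V (r + σ * Real.sqrt r * z)).continuousAt

lemma hasDerivAt_gaussianPDFReal (z : ℝ) :
    HasDerivAt (gaussianPDFReal 0 1) (-z * gaussianPDFReal 0 1 z) z := by
  have h : gaussianPDFReal 0 1 =
      fun x => (Real.sqrt (2 * Real.pi))⁻¹ * Real.exp (-x ^ 2 / 2) := by
    ext x; simp [gaussianPDFReal]
  rw [h]
  have h1 : HasDerivAt (fun x : ℝ => -x ^ 2 / 2) (-z) z := by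
    have := ((hasDerivAt_pow 2 z).neg).div_const 2
    convert! this using 1
    push_cast; ring
  have := (h1.exp).const_mul ((Real.sqrt (2 * Real.pi))⁻¹)
  convert! this using 1
  ring

lemma integrable_gaussianReal_iff {f : ℝ → ℝ} :
    Integrable f (gaussianReal 0 1) ↔ Integrable (fun x => gaussianPDFReal 0 1 x * f x) := by
  rw [gaussianReal_of_var_ne_zero _ one_ne_zero, integrable_withDensity_iff_integrable_smul'
    (measurable_gaussianPDF 0 1) (.of_forall fun x => gaussianPDF_lt_top)]
  simp [toReal_gaussianPDF]

/-- Gaussian integration by parts. -/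
lemma integral_mul_gaussianReal {f f' : ℝ → ℝ} {C : ℝ} (hf : ∀ x, HasDerivAt f (f' x) x)
    (hf' : Continuous f') (hC : ∀ x, |f x| ≤ C) (hC' : ∀ x, |f' x| ≤ C) :
    ∫ z, z * f z ∂gaussianReal 0 1 = ∫ z, f' z ∂gaussianReal 0 1 := by
  have hfc : Continuous f := continuous_iff_continuousAt.2 fun x => (hf x).continuousAt
  have i1 : Integrable (fun z => z * f z) (gaussianReal 0 1) := by
    refine ((integrable_id_gaussianReal 0 1).norm.mul_const C).mono'
      (by fun_prop) (.of_forall fun z => ?_)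
    rw [norm_mul]
    exact mul_le_mul_of_nonneg_left (hC z) (norm_nonneg _)
  have i2 : Integrable f' (gaussianReal 0 1) :=
    Integrable.of_bound (C := C) (by fun_prop) (.of_forall hC')
  have i3 : Integrable f (gaussianReal 0 1) :=
    Integrable.of_bound (C := C) (by fun_prop) (.of_forall hC)
  rw [integral_gaussianReal_eq_integral_smul one_ne_zero,
    integral_gaussianReal_eq_integral_smul one_ne_zero]
  rw [integrable_gaussianReal_iff] at i1 i2 i3
  have := integral_mul_deriv_eq_deriv_mul_of_integrable (u := f) (u' := f')
    (v := gaussianPDFReal 0 1) (v' := fun z => -z * gaussianPDFReal 0 1 z)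
    (fun x _ => hf x) (fun x _ => hasDerivAt_gaussianPDFReal x)
    (i1.neg.congr (.of_forall fun x => by simp only [Pi.neg_apply, Pi.mul_apply]; ring))
    (i2.congr (.of_forall fun x => by simp only [Pi.mul_apply]; ring))
    (i3.congr (.of_forall fun x => by simp only [Pi.mul_apply]; ring))
  simp only [smul_eq_mul]
  calc ∫ x, gaussianPDFReal 0 1 x * (x * f x)
      = -∫ x, f x * (-x * gaussianPDFReal 0 1 x) := by
        rw [← integral_neg]; congr 1; ext x; ring
    _ = ∫ x, gaussianPDFReal 0 1 x * f' x := by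
        rw [this, neg_neg]; congr 1; ext x; ring

/-- The generator of `r + σ √r Z`, as a derivative in `r`. -/
lemma hasDerivAt_integral_drift {f f' f'' : ℝ → ℝ} {C : ℝ} (hf : ∀ x, HasDerivAt f (f' x) x)
    (hf' : ∀ x, HasDerivAt f' (f'' x) x) (hf'' : Continuous f'') (hC : ∀ x, |f' x| ≤ C)
    (hC' : ∀ x, |f'' x| ≤ C) (σ : ℝ) {r : ℝ} (hr : 0 < r) :
    HasDerivAt (fun r => ∫ z, f (r + σ * Real.sqrt r * z) ∂gaussianReal 0 1)
      (∫ z, (f' (r + σ * Real.sqrt r * z) + σ ^ 2 / 2 * f'' (r + σ * Real.sqrt r * z))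
        ∂gaussianReal 0 1) r := by
  have hfc : Continuous f := continuous_iff_continuousAt.2 fun x => (hf x).continuousAt
  have hfc' : Continuous f' := continuous_iff_continuousAt.2 fun x => (hf' x).continuousAt
  have hC0 : 0 ≤ C := (abs_nonneg _).trans (hC 0)
  have hs : ∀ z s, 0 < s → HasDerivAt (fun r => f (r + σ * Real.sqrt r * z))
      (f' (s + σ * Real.sqrt s * z) * (1 + σ * (1 / (2 * Real.sqrt s)) * z)) s := by
    intro z s hs
    have h1 := (hasDerivAt_id s).add
      (((Real.hasDerivAt_sqrt hs.ne').const_mul σ).mul_const z)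
    exact (hf _).comp s h1
  have hlip : LipschitzWith (Real.toNNReal C) f := by
    refine lipschitzWith_of_nnnorm_deriv_le (fun x => (hf x).differentiableAt) fun x => ?_
    rw [(hf x).deriv, ← NNReal.coe_le_coe, coe_nnnorm, Real.coe_toNNReal _ hC0]
    exact hC x
  have hint : Integrable (fun z => f (r + σ * Real.sqrt r * z)) (gaussianReal 0 1) := by
    refine ((integrable_const (|f r|)).add
      ((integrable_id_gaussianReal 0 1).abs.const_mul (C * |σ * Real.sqrt r|))).mono'
      (by fun_prop) (.of_forall fun z => ?_)
    have h1 := hlip.dist_le_mul (r + σ * Real.sqrt r * z) r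
    rw [Real.dist_eq, Real.dist_eq, Real.coe_toNNReal _ hC0, add_sub_cancel_left, abs_mul] at h1
    have h2 := abs_sub_abs_le_abs_sub (f (r + σ * Real.sqrt r * z)) (f r)
    rw [Real.norm_eq_abs]
    simp only [Pi.add_apply, id_eq]
    linarith
  -- Restricting to `s > r / 2` keeps `1 / √s` bounded, so the differentiated integrand is dominated
  -- by an affine function of `|z|`.
  have key := (hasDerivAt_integral_of_dominated_loc_of_deriv_le
    (μ := gaussianReal 0 1) (F := fun r z => f (r + σ * Real.sqrt r * z))
    (F' := fun r z => f' (r + σ * Real.sqrt r * z) * (1 + σ * (1 / (2 * Real.sqrt r)) * z))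
    (x₀ := r) (s := Set.Ioi (r / 2))
    (bound := fun z => C * (1 + |σ| * (1 / (2 * Real.sqrt (r / 2))) * |z|))
    (Ioi_mem_nhds (by linarith))
    (.of_forall fun s => (by fun_prop : Continuous fun z =>
      f (s + σ * Real.sqrt s * z)).aestronglyMeasurable) hint
    (by fun_prop) (.of_forall fun z s hsr => ?_) ?_ (.of_forall fun z s hsr => ?_)).2
  rotate_left
  · have hs0 : 0 < r / 2 := by linarith
    have hs1 : 0 < s := hs0.trans hsr
    rw [norm_mul]
    refine mul_le_mul (hC _) ?_ (norm_nonneg _) hC0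
    refine (norm_add_le _ _).trans ?_
    rw [norm_one, norm_mul, norm_mul, Real.norm_eq_abs, Real.norm_eq_abs z,
      Real.norm_eq_abs (1 / _), abs_of_nonneg (by positivity : 0 ≤ 1 / (2 * Real.sqrt s))]
    have : Real.sqrt (r / 2) ≤ Real.sqrt s := Real.sqrt_le_sqrt (le_of_lt hsr)
    gcongr
  · exact ((integrable_const 1).add
      ((integrable_id_gaussianReal 0 1).abs.const_mul _)).const_mul C
  · exact hs z s ((by linarith : 0 < r / 2).trans hsr)
  have hsr : 0 < Real.sqrt r := Real.sqrt_pos.2 hr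
  set c := σ * Real.sqrt r with hc
  -- Integration by parts trades the factor `z` for `c = σ √r` and one more derivative. Multiplied
  -- by `σ / (2 √r)` this yields the diffusion coefficient `σ² / 2`.
  have hst := integral_mul_gaussianReal (f := fun z => f' (r + c * z))
    (f' := fun z => c * f'' (r + c * z)) (C := max C (|c| * C))
    (fun z => by
      have h1 : HasDerivAt (fun z : ℝ => r + c * z) c z := by
        simpa using ((hasDerivAt_id z).const_mul c).const_add r
      have := (hf' (r + c * z)).comp z h1
      convert! this using 1
      ring)
    (by fun_prop) (fun z => (hC _).trans (le_max_left _ _)) (fun z => by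
      rw [abs_mul]
      exact (mul_le_mul_of_nonneg_left (hC' _) (abs_nonneg c)).trans (le_max_right _ _))
  have i1 : Integrable (fun z => f' (r + c * z)) (gaussianReal 0 1) :=
    Integrable.of_bound (C := C) (by fun_prop) (.of_forall fun z => hC _)
  have i2 : Integrable (fun z => f'' (r + c * z)) (gaussianReal 0 1) :=
    Integrable.of_bound (C := C) (by fun_prop) (.of_forall fun z => hC' _)
  have i3 : Integrable (fun z => z * f' (r + c * z)) (gaussianReal 0 1) := by
    refine ((integrable_id_gaussianReal 0 1).norm.mul_const C).mono'
      (by fun_prop) (.of_forall fun z => ?_)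
    rw [norm_mul]
    exact mul_le_mul_of_nonneg_left (hC _) (norm_nonneg _)
  convert! key using 1
  rw [integral_add i1 (i2.const_mul _), integral_const_mul]
  have e : ∀ z, f' (r + c * z) * (1 + σ * (1 / (2 * Real.sqrt r)) * z) =
      f' (r + c * z) + σ * (1 / (2 * Real.sqrt r)) * (z * f' (r + c * z)) := fun z => by ring
  simp_rw [e]
  rw [integral_add i1 (i3.const_mul _), integral_const_mul, hst, integral_const_mul]
  congr 1
  rw [← mul_assoc]
  congr 1
  rw [hc]
  field_simp

end HPop

/-! ### The logistic loss -/

section Logistic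

/-- `-V'` for the logistic loss `V`. -/
noncomputable def logisticSlope (x : ℝ) : ℝ := (1 + Real.exp x)⁻¹

lemma logisticSlope_pos (x : ℝ) : 0 < logisticSlope x := by unfold logisticSlope; positivity

lemma logisticSlope_lt_one (x : ℝ) : logisticSlope x < 1 :=
  inv_lt_one_of_one_lt₀ (by linarith [Real.exp_pos x])

lemma continuous_logisticSlope : Continuous logisticSlope := by
  unfold logisticSlope
  exact (by fun_prop : Continuous fun x : ℝ => 1 + Real.exp x).inv₀ fun x => by positivity

lemma hasDerivAt_logistic (x : ℝ) : HasDerivAt logistic (-logisticSlope x) x := by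
  have h1 : HasDerivAt (fun x : ℝ => 1 + Real.exp (-x)) (-Real.exp (-x)) x := by
    simpa using ((hasDerivAt_neg x).exp).const_add 1
  have := h1.log (by positivity)
  convert! this using 1
  unfold logisticSlope
  have h2 : Real.exp (-x) * Real.exp x = 1 := by rw [← Real.exp_add]; simp
  have h3 := Real.exp_pos x
  have h4 := Real.exp_pos (-x)
  rw [neg_div, neg_inj, eq_div_iff (by positivity), inv_mul_eq_iff_eq_mul₀ (by positivity)]
  linarith

lemma hasDerivAt_logisticSlope (x : ℝ) :
    HasDerivAt logisticSlope (-(logisticSlope x * (1 - logisticSlope x))) x := by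
  have h1 : HasDerivAt (fun x : ℝ => 1 + Real.exp x) (Real.exp x) x :=
    (Real.hasDerivAt_exp x).const_add 1
  have := h1.inv (by positivity)
  convert! this using 1
  unfold logisticSlope
  have h3 := Real.exp_pos x
  field_simp
  ring

/-- The curvature of the logistic loss. -/
noncomputable def logisticCurv (x : ℝ) : ℝ := logisticSlope x * (1 - logisticSlope x)

lemma logisticCurv_pos (x : ℝ) : 0 < logisticCurv x :=
  mul_pos (logisticSlope_pos x) (by linarith [logisticSlope_lt_one x])

lemma continuous_logisticCurv : Continuous logisticCurv := by
  have := continuous_logisticSlope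
  unfold logisticCurv; fun_prop

lemma logisticCurv_le_one (x : ℝ) : logisticCurv x ≤ 1 := by
  have h1 := logisticSlope_pos x
  have h2 := logisticSlope_lt_one x
  unfold logisticCurv; nlinarith

lemma hasDerivAt_neg_logisticSlope (x : ℝ) :
    HasDerivAt (fun x => -logisticSlope x) (logisticCurv x) x := by
  have := (hasDerivAt_logisticSlope x).neg
  rw [neg_neg] at this
  exact this

lemma hasDerivAt_logisticCurv (x : ℝ) : HasDerivAt logisticCurv
    (-(logisticCurv x * (1 - 2 * logisticSlope x))) x := by
  have h := hasDerivAt_logisticSlope x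
  have := h.mul (h.const_sub 1)
  convert! this using 1
  unfold logisticCurv
  ring

/-- The fourth derivative of the logistic loss. With `s` the slope and `p = s (1 - s)` the
curvature, it simplifies through `(1 - 2 s)² = 1 - 4 p`. -/
lemma hasDerivAt_logistic_third (x : ℝ) :
    HasDerivAt (fun x => -(logisticCurv x * (1 - 2 * logisticSlope x)))
      (logisticCurv x * (1 - 6 * logisticCurv x)) x := by
  have := ((hasDerivAt_logisticCurv x).mul
    (((hasDerivAt_logisticSlope x).const_mul 2).const_sub 1)).neg
  convert! this using 1
  unfold logisticCurv
  ring

lemma exists_curv_lower_bound (X : ℝ) : ∃ m > 0, ∀ x ∈ Set.Icc (-X) X, m ≤ logisticCurv x := by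
  rcases le_or_gt 0 X with hX | hX
  · obtain ⟨y, -, hy⟩ := isCompact_Icc.exists_isMinOn (s := Set.Icc (-X) X)
      ⟨0, by simp [hX]⟩ continuous_logisticCurv.continuousOn
    exact ⟨logisticCurv y, logisticCurv_pos y, fun x hx => hy hx⟩
  · exact ⟨1, one_pos, fun x hx => by linarith [hx.1, hx.2]⟩

lemma regularLoss_logistic : RegularLoss logistic where
  lipschitz := by
    refine lipschitzWith_of_nnnorm_deriv_le (fun x => (hasDerivAt_logistic x).differentiableAt)
      fun x => ?_
    rw [(hasDerivAt_logistic x).deriv, ← NNReal.coe_le_coe, coe_nnnorm, norm_neg,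
      Real.norm_of_nonneg (logisticSlope_pos x).le]
    exact (logisticSlope_lt_one x).le
  convex := by
    refine convexOn_of_hasDerivWithinAt2_nonneg convex_univ (f' := fun x => -logisticSlope x)
      (f'' := logisticCurv)
      (continuous_iff_continuousAt.2 fun x => (hasDerivAt_logistic x).continuousAt).continuousOn
      (fun x _ => (hasDerivAt_logistic x).hasDerivWithinAt)
      (fun x _ => (hasDerivAt_neg_logisticSlope x).hasDerivWithinAt)
      (fun x _ => (logisticCurv_pos x).le)
  nonneg := fun x => Real.log_nonneg (by linarith [Real.exp_pos (-x)])
  curved := by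
    -- The points `x ± c` with `|x| ≤ 2` and `|c| ≤ 1` stay in `[-3, 3]`, where the second
    -- derivative has a positive minimum.
    obtain ⟨m, hm, h⟩ := exists_curv_lower_bound 3
    have hc := convexOn_sub_sq (f := logistic) (fun x _ => hasDerivAt_logistic x)
      (fun x _ => hasDerivAt_neg_logisticSlope x) h
    have hcont : Continuous logistic :=
      continuous_iff_continuousAt.2 fun x => (hasDerivAt_logistic x).continuousAt
    refine ⟨4 * m, by positivity, fun c hc1 => ?_⟩
    have hc2 := abs_le.1 hc1
    have : ∫ x in Set.Icc (-2 : ℝ) 2, m * c ^ 2 = 4 * m * c ^ 2 := by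
      simp; ring
    rw [← this]
    refine setIntegral_mono_on (integrableOn_const (by simp)) ((by fun_prop : Continuous fun x =>
      logistic (x + c) + logistic (x - c) - 2 * logistic x).continuousOn.integrableOn_compact
      isCompact_Icc) measurableSet_Icc fun x hx => ?_
    have h2 := midpoint_le_of_convexOn_sub_sq hc (x := x + c) (y := x - c)
      ⟨by linarith [hx.1], by linarith [hx.2]⟩ ⟨by linarith [hx.1], by linarith [hx.2]⟩
    rw [show (x + c + (x - c)) / 2 = x by ring] at h2
    nlinarith

/-- Positivity of `1 - q y + (q² / 4) (3 y² - 1) / 2` for `y ≤ 1` and `0 ≤ q ≤ 1`. -/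
lemma drift_quadratic_lower_bound {q y : ℝ} (hq : 0 ≤ q) (hq1 : q ≤ 1) (hy' : y ≤ 1) :
    1 / 8 ≤ 1 - q * y + q ^ 2 / 4 * (1 - 6 * ((1 - y ^ 2) / 4)) := by
  nlinarith [sq_nonneg (1 - q), mul_nonneg hq (sub_nonneg.2 hy'),
    mul_nonneg hq (sub_nonneg.2 hq1),
    mul_nonneg (mul_nonneg hq hq) (mul_nonneg (sub_nonneg.2 hy') (sub_nonneg.2 hy')),
    mul_nonneg (mul_nonneg hq (sub_nonneg.2 hq1)) (sub_nonneg.2 hy'),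
    mul_nonneg (mul_nonneg hq hq) (sub_nonneg.2 hy')]

/-- Let `A f = f' + (σ² / 2) f''`, so that differentiating `𝔼 f (r + σ √r Z)` in `r` gives `𝔼 (A f)
(r + σ √r Z)`. Two differentiations show that the second derivative of `hPop` is `𝔼 (A² V)`. With `q
= σ²`, `p` the logistic curvature and `y = 1 - 2 * logisticSlope`, one finds `A² V = p (1 - q y +
(q² / 4) (1 - 6 p))`, which is at least `p / 8`. The event `|Z| ≤ 1` alone contributes a positive
amount, uniformly for `r` in `[a, b]`. -/
lemma exists_hPop_logistic_strongConvex {σ β : ℝ} (hσ1 : σ ^ 2 ≤ 1) {a b : ℝ}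
    (ha : 0 < a) (hab : a < b) : ∃ m > 0,
      ConvexOn ℝ (Set.Icc a b) (fun x => hPop logistic σ β x - m / 2 * x ^ 2) := by
  have hb : 0 < b := ha.trans hab
  set Y : ℝ → ℝ → ℝ := fun r z => r + σ * Real.sqrt r * z with hY
  set G : ℝ → ℝ := fun x => -logisticSlope x + σ ^ 2 / 2 * logisticCurv x with hG
  set G' : ℝ → ℝ := fun x =>
    logisticCurv x + σ ^ 2 / 2 * -(logisticCurv x * (1 - 2 * logisticSlope x)) with hG'
  set G'' : ℝ → ℝ := fun x => -(logisticCurv x * (1 - 2 * logisticSlope x)) +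
    σ ^ 2 / 2 * (logisticCurv x * (1 - 6 * logisticCurv x)) with hG''
  have c1 := continuous_logisticSlope
  have c2 := continuous_logisticCurv
  have hσ0 := sq_nonneg σ
  have bs : ∀ x, |1 - 2 * logisticSlope x| ≤ 1 := fun x => by
    have := logisticSlope_pos x; have := logisticSlope_lt_one x
    rw [abs_le]; constructor <;> linarith
  have bc : ∀ x, |logisticCurv x| ≤ 1 := fun x => by
    rw [abs_of_pos (logisticCurv_pos x)]; exact logisticCurv_le_one x
  have b3 : ∀ x, |-(logisticCurv x * (1 - 2 * logisticSlope x))| ≤ 1 := fun x => by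
    rw [abs_neg, abs_mul]
    exact mul_le_one₀ (bc x) (abs_nonneg _) (bs x)
  have b4 : ∀ x, |logisticCurv x * (1 - 6 * logisticCurv x)| ≤ 5 := fun x => by
    have h1 := logisticCurv_pos x
    have h2 := logisticCurv_le_one x
    rw [abs_le]; constructor <;> nlinarith
  have key : ∀ {s u v : ℝ}, |u| ≤ 1 → |v| ≤ 5 → 0 ≤ s → s ≤ 1 → |u + s / 2 * v| ≤ 5 := by
    intro s u v hu hv hs hs1
    have h1 := abs_le.1 hu
    have h2 := abs_le.1 hv
    rw [abs_le]; constructor <;> nlinarith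
  have hd1 : ∀ x, HasDerivAt G (G' x) x := fun x =>
    (hasDerivAt_neg_logisticSlope x).add ((hasDerivAt_logisticCurv x).const_mul (σ ^ 2 / 2))
  have hd2 : ∀ x, HasDerivAt G' (G'' x) x := fun x =>
    (hasDerivAt_logisticCurv x).add ((hasDerivAt_logistic_third x).const_mul (σ ^ 2 / 2))
  have D1 : ∀ r, 0 < r → HasDerivAt (hPop logistic σ β)
      ((∫ z, G (Y r z) ∂gaussianReal 0 1) + β) r := fun r hr => by
    have h1 := hasDerivAt_integral_drift (C := 1) hasDerivAt_logistic hasDerivAt_neg_logisticSlope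
      c2 (fun x => by
        rw [abs_neg, abs_of_pos (logisticSlope_pos x)]; exact (logisticSlope_lt_one x).le)
      bc σ hr
    have h2 := h1.add ((hasDerivAt_id r).const_mul β)
    rw [mul_one] at h2
    exact h2
  have D2 : ∀ r, 0 < r → HasDerivAt (fun r => (∫ z, G (Y r z) ∂gaussianReal 0 1) + β)
      (∫ z, (G' (Y r z) + σ ^ 2 / 2 * G'' (Y r z)) ∂gaussianReal 0 1) r := fun r hr =>
    (hasDerivAt_integral_drift (C := 5) hd1 hd2 (by fun_prop)
      (fun x => key (bc x) ((b3 x).trans (by norm_num)) hσ0 hσ1)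
      (fun x => key (b3 x) (b4 x) hσ0 hσ1) σ hr).add_const β
  have hlow : ∀ x, 1 / 8 * logisticCurv x ≤ G' x + σ ^ 2 / 2 * G'' x := by
    intro x
    have h1 := drift_quadratic_lower_bound hσ0 hσ1 (y := 1 - 2 * logisticSlope x)
      (abs_le.1 (bs x)).2
    have h2 : (1 - (1 - 2 * logisticSlope x) ^ 2) / 4 = logisticCurv x := by
      unfold logisticCurv; ring
    rw [h2] at h1
    have h3 := mul_le_mul_of_nonneg_left h1 (logisticCurv_pos x).le
    simp only [hG', hG'']
    linarith
  -- This radius contains `r + σ √r z` for all `r ∈ [a, b]` and `|z| ≤ 1`.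
  obtain ⟨m, hm, hmX⟩ := exists_curv_lower_bound (b + |σ| * Real.sqrt b)
  set p := (gaussianReal 0 1).real (Set.Icc (-1) 1) with hp
  have hp0 : 0 < p := by
    rw [hp, measureReal_def, ENNReal.toReal_pos_iff]
    refine ⟨?_, measure_lt_top _ _⟩
    rw [gaussianReal_apply_eq_integral _ one_ne_zero, ENNReal.ofReal_pos]
    rw [setIntegral_pos_iff_support_of_nonneg_ae
      (.of_forall fun x => gaussianPDFReal_nonneg _ _ _)
      (integrable_gaussianPDFReal 0 1).integrableOn]
    have : Function.support (gaussianPDFReal 0 1) = Set.univ := by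
      ext x; simp [(gaussianPDFReal_pos 0 1 x one_ne_zero).ne']
    rw [this]
    simp
  refine ⟨1 / 8 * m * p, by positivity, convexOn_sub_sq (fun r hr => D1 r (ha.trans_le hr.1))
    (fun r hr => D2 r (ha.trans_le hr.1)) fun r hr => ?_⟩
  have hr0 : 0 < r := ha.trans_le hr.1
  have cY : Continuous (Y r) := by fun_prop
  have hi : Integrable (fun z => G' (Y r z) + σ ^ 2 / 2 * G'' (Y r z)) (gaussianReal 0 1) := by
    have cG' : Continuous G' := by fun_prop
    have cG'' : Continuous G'' := by fun_prop
    refine Integrable.of_bound (C := 5 + σ ^ 2 / 2 * 5) (by fun_prop) (.of_forall fun z => ?_)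
    refine (norm_add_le _ _).trans (add_le_add
      (key (bc _) ((b3 _).trans (by norm_num)) hσ0 hσ1) ?_)
    rw [norm_mul, Real.norm_of_nonneg (by positivity)]
    exact mul_le_mul_of_nonneg_left (key (b3 _) (b4 _) hσ0 hσ1) (by positivity)
  have hpos : ∀ z, 0 ≤ G' (Y r z) + σ ^ 2 / 2 * G'' (Y r z) := fun z =>
    le_trans (by have := logisticCurv_pos (Y r z); positivity) (hlow _)
  calc 1 / 8 * m * p = ∫ z in Set.Icc (-1) 1, 1 / 8 * m ∂gaussianReal 0 1 := by
        rw [setIntegral_const, smul_eq_mul, mul_comm]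
    _ ≤ ∫ z in Set.Icc (-1) 1, (G' (Y r z) + σ ^ 2 / 2 * G'' (Y r z)) ∂gaussianReal 0 1 := by
        refine setIntegral_mono_on (integrable_const _).integrableOn hi.integrableOn
          measurableSet_Icc fun z hz => ?_
        refine le_trans (mul_le_mul_of_nonneg_left (hmX _ ?_) (by norm_num)) (hlow _)
        have h1 : |σ * Real.sqrt r * z| ≤ |σ| * Real.sqrt b := by
          rw [abs_mul, abs_mul, abs_of_nonneg (Real.sqrt_nonneg r)]
          have hz1 : |z| ≤ 1 := abs_le.2 hz
          have hs := Real.sqrt_le_sqrt hr.2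
          calc |σ| * Real.sqrt r * |z| ≤ |σ| * Real.sqrt b * 1 := by gcongr
            _ = _ := mul_one _
        have h2 := abs_le.1 h1
        simp only [hY]
        exact ⟨by linarith, by linarith [hr.2]⟩
    _ ≤ _ := setIntegral_le_integral hi (.of_forall hpos)

end Logistic

/-! ### The hinge loss -/

section Hinge

lemma lipschitz_hinge : LipschitzWith 1 hinge := by
  refine LipschitzWith.of_dist_le_mul fun a b => ?_
  rw [Real.dist_eq, Real.dist_eq, NNReal.coe_one, one_mul]
  refine (abs_max_sub_max_le_abs _ _ _).trans (le_of_eq ?_)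
  rw [abs_sub_comm]
  congr 1
  ring

/-- The curvature of the hinge is a point mass at 1, which is why `RegularLoss` asks for it only in
integrated form. The second difference at `x` is at least `|c| - |1 - x|`. Over `|x - 1| ≤ |c| / 2`,
an interval inside `[-2, 2]`, this is at least `|c| / 2`, which gives `c² / 2`. -/
lemma regularLoss_hinge : RegularLoss hinge where
  lipschitz := lipschitz_hinge
  convex := by
    have h1 : ConvexOn ℝ Set.univ (fun x : ℝ => 1 - x) :=
      ⟨convex_univ, fun x _ y _ a b _ _ hab => by
        simp only [smul_eq_mul]; nlinarith⟩
    exact h1.sup (convexOn_const 0 convex_univ)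
  nonneg := fun x => le_max_right _ _
  curved := by
    have hcont := lipschitz_hinge.continuous
    refine ⟨1 / 2, by norm_num, fun c hc => ?_⟩
    set F : ℝ → ℝ := fun x => hinge (x + c) + hinge (x - c) - 2 * hinge x with hF
    have hFc : Continuous F := by fun_prop
    have hF0 : ∀ x, max (|c| - |1 - x|) 0 ≤ F x := by
      intro x
      simp only [hF, hinge]
      rcases abs_cases c with ⟨h1, h1'⟩ | ⟨h1, h1'⟩ <;>
      rcases abs_cases (1 - x) with ⟨h2, h2'⟩ | ⟨h2, h2'⟩ <;>
      rw [h1, h2] <;>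
      rcases max_cases (1 - (x + c)) 0 with ⟨h3, h3'⟩ | ⟨h3, h3'⟩ <;>
      rcases max_cases (1 - (x - c)) 0 with ⟨h4, h4'⟩ | ⟨h4, h4'⟩ <;>
      rcases max_cases (1 - x) 0 with ⟨h5, h5'⟩ | ⟨h5, h5'⟩ <;>
      rw [h3, h4, h5] <;> refine max_le ?_ ?_ <;> linarith
    have hsub : Set.Icc (1 - |c| / 2) (1 + |c| / 2) ⊆ Set.Icc (-2 : ℝ) 2 :=
      Set.Icc_subset_Icc (by linarith) (by linarith)
    have hint := hFc.continuousOn.integrableOn_compact (μ := volume)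
      (isCompact_Icc (a := (-2 : ℝ)) (b := 2))
    calc 1 / 2 * c ^ 2 = ∫ x in Set.Icc (1 - |c| / 2) (1 + |c| / 2), |c| / 2 := by
          rw [setIntegral_const, measureReal_def, Real.volume_Icc, ENNReal.toReal_ofReal
            (by linarith [abs_nonneg c]), smul_eq_mul, ← sq_abs c]
          ring
      _ ≤ ∫ x in Set.Icc (1 - |c| / 2) (1 + |c| / 2), F x := by
          refine setIntegral_mono_on (integrableOn_const (by simp)) (hint.mono_set hsub)
            measurableSet_Icc fun x hx => ?_
          refine le_trans ?_ ((le_max_left _ _).trans (hF0 x))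
          have : |1 - x| ≤ |c| / 2 := abs_le.2 ⟨by linarith [hx.2], by linarith [hx.1]⟩
          linarith
      _ ≤ ∫ x in Set.Icc (-2) 2, F x :=
          setIntegral_mono_set hint (.of_forall fun x => (le_max_right _ _).trans (hF0 x))
            (.of_forall hsub)

/-- The standard normal distribution function. -/
noncomputable def normalCdf (t : ℝ) : ℝ := ∫ z in Set.Iic t, gaussianPDFReal 0 1 z

lemma continuous_gaussianPDFReal : Continuous (gaussianPDFReal 0 1) :=
  continuous_iff_continuousAt.2 fun z => (hasDerivAt_gaussianPDFReal z).continuousAt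

lemma hasDerivAt_normalCdf (t : ℝ) : HasDerivAt normalCdf (gaussianPDFReal 0 1 t) t := by
  have hi := integrable_gaussianPDFReal 0 1
  have h : normalCdf = fun t => normalCdf 0 + ∫ z in (0 : ℝ)..t, gaussianPDFReal 0 1 z := by
    ext t
    rw [← intervalIntegral.integral_Iic_sub_Iic hi.integrableOn hi.integrableOn]
    simp [normalCdf]
  rw [h]
  exact (continuous_gaussianPDFReal.integral_hasStrictDerivAt 0 t).hasDerivAt.const_add _

lemma tendsto_gaussianPDFReal_atBot :
    Filter.Tendsto (gaussianPDFReal 0 1) Filter.atBot (nhds 0) := by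
  have h : gaussianPDFReal 0 1 =
      fun x => (Real.sqrt (2 * Real.pi))⁻¹ * Real.exp (-(x ^ 2 / 2)) := by
    ext x; simp [gaussianPDFReal, neg_div]
  rw [h, show (0 : ℝ) = (Real.sqrt (2 * Real.pi))⁻¹ * 0 by simp]
  refine Filter.Tendsto.const_mul _ (Real.tendsto_exp_neg_atTop_nhds_zero.comp ?_)
  have : Filter.Tendsto (fun x : ℝ => x ^ 2) Filter.atBot Filter.atTop := by
    have := (Filter.tendsto_pow_atTop (α := ℝ) two_ne_zero).comp Filter.tendsto_neg_atBot_atTop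
    refine this.congr fun x => ?_
    simp
  exact this.atTop_div_const (by norm_num)

/-- `𝔼 (t - Z)₊` for a standard normal variable. -/
lemma integral_max_sub (t : ℝ) : ∫ z, max (t - z) 0 ∂gaussianReal 0 1 =
    t * normalCdf t + gaussianPDFReal 0 1 t := by
  have hi := integrable_gaussianPDFReal 0 1
  have hzi : Integrable (fun z => -z * gaussianPDFReal 0 1 z) := by
    have := integrable_gaussianReal_iff.1 (integrable_id_gaussianReal 0 1)
    exact this.neg.congr (.of_forall fun x => by simp only [Pi.neg_apply, id]; ring)
  rw [integral_gaussianReal_eq_integral_smul one_ne_zero]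
  have h : ∀ z, gaussianPDFReal 0 1 z • max (t - z) 0 =
      (Set.Iic t).indicator (fun z => t * gaussianPDFReal 0 1 z + -z * gaussianPDFReal 0 1 z) z := by
    intro z
    by_cases hz : z ≤ t
    · rw [Set.indicator_of_mem (by exact hz), max_eq_left (by linarith), smul_eq_mul]; ring
    · rw [Set.indicator_of_notMem (by exact hz), max_eq_right (by linarith), smul_zero]
  simp_rw [h]
  rw [integral_indicator measurableSet_Iic, integral_add (hi.const_mul t).integrableOn
    hzi.integrableOn, integral_const_mul, integral_Iic_of_hasDerivAt_of_tendsto'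
    (fun x _ => hasDerivAt_gaussianPDFReal x) hzi.integrableOn tendsto_gaussianPDFReal_atBot,
    sub_zero]
  rfl

variable {σ : ℝ}

/-- The normalized margin `(1 - r) / (σ √r)`. -/
noncomputable def margin (σ r : ℝ) : ℝ := (1 - r) / (σ * Real.sqrt r)

lemma hasDerivAt_margin (hσ : 0 < σ) {r : ℝ} (hr : 0 < r) :
    HasDerivAt (margin σ) (-(1 + r) / (2 * σ * (r * Real.sqrt r))) r := by
  have hq : 0 < Real.sqrt r := Real.sqrt_pos.2 hr
  have h := ((hasDerivAt_id r).const_sub 1).div ((Real.hasDerivAt_sqrt hr.ne').const_mul σ)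
    (by positivity)
  convert! h using 1
  have hqr : r = Real.sqrt r ^ 2 := (Real.sq_sqrt hr.le).symm
  set q := Real.sqrt r
  simp only [id]
  rw [hqr]
  field_simp
  ring

/-- Factor `σ √r` out of the hinge: what remains is the positive part of `margin σ r - Z`. -/
lemma hPop_hinge (hσ : 0 < σ) (β : ℝ) {r : ℝ} (hr : 0 < r) : hPop hinge σ β r =
    (1 - r) * normalCdf (margin σ r) + σ * Real.sqrt r * gaussianPDFReal 0 1 (margin σ r)
      + β * r := by
  have hq : 0 < Real.sqrt r := Real.sqrt_pos.2 hr
  have hm : σ * Real.sqrt r * margin σ r = 1 - r := by unfold margin; field_simp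
  unfold hPop
  have h : ∀ z, hinge (r + σ * Real.sqrt r * z) =
      σ * Real.sqrt r * max (margin σ r - z) 0 := by
    intro z
    rw [mul_max_of_nonneg _ _ (by positivity), mul_zero, mul_sub, hm, hinge]
    congr 1
    ring
  simp_rw [h]
  rw [integral_const_mul, integral_max_sub, mul_add, ← mul_assoc, hm]

/-- Two differentiations of the closed form give the second derivative `φ (margin σ r) (r² + (2 -
σ²) r + 1) / (4 σ r² √r)`. Its quadratic factor is `(r - 1)² + (4 - σ²) r`, positive because `σ² <
4`. Compactness of `[a, b]` then supplies the modulus. -/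
lemma exists_hPop_hinge_strongConvex (hσ : 0 < σ) {β : ℝ} (hσ1 : σ ^ 2 < 4) {a b : ℝ}
    (ha : 0 < a) (hab : a < b) : ∃ m > 0,
      ConvexOn ℝ (Set.Icc a b) (fun x => hPop hinge σ β x - m / 2 * x ^ 2) := by
  set φ := gaussianPDFReal 0 1 with hφ
  have hD1 : ∀ r, 0 < r → HasDerivAt (hPop hinge σ β)
      (-normalCdf (margin σ r) + σ * (1 / (2 * Real.sqrt r)) * φ (margin σ r) + β) r := by
    intro r hr
    have hq : 0 < Real.sqrt r := Real.sqrt_pos.2 hr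
    have hm : σ * Real.sqrt r * margin σ r = 1 - r := by unfold margin; field_simp
    have h1 := hasDerivAt_margin hσ hr
    have h2 := (hasDerivAt_normalCdf (margin σ r)).comp r h1
    have h3 := (hasDerivAt_gaussianPDFReal (margin σ r)).comp r h1
    have h4 := ((((hasDerivAt_id r).const_sub 1).mul h2).add
      (((Real.hasDerivAt_sqrt hr.ne').const_mul σ).mul h3)).add ((hasDerivAt_id r).const_mul β)
    have h5 : HasDerivAt (hPop hinge σ β) _ r := h4.congr_of_eventuallyEq (by
      filter_upwards [Ioi_mem_nhds hr] with s hs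
      exact hPop_hinge hσ β hs)
    convert! h5 using 1
    simp only [Function.comp_apply, id]
    -- The terms containing the derivative of the margin cancel, since `φ' (t) = -t φ (t)` and `σ √r
    -- * margin σ r = 1 - r`.
    linear_combination (φ (margin σ r) * (-(1 + r) / (2 * σ * (r * Real.sqrt r)))) * hm
  set H : ℝ → ℝ := fun r => φ (margin σ r) * (r ^ 2 + (2 - σ ^ 2) * r + 1) /
    (4 * σ * (r ^ 2 * Real.sqrt r)) with hH
  have hD2 : ∀ r, 0 < r → HasDerivAt
      (fun r => -normalCdf (margin σ r) + σ * (1 / (2 * Real.sqrt r)) * φ (margin σ r) + β)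
      (H r) r := by
    intro r hr
    have hq : 0 < Real.sqrt r := Real.sqrt_pos.2 hr
    have h1 := hasDerivAt_margin hσ hr
    have h2 := (hasDerivAt_normalCdf (margin σ r)).comp r h1
    have h3 := (hasDerivAt_gaussianPDFReal (margin σ r)).comp r h1
    have h4 : HasDerivAt (fun r => σ * (1 / (2 * Real.sqrt r)))
        (-σ / (4 * (r * Real.sqrt r))) r := by
      have := ((((Real.hasDerivAt_sqrt hr.ne').const_mul 2).inv (by positivity)).const_mul σ)
      simp only [one_div]
      convert! this using 1
      have hqr : r = Real.sqrt r ^ 2 := (Real.sq_sqrt hr.le).symm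
      set q := Real.sqrt r
      rw [hqr]
      field_simp
      ring
    have h5 := (h2.neg.add (h4.mul h3)).add_const β
    convert! h5 using 1
    simp only [Function.comp_apply, hH, ← hφ]
    have hm : margin σ r = (1 - r) / (σ * Real.sqrt r) := rfl
    generalize φ (margin σ r) = y
    rw [hm]
    have hqr : r = Real.sqrt r ^ 2 := (Real.sq_sqrt hr.le).symm
    set q := Real.sqrt r
    rw [hqr]
    field_simp
    ring
  have hpos : ∀ r, 0 < r → 0 < H r := by
    intro r hr
    have hq : 0 < Real.sqrt r := Real.sqrt_pos.2 hr
    have h1 : 0 < φ (margin σ r) := gaussianPDFReal_pos _ _ _ one_ne_zero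
    have h2 : 0 < r ^ 2 + (2 - σ ^ 2) * r + 1 := by nlinarith [sq_nonneg (r - 1)]
    simp only [hH]
    positivity
  have hcont : ContinuousOn H (Set.Icc a b) := by
    intro r hr
    have hr0 : 0 < r := ha.trans_le hr.1
    have hq : 0 < Real.sqrt r := Real.sqrt_pos.2 hr0
    have h1 : ContinuousAt (fun r => φ (margin σ r)) r :=
      (hasDerivAt_gaussianPDFReal _).continuousAt.comp (hasDerivAt_margin hσ hr0).continuousAt
    exact (ContinuousAt.div (h1.mul (by fun_prop)) (by fun_prop) (by positivity)).continuousWithinAt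
  obtain ⟨y, hy, hmin⟩ := isCompact_Icc.exists_isMinOn ⟨a, le_rfl, hab.le⟩ hcont
  exact ⟨H y, hpos y (ha.trans_le hy.1), convexOn_sub_sq (fun r hr => hD1 r (ha.trans_le hr.1))
    (fun r hr => hD2 r (ha.trans_le hr.1)) fun r hr => hmin hr⟩

end Hinge

/-! ### Both losses -/

section HingeOrLogistic

variable {V : ℝ → ℝ} {σ β : ℝ}

lemma HingeOrLogistic.regularLoss (hV : HingeOrLogistic V σ β) : RegularLoss V := by
  rcases hV with ⟨rfl, -, -⟩ | ⟨rfl, -, -⟩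
  · exact regularLoss_hinge
  · exact regularLoss_logistic

lemma HingeOrLogistic.strongConvex (hV : HingeOrLogistic V σ β) (hσ : 0 < σ) {a b : ℝ}
    (ha : 0 < a) (hab : a < b) : ∃ m > 0,
      ConvexOn ℝ (Set.Icc a b) (fun x => hPop V σ β x - m / 2 * x ^ 2) := by
  rcases hV with ⟨rfl, h, -⟩ | ⟨rfl, h, -⟩
  · exact exists_hPop_hinge_strongConvex hσ h ha hab
  · refine exists_hPop_logistic_strongConvex ?_ ha hab
    -- The noise bound `-4 + 2 √6` is below 1, and `σ² ≤ 1` is all that the strong convexity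
    -- argument needs.
    have : Real.sqrt 6 ≤ 5 / 2 := by
      rw [Real.sqrt_le_left (by norm_num)]; norm_num
    linarith

/-- Quadratic growth of the one-dimensional population loss at a positive minimizer. -/
lemma HingeOrLogistic.exists_growth (hV : HingeOrLogistic V σ β) (hσ : 0 < σ) {r : ℝ}
    (hr : 0 < r) (hmin : IsMinOn (hPop V σ β) (Set.Ici 0) r) {R : ℝ} (hR : 0 < R) :
    ∃ κ > 0, ∀ x, 0 ≤ x → x ≤ R → κ * (x - r) ^ 2 ≤ hPop V σ β x - hPop V σ β r :=
  exists_quadratic_growth hr hmin (fun _ _ ha hab => hV.strongConvex hσ ha hab)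
    (continuous_hPop hV.regularLoss.lipschitz σ β).continuousWithinAt hR

end HingeOrLogistic

/-! ### Concentration of empirical averages -/

section Concentration

open scoped NNReal

lemma integrable_exp_mul_of_lipschitz {φ : ℝ → ℝ} (hφ : LipschitzWith 1 φ) (v : ℝ≥0) (t : ℝ) :
    Integrable (fun x => Real.exp (t * φ x)) (gaussianReal 0 v) := by
  have hc := hφ.continuous
  refine (((integrable_exp_mul_gaussianReal (μ := 0) (v := v) t).add
    (integrable_exp_mul_gaussianReal (μ := 0) (v := v) (-t))).const_mul
      (Real.exp (t * φ 0))).mono' (by fun_prop) (.of_forall fun x => ?_)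
  rw [Real.norm_of_nonneg (Real.exp_pos _).le]
  have h1 := abs_sub_le_of_lipschitz hφ x 0
  rw [sub_zero] at h1
  have h2 : t * (φ x - φ 0) ≤ |t * x| := by
    refine (le_abs_self _).trans ?_
    rw [abs_mul, abs_mul]
    gcongr
  calc Real.exp (t * φ x) ≤ Real.exp (t * φ 0 + |t * x|) := Real.exp_le_exp.2 (by linarith)
    _ = Real.exp (t * φ 0) * Real.exp |t * x| := Real.exp_add _ _
    _ ≤ Real.exp (t * φ 0) * (Real.exp (t * x) + Real.exp (-t * x)) := by
        refine mul_le_mul_of_nonneg_left ?_ (Real.exp_pos _).le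
        have h3 := Real.exp_pos (t * x)
        have h4 := Real.exp_pos (-t * x)
        rcases abs_cases (t * x) with ⟨h, -⟩ | ⟨h, -⟩ <;> rw [h]
        · linarith
        · rw [← neg_mul]; linarith

/-- A `1`-Lipschitz function of a centered Gaussian variable of variance `v` is subgaussian. -/
lemma hasSubgaussianMGF_of_lipschitz {φ : ℝ → ℝ} (hφ : LipschitzWith 1 φ) (v : ℝ≥0) :
    HasSubgaussianMGF (fun x => φ x - ∫ y, φ y ∂gaussianReal 0 v) (2 * v) (gaussianReal 0 v) := by
  set γ := gaussianReal 0 v with hγ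
  set m := ∫ y, φ y ∂γ with hm
  have hi : ∀ t, Integrable (fun x => Real.exp (t * φ x)) γ :=
    integrable_exp_mul_of_lipschitz hφ v
  have he : ∀ t x, Real.exp (t * (φ x - m)) = Real.exp (-t * m) * Real.exp (t * φ x) := by
    intro t x; rw [← Real.exp_add]; ring_nf
  refine ⟨fun t => ?_, fun t => ?_⟩
  · simp_rw [he]
    exact (hi t).const_mul _
  have hφi : Integrable φ γ := integrable_gaussianReal_of_lipschitz hφ 0 v
  -- Jensen replaces the mean by an independent copy, so the centered moment generating function is
  -- at most `𝔼 exp (t (φ X - φ X'))`.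
  have hJ : Real.exp (-t * m) ≤ ∫ x, Real.exp (-t * φ x) ∂γ := by
    have := convexOn_exp.map_integral_le (μ := γ) (f := fun x => -t * φ x)
      Real.continuous_exp.continuousOn isClosed_univ (.of_forall fun x => Set.mem_univ _)
      (hφi.const_mul _) (hi (-t))
    rwa [integral_const_mul] at this
  have hA : ∀ t, ∫ x, Real.exp (t * x) ∂γ = Real.exp (v * t ^ 2 / 2) := by
    intro t
    have := congrFun (mgf_fun_id_gaussianReal (μ := 0) (v := v)) t
    simpa [mgf] using this
  have hM0 : 0 ≤ ∫ x, Real.exp (t * φ x) ∂γ := integral_nonneg fun x => (Real.exp_pos _).le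
  have hprod : (∫ x, Real.exp (t * φ x) ∂γ) * ∫ x, Real.exp (-t * φ x) ∂γ ≤
      (∫ x, Real.exp (t * x) ∂γ) * ∫ x, Real.exp (-t * x) ∂γ := by
    have hid := integrable_exp_mul_gaussianReal (μ := 0) (v := v)
    have e1 := integral_prod_mul (μ := γ) (ν := γ) (fun x => Real.exp (t * φ x))
      (fun x => Real.exp (-t * φ x))
    have e2 := integral_prod_mul (μ := γ) (ν := γ) (fun x => Real.exp (-t * φ x))
      (fun x => Real.exp (t * φ x))
    have e3 := integral_prod_mul (μ := γ) (ν := γ) (fun x => Real.exp (t * x))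
      (fun x => Real.exp (-t * x))
    have e4 := integral_prod_mul (μ := γ) (ν := γ) (fun x => Real.exp (-t * x))
      (fun x => Real.exp (t * x))
    have i1 := (hi t).mul_prod (hi (-t))
    have i2 := (hi (-t)).mul_prod (hi t)
    have i3 := (hid t).mul_prod (hid (-t))
    have i4 := (hid (-t)).mul_prod (hid t)
    -- Exchanging the two copies turns the exponential into a hyperbolic cosine, which increases in
    -- the absolute value of its argument. The Lipschitz bound thus replaces `φ X - φ X'` by `X -
    -- X'`, of variance `2 v`; hence the proxy `2 * v`.
    have hmono := integral_mono (i1.add i2) (i3.add i4) (fun z => by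
      have h1 := abs_sub_le_of_lipschitz hφ z.1 z.2
      have h2 : |t * (φ z.1 - φ z.2)| ≤ |t * (z.1 - z.2)| := by
        rw [abs_mul, abs_mul]; gcongr
      have h3 := Real.cosh_le_cosh.2 h2
      rw [Real.cosh_eq, Real.cosh_eq] at h3
      simp only [Pi.add_apply, ← Real.exp_add]
      have a1 : t * φ z.1 + -t * φ z.2 = t * (φ z.1 - φ z.2) := by ring
      have a2 : -t * φ z.1 + t * φ z.2 = -(t * (φ z.1 - φ z.2)) := by ring
      have a3 : t * z.1 + -t * z.2 = t * (z.1 - z.2) := by ring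
      have a4 : -t * z.1 + t * z.2 = -(t * (z.1 - z.2)) := by ring
      rw [a1, a2, a3, a4]
      linarith)
    simp only [Pi.add_apply] at hmono
    rw [integral_add i1 i2, integral_add i3 i4, e1, e2, e3, e4] at hmono
    linarith
  have hmgf : mgf (fun x => φ x - m) γ t = Real.exp (-t * m) * ∫ x, Real.exp (t * φ x) ∂γ := by
    simp only [mgf]
    simp_rw [he]
    rw [integral_const_mul]
  rw [hmgf]
  calc Real.exp (-t * m) * ∫ x, Real.exp (t * φ x) ∂γ
      ≤ (∫ x, Real.exp (-t * φ x) ∂γ) * ∫ x, Real.exp (t * φ x) ∂γ := by gcongr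
    _ ≤ (∫ x, Real.exp (t * x) ∂γ) * ∫ x, Real.exp (-t * x) ∂γ := by rw [mul_comm]; exact hprod
    _ = Real.exp ((2 * v : ℝ≥0) * t ^ 2 / 2) := by
        rw [hA, hA, ← Real.exp_add]
        push_cast
        ring_nf

variable {D d : ℕ} {B : Matrix (Fin D) (Fin d) ℝ} {SZ : Matrix (Fin d) (Fin d) ℝ} {σ : ℝ}

lemma hasSubgaussianMGF_imageLaw (hSZ : SZ.PosSemidef) {φ : ℝ → ℝ} (hφ : LipschitzWith 1 φ)
    (a : Img D) {c : ℝ≥0} (hc : 2 * imageForm B SZ σ a a ≤ c) :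
    HasSubgaussianMGF (fun x => φ (inner ℝ a x) - ∫ y, φ (inner ℝ a y) ∂imageLaw B SZ σ) c
      (imageLaw B SZ σ) := by
  have h := hasSubgaussianMGF_of_lipschitz hφ (imageForm B SZ σ a a).toNNReal
  rw [← map_inner_imageLaw hSZ a, integral_map (by fun_prop)
    hφ.continuous.aestronglyMeasurable] at h
  have h2 := h.of_map (Y := fun x => inner ℝ a x) (by fun_prop)
  refine ⟨h2.integrable_exp_mul, fun t => (h2.mgf_le t).trans (Real.exp_le_exp.2 ?_)⟩
  push_cast
  rw [Real.coe_toNNReal _ (imageForm_nonneg hSZ a)]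
  gcongr

lemma measureReal_pi_sum_ge_le {Ω : Type*} [MeasurableSpace Ω] {P : Measure Ω}
    [IsProbabilityMeasure P] {f : Ω → ℝ} {c : ℝ≥0} (hm : Measurable f)
    (hf : HasSubgaussianMGF f c P) (n : ℕ) {ε : ℝ} (hε : 0 ≤ ε) :
    (Measure.pi (fun _ : Fin n => P)).real {x | ε ≤ ∑ i, f (x i)} ≤
      Real.exp (-ε ^ 2 / (2 * (n * c))) := by
  have hind : iIndepFun (fun (i : Fin n) (x : Fin n → Ω) => f (x i))
      (Measure.pi (fun _ : Fin n => P)) := iIndepFun_pi fun _ => hm.aemeasurable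
  have := HasSubgaussianMGF.measure_sum_ge_le_of_iIndepFun hind (c := fun _ => c)
    (s := Finset.univ) (fun i _ => by
      refine HasSubgaussianMGF.of_map (Y := fun x : Fin n → Ω => x i)
        (measurable_pi_apply i).aemeasurable ?_
      rw [(measurePreserving_eval (fun _ : Fin n => P) i).map_eq]
      exact hf) hε
  simpa using this

/-- Simultaneous concentration of finitely many empirical averages of `1`-Lipschitz functions of
linear functionals of the images. -/
lemma exists_concentration_event (hSZ : SZ.PosSemidef) {J : Type*} [Fintype J]
    (φ : J → ℝ → ℝ) (hφ : ∀ j, LipschitzWith 1 (φ j)) (a : J → Img D) {c : ℝ} (hc0 : 0 < c)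
    (hc : ∀ j, 2 * imageForm B SZ σ (a j) (a j) ≤ c) {n : ℕ} (hn : 1 ≤ n) {t : ℝ} (ht : 0 ≤ t) :
    ∃ E : Set (Fin n → Img D), MeasurableSet E ∧
      ENNReal.ofReal (1 - 2 * Fintype.card J * Real.exp (-(n * t ^ 2) / (2 * c))) ≤
        Measure.pi (fun _ : Fin n => imageLaw B SZ σ) E ∧
      ∀ x ∈ E, ∀ j, |1 / (n : ℝ) * ∑ i, φ j (inner ℝ (a j) (x i)) -
        ∫ y, φ j (inner ℝ (a j) y) ∂imageLaw B SZ σ| ≤ t := by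
  set P := imageLaw B SZ σ with hP
  set Q := Measure.pi (fun _ : Fin n => P) with hQ
  have hn0 : (0 : ℝ) < n := by exact_mod_cast hn
  set f : J → Img D → ℝ := fun j x => φ j (inner ℝ (a j) x) - ∫ y, φ j (inner ℝ (a j) y) ∂P with hf
  have hfm : ∀ j, Measurable (f j) := fun j => by
    have := (hφ j).continuous.measurable
    fun_prop
  have hsub : ∀ j, HasSubgaussianMGF (f j) c.toNNReal P := fun j =>
    hasSubgaussianMGF_imageLaw hSZ (hφ j) (a j) (by rw [Real.coe_toNNReal _ hc0.le]; exact hc j)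
  set F : J → Set (Fin n → Img D) := fun j =>
    {x | n * t ≤ ∑ i, f j (x i)} ∪ {x | n * t ≤ ∑ i, -f j (x i)} with hF
  have hFm : ∀ j, MeasurableSet (F j) := fun j => by
    refine (measurableSet_le measurable_const ?_).union (measurableSet_le measurable_const ?_)
    · exact Finset.measurable_sum _ fun i _ => (hfm j).comp (measurable_pi_apply i)
    · exact Finset.measurable_sum _ fun i _ => ((hfm j).comp (measurable_pi_apply i)).neg
  have hexp : -(n * t) ^ 2 / (2 * (n * (c.toNNReal : ℝ))) = -(n * t ^ 2) / (2 * c) := by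
    rw [Real.coe_toNNReal _ hc0.le]
    field_simp
  have hFb : ∀ j, Q.real (F j) ≤ 2 * Real.exp (-(n * t ^ 2) / (2 * c)) := fun j => by
    have h1 := measureReal_pi_sum_ge_le (hfm j) (hsub j) n (by positivity : 0 ≤ n * t)
    have h2 := measureReal_pi_sum_ge_le (hfm j).neg (hsub j).neg n (by positivity : 0 ≤ n * t)
    rw [hexp] at h1 h2
    refine (measureReal_union_le _ _).trans ?_
    rw [two_mul]
    exact add_le_add h1 h2
  have hU : Q.real (⋃ j, F j) ≤ 2 * Fintype.card J * Real.exp (-(n * t ^ 2) / (2 * c)) := by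
    refine (measureReal_iUnion_fintype_le _).trans ((Finset.sum_le_sum fun j _ => hFb j).trans ?_)
    simp
    linarith
  refine ⟨(⋃ j, F j)ᶜ, (MeasurableSet.iUnion hFm).compl, ?_, fun x hx j => ?_⟩
  · have h1 := probReal_compl_eq_one_sub (μ := Q) (MeasurableSet.iUnion hFm)
    rw [← ENNReal.ofReal_toReal (measure_ne_top Q (⋃ j, F j)ᶜ)]
    refine ENNReal.ofReal_le_ofReal ?_
    rw [← measureReal_def, h1]
    linarith
  · have hx' : x ∉ F j := fun h => hx (Set.mem_iUnion.2 ⟨j, h⟩)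
    simp only [hF, Set.mem_union, Set.mem_ofPred_eq, not_or, not_le, Finset.sum_neg_distrib] at hx'
    have hs : ∑ i, f j (x i) = n * (1 / (n : ℝ) * ∑ i, φ j (inner ℝ (a j) (x i)) -
        ∫ y, φ j (inner ℝ (a j) y) ∂P) := by
      simp only [hf, Finset.sum_sub_distrib, Finset.sum_const, Finset.card_univ, Fintype.card_fin,
        nsmul_eq_mul]
      field_simp
    rw [hs] at hx'
    rw [abs_le]
    constructor <;> nlinarith [hx'.1, hx'.2]

end Concentration

/-! ### Uniform deviation of the empirical objective -/

section Deviation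

open scoped NNReal

variable {K D d : ℕ} {V : ℝ → ℝ}

@[simp]
lemma abs_bit (m : Message K) (k : Fin K) : |bit m k| = 1 := by
  rcases Int.units_eq_one_or (m k) with h | h <;> simp [bit, h]

@[simp]
lemma bit_mul_self (m : Message K) (k : Fin K) : bit m k * bit m k = 1 := by
  rcases Int.units_eq_one_or (m k) with h | h <;> simp [bit, h]

/-- The deterministic part of the `k`-th decoding margin. -/
noncomputable def offset (w : Fin K → Img D) (m : Message K) (k : Fin K) : ℝ :=
  bit m k * inner ℝ (w k) (∑ j, bit m j • w j)

lemma bit_mul_inner_embed (w : Fin K → Img D) (m : Message K) (k : Fin K) (x : Img D) :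
    bit m k * inner ℝ (w k) (embed w m x) = inner ℝ (bit m k • w k) x + offset w m k := by
  rw [embed, inner_add_right, mul_add, real_inner_smul_left, offset]

/-- The population objective. -/
noncomputable def popLoss (V : ℝ → ℝ) (β : ℝ) (P : Measure (Img D)) (w : Fin K → Img D) : ℝ :=
  (1 / (2 : ℝ) ^ K) * ∑ m : Message K, ∑ k, ∫ x, V (bit m k * inner ℝ (w k) (embed w m x)) ∂P
    + β * ∑ k, ‖w k‖ ^ 2

lemma inner_eq_sum (x y : Img D) : inner ℝ x y = ∑ i, x i * y i := by
  rw [PiLp.inner_apply]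
  exact Finset.sum_congr rfl fun i _ => by rw [RCLike.inner_apply, conj_trivial, mul_comm]

lemma abs_inner_sub_le {w w' : Fin K → Img D} {ρ h : ℝ} (hw : ∀ k i, |w k i| ≤ ρ)
    (hw' : ∀ k i, |w' k i| ≤ ρ) (hh : ∀ k i, |w k i - w' k i| ≤ h) (j k : Fin K) :
    |inner ℝ (w k) (w j) - inner ℝ (w' k) (w' j)| ≤ D * (2 * ρ * h) := by
  rw [inner_eq_sum, inner_eq_sum, ← Finset.sum_sub_distrib]
  refine (Finset.abs_sum_le_sum_abs _ _).trans ((Finset.sum_le_sum (g := fun _ => 2 * ρ * h)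
    fun i _ => ?_).trans (by simp))
  have h1 : w k i * w j i - w' k i * w' j i =
      (w k i - w' k i) * w j i + w' k i * (w j i - w' j i) := by ring
  have hh0 : 0 ≤ h := (abs_nonneg _).trans (hh k i)
  have hρ0 : 0 ≤ ρ := (abs_nonneg _).trans (hw k i)
  rw [h1]
  refine (abs_add_le _ _).trans ?_
  rw [abs_mul, abs_mul]
  calc _ ≤ h * ρ + ρ * h := by
        gcongr
        · exact hh k i
        · exact hw j i
        · exact hw' k i
        · exact hh j i
    _ = _ := by ring

/-- On the cube the loss is Lipschitz in the coordinates of the watermark, with a constant affine in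
the `ℓ¹` norm of the image. Passing from a grid point to a general watermark therefore requires
control of the empirical means of `|x i|` as well. -/
lemma abs_loss_sub_le (hV : LipschitzWith 1 V) {w w' : Fin K → Img D} {ρ h : ℝ}
    (hw : ∀ k i, |w k i| ≤ ρ) (hw' : ∀ k i, |w' k i| ≤ ρ) (hh : ∀ k i, |w k i - w' k i| ≤ h)
    (m : Message K) (k : Fin K) (x : Img D) :
    |V (bit m k * inner ℝ (w k) (embed w m x)) - V (bit m k * inner ℝ (w' k) (embed w' m x))| ≤
      h * (∑ i, |x i| + K * D * (2 * ρ)) := by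
  refine (abs_sub_le_of_lipschitz hV _ _).trans ?_
  rw [← mul_sub, abs_mul, abs_bit, one_mul]
  have h1 : inner ℝ (w k) (embed w m x) - inner ℝ (w' k) (embed w' m x) =
      ∑ i, (w k i - w' k i) * x i +
        ∑ j, bit m j * (inner ℝ (w k) (w j) - inner ℝ (w' k) (w' j)) := by
    simp only [embed, inner_add_right, inner_sum, real_inner_smul_right]
    rw [inner_eq_sum, inner_eq_sum]
    simp only [sub_mul, mul_sub, Finset.sum_sub_distrib]
    ring
  rw [h1]
  refine (abs_add_le _ _).trans ?_
  rw [mul_add]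
  refine add_le_add ?_ ?_
  · refine (Finset.abs_sum_le_sum_abs _ _).trans ?_
    rw [Finset.mul_sum]
    refine Finset.sum_le_sum fun i _ => ?_
    rw [abs_mul]
    exact mul_le_mul_of_nonneg_right (hh k i) (abs_nonneg _)
  · refine (Finset.abs_sum_le_sum_abs _ _).trans ((Finset.sum_le_sum
      (g := fun _ => D * (2 * ρ * h)) fun j _ => ?_).trans (le_of_eq ?_))
    · rw [abs_mul, abs_bit, one_mul]
      exact abs_inner_sub_le hw hw' hh j k
    · simp
      ring

lemma abs_sum_message_le {F : Message K → Fin K → ℝ} {c : ℝ} (h : ∀ m k, |F m k| ≤ c) :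
    |1 / (2 : ℝ) ^ K * ∑ m : Message K, ∑ k, F m k| ≤ K * c := by
  rw [abs_mul, abs_of_pos (by positivity : (0 : ℝ) < 1 / 2 ^ K)]
  have h1 : |∑ m : Message K, ∑ k, F m k| ≤ 2 ^ K * (K * c) := by
    refine (Finset.abs_sum_le_sum_abs _ _).trans ((Finset.sum_le_sum (g := fun _ => K * c)
      fun m _ => (Finset.abs_sum_le_sum_abs _ _).trans ((Finset.sum_le_sum (g := fun _ => c)
      fun k _ => h m k).trans (by simp))).trans (by simp))
  calc 1 / (2 : ℝ) ^ K * |∑ m : Message K, ∑ k, F m k| ≤ 1 / 2 ^ K * (2 ^ K * (K * c)) := by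
        gcongr
    _ = K * c := by field_simp

/-- The grid points of mesh `1 / n` in the cube of radius `ρ`. -/
noncomputable def gridPoint {n ρ : ℕ} (g : Fin K → Fin D → Fin (2 * ρ * n + 1)) :
    Fin K → Img D :=
  fun k => WithLp.toLp 2 fun i => ((g k i : ℕ) : ℝ) / n - ρ

lemma abs_gridPoint_le {n ρ : ℕ} (hn : 1 ≤ n) (g : Fin K → Fin D → Fin (2 * ρ * n + 1)) (k : Fin K)
    (i : Fin D) : |gridPoint g k i| ≤ ρ := by
  have hn0 : (0 : ℝ) < n := by exact_mod_cast hn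
  have h1 : ((g k i : ℕ) : ℝ) ≤ 2 * ρ * n := by
    have := Nat.lt_succ_iff.1 (g k i).2
    exact_mod_cast this
  have h2 : ((g k i : ℕ) : ℝ) / n ≤ 2 * ρ := by rwa [div_le_iff₀ hn0]
  have h3 : 0 ≤ ((g k i : ℕ) : ℝ) / n := by positivity
  simp only [gridPoint]
  rw [abs_le]
  constructor <;> linarith

lemma exists_gridPoint {n ρ : ℕ} (hn : 1 ≤ n) {w : Fin K → Img D} (hw : ∀ k i, |w k i| ≤ ρ) :
    ∃ g : Fin K → Fin D → Fin (2 * ρ * n + 1), ∀ k i, |w k i - gridPoint g k i| ≤ 1 / n := by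
  have hn0 : (0 : ℝ) < n := by exact_mod_cast hn
  have h : ∀ k i, ∃ q : Fin (2 * ρ * n + 1), |w k i - ((q : ℕ) / n - ρ : ℝ)| ≤ 1 / n := by
    intro k i
    obtain ⟨h1, h2⟩ := abs_le.1 (hw k i)
    have h3 : 0 ≤ (w k i + ρ) * n := mul_nonneg (by linarith) hn0.le
    have h4 : ⌊(w k i + ρ) * n⌋₊ ≤ 2 * ρ * n := by
      refine Nat.floor_le_of_le ?_
      push_cast
      nlinarith
    refine ⟨⟨_, Nat.lt_succ_of_le h4⟩, ?_⟩
    have h5 := Nat.floor_le h3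
    have h6 := Nat.lt_floor_add_one ((w k i + ρ) * n)
    simp only
    have h7 : w k i - ((⌊(w k i + ρ) * n⌋₊ : ℝ) / n - ρ) =
        ((w k i + ρ) * n - ⌊(w k i + ρ) * n⌋₊) / n := by field_simp; ring
    rw [h7, abs_of_nonneg (by apply div_nonneg <;> linarith)]
    gcongr
    linarith
  choose g hg using h
  exact ⟨g, hg⟩

lemma empLoss_sub_popLoss {n : ℕ} (V : ℝ → ℝ) (β : ℝ) (P : Measure (Img D))
    (x : Fin n → Img D) (w : Fin K → Img D) :
    empLoss V β x w - popLoss V β P w = 1 / (2 : ℝ) ^ K * ∑ m : Message K, ∑ k,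
      (1 / (n : ℝ) * ∑ i, V (bit m k * inner ℝ (w k) (embed w m (x i))) -
        ∫ y, V (bit m k * inner ℝ (w k) (embed w m y)) ∂P) := by
  simp only [empLoss, popLoss, Finset.sum_sub_distrib, mul_sub, add_sub_add_right_eq_sub]
  congr 1
  simp only [Finset.mul_sum]
  rw [Finset.sum_comm]
  refine Finset.sum_congr rfl fun m _ => ?_
  rw [Finset.sum_comm]
  refine Finset.sum_congr rfl fun k _ => Finset.sum_congr rfl fun i _ => ?_
  ring

variable {B : Matrix (Fin D) (Fin d) ℝ} {SZ : Matrix (Fin d) (Fin d) ℝ} {σ : ℝ}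

lemma integrable_lipschitz_inner (hSZ : SZ.PosSemidef) {φ : ℝ → ℝ} (hφ : LipschitzWith 1 φ)
    (a : Img D) : Integrable (fun x => φ (inner ℝ a x)) (imageLaw B SZ σ) := by
  have := integrable_gaussianReal_of_lipschitz hφ 0 (imageForm B SZ σ a a).toNNReal
  rw [← map_inner_imageLaw hSZ a, integrable_map_measure hφ.continuous.aestronglyMeasurable
    (by fun_prop)] at this
  exact this

lemma integrable_loss (hSZ : SZ.PosSemidef) (hV : LipschitzWith 1 V) (w : Fin K → Img D)
    (m : Message K) (k : Fin K) :
    Integrable (fun x => V (bit m k * inner ℝ (w k) (embed w m x))) (imageLaw B SZ σ) := by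
  simp_rw [bit_mul_inner_embed]
  exact integrable_lipschitz_inner hSZ (lipschitz_comp_add hV (offset w m k)) _

lemma lipschitz_abs : LipschitzWith 1 (fun x : ℝ => |x|) :=
  LipschitzWith.of_dist_le_mul fun a b => by
    simpa [Real.dist_eq] using abs_abs_sub_abs_le_abs_sub a b

lemma inner_single_one (i : Fin D) (x : Img D) :
    inner ℝ (EuclideanSpace.single i (1 : ℝ)) x = x i := by
  simp [EuclideanSpace.inner_single_left]

lemma integrable_abs_apply (hSZ : SZ.PosSemidef) (i : Fin D) :
    Integrable (fun x : Img D => |x i|) (imageLaw B SZ σ) := by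
  simpa only [inner_single_one] using
    integrable_lipschitz_inner (B := B) (σ := σ) hSZ lipschitz_abs (EuclideanSpace.single i (1 : ℝ))

lemma exists_imageForm_bound (B : Matrix (Fin D) (Fin d) ℝ) (SZ : Matrix (Fin d) (Fin d) ℝ) (σ : ℝ)
    (ρ : ℝ) : ∃ c > 0, ∀ a : Img D, (∀ i, |a i| ≤ ρ) → imageForm B SZ σ a a ≤ c := by
  have hcont : Continuous fun a : Img D => imageForm B SZ σ a a := by
    have h : ∀ a : Img D, imageForm B SZ σ a a =
        (imageForm B SZ σ).toContinuousBilinearMap a a := fun a => rfl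
    simp_rw [h]
    fun_prop
  have hK : IsCompact {a : Img D | ∀ i, |a i| ≤ ρ} := by
    have h1 : IsCompact (Set.univ.pi fun _ : Fin D => Set.Icc (-ρ) ρ) :=
      isCompact_univ_pi fun _ => isCompact_Icc
    have h2 := h1.image (PiLp.continuous_toLp 2 fun _ : Fin D => ℝ)
    convert! h2 using 1
    ext a
    simp only [Set.mem_ofPred_eq, Set.mem_image, Set.mem_univ_pi, Set.mem_Icc, abs_le]
    exact ⟨fun h => ⟨a.ofLp, h, rfl⟩, by rintro ⟨y, hy, rfl⟩; exact hy⟩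
  obtain ⟨c, hc⟩ := hK.bddAbove_image hcont.continuousOn
  exact ⟨max c 1, by positivity, fun a ha => (hc ⟨a, ha, rfl⟩).trans (le_max_left _ _)⟩

/-- Uniform deviation of the empirical objective over a cube, by a union bound over a grid of
mesh `1 / n`. -/
lemma exists_uniform_deviation (hSZ : SZ.PosSemidef) (hV : LipschitzWith 1 V) (β : ℝ)
    (K ρ : ℕ) : ∃ C > 0, ∃ c > 0, ∀ n : ℕ, 1 ≤ n → ∀ t : ℝ, 0 ≤ t → t ≤ 1 →
    ∃ E : Set (Fin n → Img D), MeasurableSet E ∧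
      ENNReal.ofReal (1 - C * (n : ℝ) ^ (K * D) * Real.exp (-(n * t ^ 2) / c)) ≤
        Measure.pi (fun _ : Fin n => imageLaw B SZ σ) E ∧
      ∀ x ∈ E, ∀ w : Fin K → Img D, (∀ k i, |w k i| ≤ ρ) →
        |empLoss V β x w - popLoss V β (imageLaw B SZ σ) w| ≤ C * (t + 1 / n) := by
  set P := imageLaw B SZ σ with hP
  -- The maximum with 1 also covers the coordinate vectors, which enter the union bound below.
  obtain ⟨c, hc0, hc⟩ := exists_imageForm_bound B SZ σ (max ρ 1)
  set A : ℝ := ∑ l : Fin D, ∫ y : Img D, |y l| ∂P with hA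
  have hA0 : 0 ≤ A := Finset.sum_nonneg fun l _ => integral_nonneg fun y => abs_nonneg _
  set C₁ : ℝ := 2 * (((2 * ρ + 1 : ℝ) ^ (K * D)) * 2 ^ K * K + D) with hC₁
  set C₂ : ℝ := K * (2 * A + D + 2 * (K * D * (2 * ρ))) with hC₂
  have hC₁0 : 0 ≤ C₁ := by positivity
  have hC₂0 : 0 ≤ C₂ := by positivity
  refine ⟨C₁ + C₂ + K + 1, by positivity, 4 * c, by positivity, fun n hn t ht ht1 => ?_⟩
  have hn0 : (0 : ℝ) < n := by exact_mod_cast hn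
  have hn1 : (1 : ℝ) ≤ n := by exact_mod_cast hn
  set G := Fin K → Fin D → Fin (2 * ρ * n + 1) with hG
  -- The union bound runs over the losses at the grid points, one for each message and bit, and over
  -- the `D` functions `|x i|`. Twice its cardinality is at most `C₁ * n ^ (K * D)`.
  set J := (G × Message K × Fin K) ⊕ Fin D with hJ
  let φ : J → ℝ → ℝ := Sum.elim
    (fun q s => V (s + offset (gridPoint q.1) q.2.1 q.2.2)) (fun _ s => |s|)
  let a : J → Img D := Sum.elim (fun q => bit q.2.1 q.2.2 • gridPoint q.1 q.2.2)
    (fun i => EuclideanSpace.single i 1)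
  have hφ : ∀ j, LipschitzWith 1 (φ j) := by
    rintro (q | i)
    · exact lipschitz_comp_add hV _
    · exact lipschitz_abs
  have ha : ∀ j, 2 * imageForm B SZ σ (a j) (a j) ≤ 2 * c := by
    intro j
    refine mul_le_mul_of_nonneg_left (hc _ ?_) (by norm_num)
    rcases j with q | i
    · intro i
      simp only [a, Sum.elim_inl, PiLp.smul_apply, smul_eq_mul, abs_mul, abs_bit, one_mul]
      exact (abs_gridPoint_le hn q.1 q.2.2 i).trans (le_max_left _ _)
    · intro i'
      simp only [a, Sum.elim_inr, PiLp.single_apply]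
      split_ifs <;> simp
  obtain ⟨E, hE, hEP, hEx⟩ := exists_concentration_event (σ := σ) (B := B) hSZ φ hφ a
    (by positivity : 0 < 2 * c) ha hn ht
  refine ⟨E, hE, le_trans (ENNReal.ofReal_le_ofReal ?_) hEP, fun x hx w hw => ?_⟩
  · have hcard : (2 : ℝ) * Fintype.card J ≤ C₁ * (n : ℝ) ^ (K * D) := by
      simp only [hJ, hG, Fintype.card_sum, Fintype.card_prod, Fintype.card_pi, Fintype.card_fin,
        Finset.prod_const, Finset.card_univ, Fintype.card_units_int]
      push_cast
      have h1 : ((2 * ρ * n + 1 : ℝ) ^ D) ^ K ≤ (2 * ρ + 1) ^ (K * D) * n ^ (K * D) := by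
        rw [← pow_mul, mul_comm D K, ← mul_pow]
        gcongr
        nlinarith
      have h2 : (1 : ℝ) ≤ n ^ (K * D) := one_le_pow₀ hn1
      have h3 : (D : ℝ) ≤ D * n ^ (K * D) := le_mul_of_one_le_right (by positivity) h2
      have h4 : ((2 * ρ * n + 1 : ℝ) ^ D) ^ K * (2 ^ K * K) ≤
          (2 * ρ + 1) ^ (K * D) * n ^ (K * D) * (2 ^ K * K) := by gcongr
      rw [hC₁]
      linarith
    have hexp : -(n * t ^ 2) / (2 * (2 * c)) = -(n * t ^ 2) / (4 * c) := by ring_nf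
    rw [hexp]
    have h1 : C₁ * (n : ℝ) ^ (K * D) ≤ (C₁ + C₂ + K + 1) * (n : ℝ) ^ (K * D) := by
      gcongr
      have : (0 : ℝ) ≤ K := by positivity
      linarith
    have h2 := mul_le_mul_of_nonneg_right (hcard.trans h1)
      (Real.exp_pos (-(n * t ^ 2) / (4 * c))).le
    linarith
  · obtain ⟨g, hg⟩ := exists_gridPoint hn hw
    set h : ℝ := 1 / n with hh
    have hh0 : 0 < h := by positivity
    have hhn : h * n = 1 := one_div_mul_cancel hn0.ne'
    set ℓ : (Fin K → Img D) → Message K → Fin K → Img D → ℝ :=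
      fun w m k y => V (bit m k * inner ℝ (w k) (embed w m y)) with hℓ
    have hlip : ∀ m k y, |ℓ w m k y - ℓ (gridPoint g) m k y| ≤
        h * (∑ l, |y l| + K * D * (2 * ρ)) := fun m k y =>
      abs_loss_sub_le hV hw (fun k i => abs_gridPoint_le hn g k i) hg m k y
    have hgrid : ∀ m k, |1 / (n : ℝ) * ∑ i, ℓ (gridPoint g) m k (x i) -
        ∫ y, ℓ (gridPoint g) m k y ∂P| ≤ t := fun m k => by
      have := hEx x hx (Sum.inl (g, m, k))
      simpa only [hℓ, bit_mul_inner_embed, φ, a, Sum.elim_inl] using this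
    have habs : ∀ l, 1 / (n : ℝ) * ∑ i, |x i l| ≤ ∫ y : Img D, |y l| ∂P + 1 := fun l => by
      have := hEx x hx (Sum.inr l)
      simp only [φ, a, Sum.elim_inr, inner_single_one] at this
      linarith [(abs_le.1 this).2]
    have hemp : ∀ m k, |1 / (n : ℝ) * ∑ i, ℓ w m k (x i) -
        1 / (n : ℝ) * ∑ i, ℓ (gridPoint g) m k (x i)| ≤ h * (A + D + K * D * (2 * ρ)) := by
      intro m k
      rw [← mul_sub, ← Finset.sum_sub_distrib, abs_mul, abs_of_pos hh0]
      calc h * |∑ i, (ℓ w m k (x i) - ℓ (gridPoint g) m k (x i))|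
          ≤ h * ∑ i, h * (∑ l, |x i l| + K * D * (2 * ρ)) := by
            refine mul_le_mul_of_nonneg_left ((Finset.abs_sum_le_sum_abs _ _).trans
              (Finset.sum_le_sum fun i _ => hlip m k (x i))) hh0.le
        _ = h * (∑ l, (1 / (n : ℝ) * ∑ i, |x i l|) + K * D * (2 * ρ)) := by
            rw [← Finset.mul_sum, Finset.sum_add_distrib, Finset.sum_comm, ← Finset.mul_sum]
            simp only [Finset.sum_const, Finset.card_univ, Fintype.card_fin, nsmul_eq_mul]
            rw [← hh]
            simp only [← Finset.mul_sum]
            linear_combination h * (K * D * (2 * ρ)) * hhn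
        _ ≤ h * (∑ l, (∫ y : Img D, |y l| ∂P + 1) + K * D * (2 * ρ)) := by
            gcongr with l
            exact habs l
        _ = h * (A + D + K * D * (2 * ρ)) := by
            rw [Finset.sum_add_distrib, hA]; simp
    have hpop : ∀ m k, |∫ y, ℓ w m k y ∂P - ∫ y, ℓ (gridPoint g) m k y ∂P| ≤
        h * (A + K * D * (2 * ρ)) := by
      intro m k
      have hi : Integrable (fun y : Img D => ∑ l, |y l|) P :=
        integrable_finsetSum _ fun l _ => integrable_abs_apply hSZ l
      rw [← integral_sub (integrable_loss hSZ hV _ m k) (integrable_loss hSZ hV _ m k)]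
      refine abs_integral_le_integral_abs.trans ((integral_mono_of_nonneg
        (.of_forall fun _ => abs_nonneg _) ((hi.add (integrable_const _)).const_mul h)
        (.of_forall fun y => hlip m k y)).trans (le_of_eq ?_))
      simp only [Pi.add_apply]
      rw [integral_const_mul, integral_add hi (integrable_const _),
        integral_finsetSum _ fun l _ => integrable_abs_apply hSZ l]
      simp [hA, hP]
    rw [empLoss_sub_popLoss]
    have hfin : K * (t + (h * (A + D + K * D * (2 * ρ)) + h * (A + K * D * (2 * ρ)))) ≤
        (C₁ + C₂ + K + 1) * (t + h) := by
      have : K * (t + (h * (A + D + K * D * (2 * ρ)) + h * (A + K * D * (2 * ρ)))) =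
        K * t + C₂ * h := by rw [hC₂]; ring
      rw [this]
      have hK0 : (0 : ℝ) ≤ K := by positivity
      nlinarith [mul_nonneg hC₁0 ht, mul_nonneg hC₂0 ht, mul_nonneg hC₁0 hh0.le,
        mul_nonneg hK0 hh0.le]
    refine (abs_sum_message_le fun m k => ?_).trans hfin
    have e : 1 / (n : ℝ) * ∑ i, ℓ w m k (x i) - ∫ y, ℓ w m k y ∂P =
        (1 / (n : ℝ) * ∑ i, ℓ (gridPoint g) m k (x i) - ∫ y, ℓ (gridPoint g) m k y ∂P) +
        ((1 / (n : ℝ) * ∑ i, ℓ w m k (x i) - 1 / (n : ℝ) * ∑ i, ℓ (gridPoint g) m k (x i)) +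
        -(∫ y, ℓ w m k y ∂P - ∫ y, ℓ (gridPoint g) m k y ∂P)) := by ring
    rw [e]
    refine (abs_add_le _ _).trans (add_le_add (hgrid m k) ((abs_add_le _ _).trans
      (add_le_add (hemp m k) ?_)))
    rw [abs_neg]
    exact hpop m k

end Deviation

/-! ### Excess population loss -/

section Excess

open scoped NNReal

variable {K D d : ℕ} {V : ℝ → ℝ} {B : Matrix (Fin D) (Fin d) ℝ} {SZ : Matrix (Fin d) (Fin d) ℝ}
  {σ β : ℝ}

lemma integral_loss_eq (hSZ : SZ.PosSemidef) (hV : LipschitzWith 1 V) (w : Fin K → Img D)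
    (m : Message K) (k : Fin K) :
    ∫ x, V (bit m k * inner ℝ (w k) (embed w m x)) ∂imageLaw B SZ σ =
      gaussLoss V (offset w m k) (imageForm B SZ σ (w k) (w k)).toNNReal := by
  have hc := hV.continuous
  simp_rw [bit_mul_inner_embed]
  have h := gaussLoss_add hV 0 (offset w m k) (imageForm B SZ σ (w k) (w k)).toNNReal
  rw [zero_add] at h
  have h2 : imageForm B SZ σ (bit m k • w k) (bit m k • w k) = imageForm B SZ σ (w k) (w k) := by
    simp only [map_smul, LinearMap.smul_apply, smul_eq_mul]
    rw [← mul_assoc, bit_mul_self, one_mul]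
  rw [h, ← h2, ← map_inner_imageLaw hSZ, integral_map (by fun_prop) (by fun_prop)]

/-- Flipping one bit of a message. -/
def flipBit (k : Fin K) (m : Message K) : Message K := Function.update m k (-m k)

lemma flipBit_involutive (k : Fin K) : Function.Involutive (flipBit k) := fun m => by
  simp [flipBit]

lemma bit_flipBit_self (m : Message K) (k : Fin K) : bit (flipBit k m) k = -bit m k := by
  simp [bit, flipBit]

lemma bit_flipBit_of_ne (m : Message K) {j k : Fin K} (h : j ≠ k) :
    bit (flipBit k m) j = bit m j := by
  simp [bit, flipBit, h]

lemma offset_eq (w : Fin K → Img D) (m : Message K) (k : Fin K) :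
    offset w m k = ‖w k‖ ^ 2 +
      ∑ j ∈ Finset.univ.erase k, bit m k * bit m j * inner ℝ (w k) (w j) := by
  rw [offset, inner_sum, Finset.mul_sum, ← Finset.add_sum_erase _ _ (Finset.mem_univ k)]
  simp only [real_inner_smul_right, ← mul_assoc, bit_mul_self, one_mul,
    real_inner_self_eq_norm_sq]

/-- Every cross term of the `k`-th offset contains the factor `bit m k`, so flipping this bit
reflects the offset about `‖w k‖ ^ 2`. -/
lemma offset_flipBit_self (w : Fin K → Img D) (m : Message K) (k : Fin K) :
    offset w (flipBit k m) k = ‖w k‖ ^ 2 - (offset w m k - ‖w k‖ ^ 2) := by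
  rw [offset_eq, offset_eq, add_sub_cancel_left, sub_eq_add_neg, ← Finset.sum_neg_distrib]
  congr 1
  refine Finset.sum_congr rfl fun j hj => ?_
  rw [bit_flipBit_self, bit_flipBit_of_ne _ (Finset.ne_of_mem_erase hj)]
  ring

/-- Flipping another bit `j` changes only the cross term with `w j`. This recovers individual inner
products from the offsets. -/
lemma offset_sub_offset_flipBit (w : Fin K → Img D) (m : Message K) {j k : Fin K} (h : j ≠ k) :
    offset w m k - offset w (flipBit j m) k = 2 * (bit m k * bit m j * inner ℝ (w k) (w j)) := by
  have hj : j ∈ Finset.univ.erase k := Finset.mem_erase.2 ⟨h, Finset.mem_univ j⟩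
  rw [offset_eq, offset_eq, ← Finset.add_sum_erase _ _ hj, ← Finset.add_sum_erase _ _ hj]
  have h2 : ∀ i ∈ (Finset.univ.erase k).erase j,
      bit (flipBit j m) k * bit (flipBit j m) i * inner ℝ (w k) (w i) =
        bit m k * bit m i * inner ℝ (w k) (w i) := fun i hi => by
    rw [bit_flipBit_of_ne _ (Finset.ne_of_mem_erase hi), bit_flipBit_of_ne _ h.symm]
  rw [Finset.sum_congr rfl h2, bit_flipBit_self, bit_flipBit_of_ne _ h.symm]
  ring

/-- The curvature term of the excess loss. -/
noncomputable def interference (V : ℝ → ℝ) (u c : ℝ) (v : ℝ≥0) : ℝ :=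
  gaussLoss V (u + c) v + gaussLoss V (u - c) v - 2 * gaussLoss V u v

/-- Decomposition of the excess population loss into nonnegative parts. -/
lemma popLoss_sub_eq (hSZ : SZ.PosSemidef) (hV : LipschitzWith 1 V) (w : Fin K → Img D) (r : ℝ) :
    popLoss V β (imageLaw B SZ σ) w - K * hPop V σ β r =
      ∑ k, ((hPop V σ β (‖w k‖ ^ 2) - hPop V σ β r) +
        (gaussLoss V (‖w k‖ ^ 2) (imageForm B SZ σ (w k) (w k)).toNNReal -
          gaussLoss V (‖w k‖ ^ 2) (σ ^ 2 * ‖w k‖ ^ 2).toNNReal) +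
        1 / 2 ^ (K + 1) * ∑ m : Message K, interference V (‖w k‖ ^ 2)
          (offset w m k - ‖w k‖ ^ 2) (imageForm B SZ σ (w k) (w k)).toNNReal) := by
  -- Flipping bit `k` permutes the messages and exchanges `u + c` with `u - c`, so the two outer
  -- terms of the second difference have the same sum. This doubling explains the weight `1 / 2 ^ (K
  -- + 1)`.
  have hflip : ∀ k, ∑ m : Message K, interference V (‖w k‖ ^ 2)
      (offset w m k - ‖w k‖ ^ 2) (imageForm B SZ σ (w k) (w k)).toNNReal =
      2 * ∑ m : Message K, gaussLoss V (offset w m k) (imageForm B SZ σ (w k) (w k)).toNNReal -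
      2 * 2 ^ K * gaussLoss V (‖w k‖ ^ 2) (imageForm B SZ σ (w k) (w k)).toNNReal := by
    intro k
    have h1 := (flipBit_involutive k).bijective.sum_comp
      (fun m => gaussLoss V (offset w m k) (imageForm B SZ σ (w k) (w k)).toNNReal)
    simp only [offset_flipBit_self] at h1
    simp only [interference, add_sub_cancel, Finset.sum_sub_distrib, Finset.sum_add_distrib]
    rw [h1]
    simp
    ring
  simp only [popLoss, integral_loss_eq hSZ hV, hflip]
  rw [Finset.sum_comm, Finset.mul_sum, Finset.mul_sum, ← Finset.sum_add_distrib,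
    show (K : ℝ) * hPop V σ β r = ∑ _k : Fin K, hPop V σ β r by simp, ← Finset.sum_sub_distrib]
  refine Finset.sum_congr rfl fun k _ => ?_
  rw [hPop_eq_gaussLoss (r := ‖w k‖ ^ 2) hV.continuous (by positivity), pow_succ]
  field_simp
  ring

lemma toNNReal_imageForm (hSZ : SZ.PosSemidef) (a : Img D) :
    (imageForm B SZ σ a a).toNNReal =
      (σ ^ 2 * ‖a‖ ^ 2).toNNReal + (latentForm B SZ a a).toNNReal := by
  rw [imageForm_apply, real_inner_self_eq_norm_sq,
    ← Real.toNNReal_add (by positivity) (latentForm_nonneg hSZ a), add_comm]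

/-- All parts of the decomposition are nonnegative, so each one is bounded by the total; the factor
`2 ^ (K + 1)` undoes the message weight. -/
lemma excess_terms_le (hSZ : SZ.PosSemidef) (hV : RegularLoss V) {r : ℝ}
    (hmin : IsMinOn (hPop V σ β) (Set.Ici 0) r) (w : Fin K → Img D) (k : Fin K) :
    hPop V σ β (‖w k‖ ^ 2) - hPop V σ β r ≤
        popLoss V β (imageLaw B SZ σ) w - K * hPop V σ β r ∧
      gaussLoss V (‖w k‖ ^ 2) (imageForm B SZ σ (w k) (w k)).toNNReal -
          gaussLoss V (‖w k‖ ^ 2) (σ ^ 2 * ‖w k‖ ^ 2).toNNReal ≤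
        popLoss V β (imageLaw B SZ σ) w - K * hPop V σ β r ∧
      ∀ m, interference V (‖w k‖ ^ 2) (offset w m k - ‖w k‖ ^ 2)
          (imageForm B SZ σ (w k) (w k)).toNNReal ≤
        2 ^ (K + 1) * (popLoss V β (imageLaw B SZ σ) w - K * hPop V σ β r) := by
  rw [popLoss_sub_eq hSZ hV.lipschitz]
  have h1 : ∀ k, 0 ≤ hPop V σ β (‖w k‖ ^ 2) - hPop V σ β r := fun k =>
    sub_nonneg.2 (hmin (Set.mem_Ici.2 (by positivity)))
  have h2 : ∀ k, 0 ≤ gaussLoss V (‖w k‖ ^ 2) (imageForm B SZ σ (w k) (w k)).toNNReal -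
      gaussLoss V (‖w k‖ ^ 2) (σ ^ 2 * ‖w k‖ ^ 2).toNNReal := fun k => by
    rw [toNNReal_imageForm hSZ]
    exact sub_nonneg.2 (gaussLoss_mono_var hV _ le_self_add)
  have h3 : ∀ k m, 0 ≤ interference V (‖w k‖ ^ 2) (offset w m k - ‖w k‖ ^ 2)
      (imageForm B SZ σ (w k) (w k)).toNNReal := fun k m =>
    gaussLoss_second_diff_nonneg hV _ _ _
  have h4 : ∀ k, 0 ≤ 1 / (2 : ℝ) ^ (K + 1) * ∑ m : Message K, interference V (‖w k‖ ^ 2)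
      (offset w m k - ‖w k‖ ^ 2) (imageForm B SZ σ (w k) (w k)).toNNReal := fun k =>
    mul_nonneg (by positivity) (Finset.sum_nonneg fun m _ => h3 k m)
  have hk := Finset.single_le_sum (f := fun k => (hPop V σ β (‖w k‖ ^ 2) - hPop V σ β r) +
        (gaussLoss V (‖w k‖ ^ 2) (imageForm B SZ σ (w k) (w k)).toNNReal -
          gaussLoss V (‖w k‖ ^ 2) (σ ^ 2 * ‖w k‖ ^ 2).toNNReal) +
        1 / 2 ^ (K + 1) * ∑ m : Message K, interference V (‖w k‖ ^ 2)
          (offset w m k - ‖w k‖ ^ 2) (imageForm B SZ σ (w k) (w k)).toNNReal)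
    (fun k _ => add_nonneg (add_nonneg (h1 k) (h2 k)) (h4 k)) (Finset.mem_univ k)
  have h1k := h1 k
  have h2k := h2 k
  have h4k := h4 k
  refine ⟨by linarith, by linarith, fun m => ?_⟩
  have hm := Finset.single_le_sum (f := fun m => interference V (‖w k‖ ^ 2)
    (offset w m k - ‖w k‖ ^ 2) (imageForm B SZ σ (w k) (w k)).toNNReal)
    (fun m _ => h3 k m) (Finset.mem_univ m)
  have h5 : ∑ m : Message K, interference V (‖w k‖ ^ 2) (offset w m k - ‖w k‖ ^ 2)
      (imageForm B SZ σ (w k) (w k)).toNNReal = 2 ^ (K + 1) * (1 / (2 : ℝ) ^ (K + 1) *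
      ∑ m : Message K, interference V (‖w k‖ ^ 2) (offset w m k - ‖w k‖ ^ 2)
      (imageForm B SZ σ (w k) (w k)).toNNReal) := by field_simp
  refine hm.trans (h5.le.trans (mul_le_mul_of_nonneg_left ?_ (by positivity)))
  linarith

/-- Every part of the decomposition is zero: the norm is optimal, the latent variance vanishes and
there are no cross terms. -/
lemma popLoss_oracle (hSZ : SZ.PosSemidef) (hV : LipschitzWith 1 V) {w : Fin K → Img D} {r : ℝ}
    (hw : IsOracle B r w) : popLoss V β (imageLaw B SZ σ) w = K * hPop V σ β r := by
  rw [← sub_eq_zero, popLoss_sub_eq hSZ hV]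
  refine Finset.sum_eq_zero fun k _ => ?_
  have h1 : latentForm B SZ (w k) (w k) = 0 := by
    rw [latentForm_apply, hw.mem_orth k]; simp
  have h2 : ∀ m, offset w m k = ‖w k‖ ^ 2 := fun m => by
    rw [offset_eq, Finset.sum_eq_zero, add_zero]
    intro j hj
    rw [hw.orth j k (Finset.ne_of_mem_erase hj), mul_zero]
  rw [toNNReal_imageForm hSZ, h1]
  simp only [h2, interference, hw.sq_norm k]
  simp
  ring

/-- Small excess loss forces a watermark to be nearly an oracle watermark. -/
lemma exists_excess_bounds (hSZ : SZ.PosSemidef) (hV : HingeOrLogistic V σ β) (hσ : 0 < σ) {r : ℝ}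
    (hr : 0 < r) (hmin : IsMinOn (hPop V σ β) (Set.Ici 0) r) (K : ℕ) {R : ℝ} (hR : 0 < R) :
    ∃ C > 0, ∃ e₀ > 0, ∀ w : Fin K → Img D, (∀ k, ‖w k‖ ^ 2 ≤ R) → ∀ e : ℝ, e ≤ e₀ →
      popLoss V β (imageLaw B SZ σ) w - K * hPop V σ β r ≤ e → ∀ k,
        |‖w k‖ ^ 2 - r| ≤ C * Real.sqrt e ∧ latentForm B SZ (w k) (w k) ≤ C * Real.sqrt e ∧
          ∀ m, |offset w m k - ‖w k‖ ^ 2| ≤ C * Real.sqrt e := by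
  have hVr := hV.regularLoss
  obtain ⟨κ₁, hκ₁, h₁⟩ := hV.exists_growth hσ hr hmin hR
  obtain ⟨v₁, hv₁, hvb⟩ := exists_imageForm_bound B SZ σ (Real.sqrt R)
  have hv₀ : 0 < σ ^ 2 * (r / 2) := by positivity
  obtain ⟨κ₂, hκ₂, h₂⟩ := exists_gaussLoss_var_growth hVr (U := R) (v₁ := v₁) hv₀
  obtain ⟨κ₃, hκ₃, h₃⟩ := exists_gaussLoss_curved hVr (U := R) (v₁ := v₁) hv₀
  set N : ℝ := 2 ^ (K + 1) with hN
  have hN0 : 0 < N := by positivity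
  -- The three conditions in `e₀` serve in turn to give `e ≤ √e`, to force `‖w k‖ ^ 2 ≥ r / 2` and
  -- thereby a variance at least `σ² r / 2`, and to exclude the capped branch of the interference
  -- bound.
  refine ⟨Real.sqrt (1 / κ₁) + 1 / κ₂ + Real.sqrt (N / κ₃), by positivity,
    min 1 (min (κ₁ * (r / 2) ^ 2) (κ₃ / N / 2)), by positivity, fun w hw e he0 he k => ?_⟩
  obtain ⟨hA, hB, hC⟩ := excess_terms_le (B := B) hSZ hVr hmin w k
  have he1 : e ≤ 1 := he0.trans (min_le_left _ _)
  have he2 : e ≤ κ₁ * (r / 2) ^ 2 := he0.trans ((min_le_right _ _).trans (min_le_left _ _))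
  have he3 : e ≤ κ₃ / N / 2 := he0.trans ((min_le_right _ _).trans (min_le_right _ _))
  have hrk0 : 0 ≤ ‖w k‖ ^ 2 := by positivity
  have hg := (h₁ _ hrk0 (hw k)).trans (hA.trans he)
  have he' : 0 ≤ e := le_trans (by positivity) hg
  have hse : 0 ≤ Real.sqrt e := Real.sqrt_nonneg e
  have hes : e ≤ Real.sqrt e := by
    have := Real.sq_sqrt he'
    have h2 : Real.sqrt e ≤ 1 := by rw [Real.sqrt_le_left zero_le_one]; simpa using he1
    nlinarith
  have ha1 : 0 ≤ Real.sqrt (1 / κ₁) * Real.sqrt e := by positivity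
  have ha2 : 0 ≤ 1 / κ₂ * Real.sqrt e := by positivity
  have ha3 : 0 ≤ Real.sqrt (N / κ₃) * Real.sqrt e := by positivity
  have hrk : r / 2 ≤ ‖w k‖ ^ 2 := by
    have : (‖w k‖ ^ 2 - r) ^ 2 ≤ (r / 2) ^ 2 := le_of_mul_le_mul_left (hg.trans he2) hκ₁
    have := abs_le_of_sq_le_sq' this (by positivity)
    linarith [this.1]
  have hu : |‖w k‖ ^ 2| ≤ R := by rw [abs_of_nonneg hrk0]; exact hw k
  have hq0 := latentForm_nonneg (B := B) hSZ (w k)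
  have hvl : σ ^ 2 * (r / 2) ≤ ((σ ^ 2 * ‖w k‖ ^ 2).toNNReal : ℝ) := by
    rw [Real.coe_toNNReal _ (by positivity)]
    gcongr
  have hvu : ((imageForm B SZ σ (w k) (w k)).toNNReal : ℝ) ≤ v₁ := by
    rw [Real.coe_toNNReal _ (imageForm_nonneg hSZ _)]
    refine hvb _ fun i => ?_
    refine (PiLp.norm_apply_le (w k) i).trans ?_
    exact Real.le_sqrt_of_sq_le (hw k)
  refine ⟨?_, ?_, fun m => ?_⟩
  · have : |‖w k‖ ^ 2 - r| ≤ Real.sqrt (1 / κ₁) * Real.sqrt e := by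
      rw [← Real.sqrt_mul (by positivity)]
      refine Real.abs_le_sqrt ?_
      rw [one_div, inv_mul_eq_div, le_div_iff₀ hκ₁]
      linarith
    linarith
  · have h := h₂ (‖w k‖ ^ 2) (σ ^ 2 * ‖w k‖ ^ 2).toNNReal (latentForm B SZ (w k) (w k)).toNNReal hu
      hvl (by rw [toNNReal_imageForm hSZ] at hvu; exact_mod_cast hvu)
    rw [← toNNReal_imageForm hSZ, Real.coe_toNNReal _ hq0] at h
    have h' : latentForm B SZ (w k) (w k) ≤ 1 / κ₂ * Real.sqrt e := by
      rw [one_div, inv_mul_eq_div, le_div_iff₀ hκ₂]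
      linarith
    linarith
  · have hvl' : σ ^ 2 * (r / 2) ≤ ((imageForm B SZ σ (w k) (w k)).toNNReal : ℝ) := by
      rw [toNNReal_imageForm hSZ]
      push_cast
      have := NNReal.coe_nonneg (latentForm B SZ (w k) (w k)).toNNReal
      linarith
    have h := (h₃ (‖w k‖ ^ 2) _ hu hvl' hvu (offset w m k - ‖w k‖ ^ 2)).trans (hC m)
    have h5 : κ₃ * min ((offset w m k - ‖w k‖ ^ 2) ^ 2) 1 ≤ N * e :=
      h.trans (mul_le_mul_of_nonneg_left he hN0.le)
    have h6 : N * e ≤ κ₃ / 2 := by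
      rw [div_div, mul_comm N 2, ← div_div, le_div_iff₀ hN0] at he3
      linarith
    have h7 : κ₃ * (offset w m k - ‖w k‖ ^ 2) ^ 2 ≤ N * e := by
      rcases min_cases ((offset w m k - ‖w k‖ ^ 2) ^ 2) 1 with ⟨h8, -⟩ | ⟨h8, -⟩ <;> rw [h8] at h5
      · exact h5
      · linarith
    have : |offset w m k - ‖w k‖ ^ 2| ≤ Real.sqrt (N / κ₃) * Real.sqrt e := by
      rw [← Real.sqrt_mul (by positivity)]
      refine Real.abs_le_sqrt ?_
      rw [div_mul_eq_mul_div, le_div_iff₀ hκ₃]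
      linarith
    linarith

end Excess

/-! ### Detection and decoding with nearby watermarks -/

section Metrics

variable {K D d : ℕ} {B : Matrix (Fin D) (Fin d) ℝ} {SZ : Matrix (Fin d) (Fin d) ℝ} {σ : ℝ}

lemma Γ_embed (w : Fin K → Img D) (m : Message K) (x : Img D) :
    Γ w (embed w m x) = fun k => Γ w x k + bit m k * offset w m k := by
  ext k
  simp only [Γ, embed, inner_add_right, offset]
  rw [← mul_assoc, bit_mul_self, one_mul]

lemma measurable_Γ (w : Fin K → Img D) : Measurable (Γ w) := by
  unfold Γ; fun_prop

lemma measurable_embed (w : Fin K → Img D) (m : Message K) : Measurable (embed w m) := by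
  unfold embed; fun_prop

lemma abs_quadratic_sub_le {S : Matrix (Fin K) (Fin K) ℝ} {ζ : ℝ}
    (hS : ∀ j k, |S j k - if j = k then 1 else 0| ≤ ζ) (x : EuclideanSpace ℝ (Fin K)) :
    |x.ofLp ⬝ᵥ S *ᵥ x.ofLp - ‖x‖ ^ 2| ≤ K ^ 2 * ζ * ‖x‖ ^ 2 := by
  have h1 : x.ofLp ⬝ᵥ S *ᵥ x.ofLp - ‖x‖ ^ 2 =
      ∑ j, ∑ k, x j * ((S j k - if j = k then 1 else 0) * x k) := by
    rw [EuclideanSpace.real_norm_sq_eq, dotProduct, ← Finset.sum_sub_distrib]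
    refine Finset.sum_congr rfl fun j _ => ?_
    simp only [Matrix.mulVec, dotProduct, sub_mul, mul_sub, Finset.sum_sub_distrib, Finset.mul_sum]
    simp
    ring
  rw [h1]
  have h2 : ∀ j k, |x j * ((S j k - if j = k then 1 else 0) * x k)| ≤ ζ * ‖x‖ ^ 2 := by
    intro j k
    rw [abs_mul, abs_mul]
    have hj : |x j| ≤ ‖x‖ := PiLp.norm_apply_le x j
    have hk : |x k| ≤ ‖x‖ := PiLp.norm_apply_le x k
    have hζ : 0 ≤ ζ := (abs_nonneg _).trans (hS j k)
    calc _ ≤ ‖x‖ * (ζ * ‖x‖) := by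
          gcongr
          exact hS j k
      _ = _ := by ring
  refine (Finset.abs_sum_le_sum_abs _ _).trans ((Finset.sum_le_sum
    (g := fun _ => K * (ζ * ‖x‖ ^ 2)) fun j _ => (Finset.abs_sum_le_sum_abs _ _).trans
      ((Finset.sum_le_sum (g := fun _ => ζ * ‖x‖ ^ 2) fun k _ => h2 j k).trans (by simp))).trans
      (le_of_eq ?_))
  simp
  ring

/-- The law of the shifted inner products depends continuously on their covariance and mean, in
total variation. -/
lemma exists_Γ_tv (hSZ : SZ.PosSemidef) (hσ : 0 < σ) {r : ℝ} (hr : 0 < r) (K : ℕ) :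
    ∃ C > 0, ∀ (w w₀ : Fin K → Img D) (b b₀ : Fin K → ℝ) (η : ℝ),
      (∀ j k, |imageForm B SZ σ (w j) (w k) - if j = k then σ ^ 2 * r else 0| ≤ η) →
      (∀ j k, imageForm B SZ σ (w₀ j) (w₀ k) = if j = k then σ ^ 2 * r else 0) →
      (∀ k, |b k - b₀ k| ≤ η) → 0 ≤ η → ∀ A : Set (Fin K → ℝ), MeasurableSet A →
      |(imageLaw B SZ σ).real {x | (fun k => Γ w x k + b k) ∈ A} -
        (imageLaw B SZ σ).real {x | (fun k => Γ w₀ x k + b₀ k) ∈ A}| ≤ C * η := by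
  obtain ⟨C, hC, h⟩ := exists_multivariateGaussian_tv K
  -- Dividing by the common standard deviation `s` and centering at `b₀` makes the reference law
  -- exactly the standard Gaussian. The set `A` is pulled back accordingly.
  set s := σ * Real.sqrt r with hs
  have hs0 : 0 < s := by positivity
  have hs2 : s ^ 2 = σ ^ 2 * r := by rw [hs, mul_pow, Real.sq_sqrt hr.le]
  -- The summand 1 keeps the constant positive when `K = 0`.
  refine ⟨C * (K ^ 2 * (1 / s ^ 2) + K * (1 / s)) + 1, by positivity,
    fun w w₀ b b₀ η hw hw₀ hb hη A hA => ?_⟩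
  set A' : Set (EuclideanSpace ℝ (Fin K)) := {y | (fun k => s * y k + b₀ k) ∈ A} with hA'
  have hA'm : MeasurableSet A' := by
    have : Measurable fun y : EuclideanSpace ℝ (Fin K) => fun k => s * y k + b₀ k := by fun_prop
    exact this hA
  have hset : ∀ (w : Fin K → Img D) (b : Fin K → ℝ),
      (imageLaw B SZ σ).real {x | (fun k => Γ w x k + b k) ∈ A} =
      (multivariateGaussian (WithLp.toLp 2 fun k => s⁻¹ * (b k - b₀ k))
        (Matrix.of fun j k => imageForm B SZ σ (s⁻¹ • w j) (s⁻¹ • w k))).real A' := by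
    intro w b
    have hm : Measurable (fun x : Img D => (WithLp.toLp 2 fun k => s⁻¹ * (b k - b₀ k) :
        EuclideanSpace ℝ (Fin K)) + s⁻¹ • WithLp.toLp 2 (Γ w x)) := by
      unfold Γ; fun_prop
    rw [← map_Γ_imageLaw hSZ, map_measureReal_apply hm hA'm]
    congr 1
    ext x
    simp only [Set.mem_ofPred_eq, Set.mem_preimage, hA', PiLp.add_apply, PiLp.smul_apply,
      smul_eq_mul]
    have : (fun k => Γ w x k + b k) =
        fun k => s * (s⁻¹ * (b k - b₀ k) + s⁻¹ * Γ w x k) + b₀ k := by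
      ext k
      field_simp
      ring
    rw [this]
  have hstd : multivariateGaussian (WithLp.toLp 2 fun k => s⁻¹ * (b₀ k - b₀ k))
        (Matrix.of fun j k => imageForm B SZ σ (s⁻¹ • w₀ j) (s⁻¹ • w₀ k)) =
      stdGaussian (EuclideanSpace ℝ (Fin K)) := by
    rw [← multivariateGaussian_zero_one]
    congr 1
    · ext k; simp
    · ext j k
      simp only [Matrix.of_apply, map_smul, LinearMap.smul_apply, smul_eq_mul, hw₀,
        Matrix.one_apply]
      split_ifs
      · rw [← hs2]; field_simp
      · simp
  rw [hset w b, hset w₀ b₀, hstd]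
  have hζ1 : 0 ≤ K ^ 2 * (1 / s ^ 2 * η) := by positivity
  have hζ2 : 0 ≤ K * (1 / s * η) := by positivity
  refine (h (K ^ 2 * (1 / s ^ 2 * η) + K * (1 / s * η)) _ _
    (gram_posSemidef hSZ fun k => s⁻¹ • w k) ?_ (fun x => ?_) A' hA'm).trans ?_
  · have h1 : ‖(WithLp.toLp 2 fun k => s⁻¹ * (b k - b₀ k) : EuclideanSpace ℝ (Fin K))‖ ≤
        K * (1 / s * η) := by
      rw [EuclideanSpace.norm_eq, Real.sqrt_le_left (by positivity)]
      have h2 : ∀ k, ‖s⁻¹ * (b k - b₀ k)‖ ^ 2 ≤ (1 / s * η) ^ 2 := fun k => by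
        rw [norm_mul, Real.norm_of_nonneg (by positivity), one_div]
        gcongr
        exact hb k
      refine (Finset.sum_le_sum fun k _ => h2 k).trans ?_
      simp only [Finset.sum_const, Finset.card_univ, Fintype.card_fin, nsmul_eq_mul]
      rw [mul_pow (K : ℝ)]
      refine mul_le_mul_of_nonneg_right ?_ (by positivity)
      have : K ≤ K ^ 2 := Nat.le_self_pow two_ne_zero K
      exact_mod_cast this
    linarith
  · refine (abs_quadratic_sub_le (ζ := 1 / s ^ 2 * η) (fun j k => ?_) x).trans ?_
    · have h1 : imageForm B SZ σ (s⁻¹ • w j) (s⁻¹ • w k) - (if j = k then 1 else 0) =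
          1 / s ^ 2 * (imageForm B SZ σ (w j) (w k) - if j = k then σ ^ 2 * r else 0) := by
        simp only [map_smul, LinearMap.smul_apply, smul_eq_mul]
        rw [← hs2]
        split_ifs
        · field_simp
        · field_simp; simp
      rw [Matrix.of_apply, h1, abs_mul, abs_of_pos (by positivity)]
      exact mul_le_mul_of_nonneg_left (hw j k) (by positivity)
    · exact mul_le_mul_of_nonneg_right (by linarith) (by positivity)
  · have : C * (K ^ 2 * (1 / s ^ 2 * η) + K * (1 / s * η)) =
      C * (K ^ 2 * (1 / s ^ 2) + K * (1 / s)) * η := by ring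
    rw [this]
    nlinarith

/-- Makes the fibres of a measurable decoder measurable. -/
instance : MeasurableSingletonClass ℤˣ where
  measurableSet_singleton u := ⟨{(u : ℤ)}, measurableSet_singleton _, by ext v; simp [Units.ext_iff]⟩

/-- The laws of the inner products with the test image, with the watermarks `w` and `w₀`, differ
by at most `θ` in total variation, under `H₀` and under `H₁`. -/
structure ΓClose (P : Measure (Img D)) (w w₀ : Fin K → Img D) (θ : ℝ) : Prop where
  null : ∀ A : Set (Fin K → ℝ), MeasurableSet A →
    |P.real (Γ w ⁻¹' A) - P.real (Γ w₀ ⁻¹' A)| ≤ θ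
  alt : ∀ (m : Message K) (A : Set (Fin K → ℝ)), MeasurableSet A →
    |(watermarkedLaw P w m).real (Γ w ⁻¹' A) - (watermarkedLaw P w₀ m).real (Γ w₀ ⁻¹' A)| ≤ θ

/-- The hypotheses control every entry of the covariance of `Γ w x`. Under the alternative its mean
is `bit m k * offset w m k`, within `2 * η` of the oracle value `bit m k * r`. -/
lemma exists_ΓClose_of_bounds (hSZ : SZ.PosSemidef) (hσ : 0 < σ) {r : ℝ} (hr : 0 < r) (K : ℕ) :
    ∃ C > 0, ∀ (w w₀ : Fin K → Img D) (η : ℝ), IsOracle B r w₀ → 0 ≤ η →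
      (∀ k, |‖w k‖ ^ 2 - r| ≤ η ∧ latentForm B SZ (w k) (w k) ≤ η ∧
        ∀ m, |offset w m k - ‖w k‖ ^ 2| ≤ η) →
      ΓClose (imageLaw B SZ σ) w w₀ (C * η) := by
  obtain ⟨C, hC, h⟩ := exists_Γ_tv (B := B) hSZ hσ hr K
  refine ⟨C * (σ ^ 2 + 2), by positivity, fun w w₀ η ho hη hw => ?_⟩
  have hη2 : 0 ≤ σ ^ 2 * η := by positivity
  have hcov : ∀ j k, |imageForm B SZ σ (w j) (w k) - if j = k then σ ^ 2 * r else 0| ≤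
      (σ ^ 2 + 2) * η := by
    intro j k
    have hl : |latentForm B SZ (w j) (w k)| ≤ η := by
      have := two_mul_abs_latentForm_le (B := B) hSZ (w j) (w k)
      linarith [(hw j).2.1, (hw k).2.1]
    have hi : |σ ^ 2 * inner ℝ (w j) (w k) - if j = k then σ ^ 2 * r else 0| ≤ σ ^ 2 * η := by
      split_ifs with hjk
      · subst hjk
        rw [real_inner_self_eq_norm_sq, ← mul_sub, abs_mul, abs_of_nonneg (sq_nonneg σ)]
        exact mul_le_mul_of_nonneg_left (hw j).1 (sq_nonneg σ)
      · rw [sub_zero, abs_mul, abs_of_nonneg (sq_nonneg σ)]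
        refine mul_le_mul_of_nonneg_left ?_ (sq_nonneg σ)
        -- Two offsets, both within `η` of `‖w j‖ ^ 2`, differ by twice the inner product, which is
        -- therefore at most `η` in absolute value.
        have h1 := offset_sub_offset_flipBit w (fun _ => 1) (j := k) (k := j) (Ne.symm hjk)
        have h2 := abs_le.1 ((hw j).2.2 (fun _ => 1))
        have h3 := abs_le.1 ((hw j).2.2 (flipBit k (fun _ => 1)))
        have h4 : bit (fun _ => 1 : Message K) j * bit (fun _ => 1 : Message K) k = 1 := by
          simp [bit]
        rw [h4, one_mul] at h1
        rw [abs_le]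
        constructor <;> linarith
    rw [imageForm_apply, add_sub_assoc]
    refine (abs_add_le _ _).trans ?_
    linarith
  have hcov₀ : ∀ j k, imageForm B SZ σ (w₀ j) (w₀ k) = if j = k then σ ^ 2 * r else 0 := by
    intro j k
    rw [imageForm_apply, latentForm_apply, ho.mem_orth j]
    split_ifs with hjk
    · subst hjk
      rw [real_inner_self_eq_norm_sq, ho.sq_norm]
      simp
    · rw [ho.orth k j (Ne.symm hjk)]
      simp
  have hη3 : 0 ≤ (σ ^ 2 + 2) * η := by positivity
  refine ⟨fun A hA => ?_, fun m A hA => ?_⟩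
  · have := h w w₀ 0 0 _ hcov hcov₀ (fun k => by simpa using hη3) hη3 A hA
    simp only [Pi.zero_apply, add_zero] at this
    rw [mul_assoc]
    exact this
  · have h1 : ∀ w : Fin K → Img D, (watermarkedLaw (imageLaw B SZ σ) w m).real (Γ w ⁻¹' A) =
        (imageLaw B SZ σ).real {x | (fun k => Γ w x k + bit m k * offset w m k) ∈ A} := by
      intro w
      rw [watermarkedLaw, map_measureReal_apply (measurable_embed w m) (measurable_Γ w hA)]
      congr 1
      ext x
      simp only [Set.mem_preimage, Γ_embed, Set.mem_ofPred_eq]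
    rw [h1, h1, mul_assoc]
    refine h w w₀ _ _ _ hcov hcov₀ (fun k => ?_) hη3 A hA
    have h2 : offset w₀ m k = r := by
      rw [offset_eq, ho.sq_norm, Finset.sum_eq_zero, add_zero]
      intro j hj
      rw [ho.orth j k (Finset.ne_of_mem_erase hj), mul_zero]
    rw [h2, ← mul_sub, abs_mul, abs_bit, one_mul]
    have h3 := abs_le.1 ((hw k).2.2 m)
    have h4 := abs_le.1 (hw k).1
    rw [abs_le]
    constructor <;> nlinarith

lemma abs_ciInf_sub_ciInf_le {ι : Type*} [Finite ι] [Nonempty ι] {f g : ι → ℝ} {c : ℝ}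
    (h : ∀ i, |f i - g i| ≤ c) : |(⨅ i, f i) - ⨅ i, g i| ≤ c := by
  have hf := (Set.finite_range f).bddBelow
  have hg := (Set.finite_range g).bddBelow
  rw [abs_le]
  constructor
  · have : (⨅ i, g i) - c ≤ ⨅ i, f i := le_ciInf fun i => by
      linarith [ciInf_le hg i, (abs_le.1 (h i)).1]
    linarith
  · have : (⨅ i, f i) - c ≤ ⨅ i, g i := le_ciInf fun i => by
      linarith [ciInf_le hf i, (abs_le.1 (h i)).2]
    linarith

variable {P : Measure (Img D)} {w w₀ : Fin K → Img D} {θ : ℝ}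

lemma measurableSet_stat (s : ℝ) : MeasurableSet {γ : Fin K → ℝ | s < ∑ k, |γ k|} :=
  measurableSet_lt measurable_const (by fun_prop)

lemma measurable_score (m : Message K) : Measurable (score m) := by
  unfold score; fun_prop

lemma measurableSet_statD (𝒟 : Finset (Message K)) (h𝒟 : 𝒟.Nonempty) (t : ℝ) :
    MeasurableSet {γ : Fin K → ℝ | t < 𝒟.sup' h𝒟 fun m => score m γ} := by
  refine measurableSet_lt measurable_const ?_
  have := Finset.measurable_sup' h𝒟 fun m (_ : m ∈ 𝒟) => measurable_score m
  convert! this using 1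
  ext γ
  simp [Finset.sup'_apply]

lemma ΓClose.mono {θ' : ℝ} (h : ΓClose P w w₀ θ) (hθ : θ ≤ θ') : ΓClose P w w₀ θ' :=
  ⟨fun A hA => (h.null A hA).trans hθ, fun m A hA => (h.alt m A hA).trans hθ⟩

lemma ΓClose.abs_fpr_sub_le (h : ΓClose P w w₀ θ) (s : ℝ) : |fpr P w s - fpr P w₀ s| ≤ θ :=
  h.null _ (measurableSet_stat s)

lemma ΓClose.abs_tpr_sub_le (h : ΓClose P w w₀ θ) (s : ℝ) : |tpr P w s - tpr P w₀ s| ≤ θ :=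
  abs_ciInf_sub_ciInf_le fun m => h.alt m _ (measurableSet_stat s)

lemma ΓClose.abs_fprD_sub_le (h : ΓClose P w w₀ θ) (𝒟 : Finset (Message K)) (h𝒟 : 𝒟.Nonempty)
    (t : ℝ) : |fprD P 𝒟 h𝒟 w t - fprD P 𝒟 h𝒟 w₀ t| ≤ θ :=
  h.null _ (measurableSet_statD 𝒟 h𝒟 t)

lemma ΓClose.abs_tprD_sub_le (h : ΓClose P w w₀ θ) (𝒟 : Finset (Message K)) (h𝒟 : 𝒟.Nonempty)
    (t : ℝ) : |tprD P 𝒟 h𝒟 w t - tprD P 𝒟 h𝒟 w₀ t| ≤ θ := by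
  have : Nonempty 𝒟 := h𝒟.to_subtype
  exact abs_ciInf_sub_ciInf_le fun m => h.alt m.1 _ (measurableSet_statD 𝒟 h𝒟 t)

lemma bitAcc_mem_Icc (m' m : Message K) : bitAcc m' m ∈ Set.Icc (0 : ℝ) 1 := by
  have h0 : 0 ≤ ∑ k, (if m' k = m k then (1 : ℝ) else 0) :=
    Finset.sum_nonneg fun k _ => by split_ifs <;> norm_num
  have h1 : ∑ k, (if m' k = m k then (1 : ℝ) else 0) ≤ K := by
    refine (Finset.sum_le_sum (g := fun _ => (1 : ℝ)) fun k _ => ?_).trans (by simp)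
    split_ifs <;> norm_num
  refine ⟨mul_nonneg (by positivity) h0, ?_⟩
  rw [bitAcc, one_div_mul_eq_div]
  exact div_le_one_of_le₀ h1 (by positivity)

/-- The decoder takes finitely many values, so the expectation is a combination of `2 ^ K`
probabilities with coefficients in `[0, 1]`. Total variation bounds then carry over with a factor `2
^ K`. -/
lemma expBitAcc_eq [IsProbabilityMeasure P] {dec : (Fin K → ℝ) → Message K}
    (hdec : Measurable dec) (w : Fin K → Img D) (m : Message K) :
    expBitAcc P dec w m = ∑ m' : Message K,
      bitAcc m' m * (watermarkedLaw P w m).real (Γ w ⁻¹' (dec ⁻¹' {m'})) := by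
  have : IsProbabilityMeasure (watermarkedLaw P w m) :=
    Measure.isProbabilityMeasure_map (measurable_embed w m).aemeasurable
  have hms : ∀ m', MeasurableSet (Γ w ⁻¹' (dec ⁻¹' {m'})) := fun m' =>
    measurable_Γ w (hdec (measurableSet_singleton m'))
  have h : ∀ x, bitAcc (dec (Γ w x)) m = ∑ m' : Message K,
      (Γ w ⁻¹' (dec ⁻¹' {m'})).indicator (fun _ => bitAcc m' m) x := by
    intro x
    rw [Finset.sum_eq_single (dec (Γ w x))]
    · rw [Set.indicator_of_mem]; simp
    · intro m' _ hm'
      rw [Set.indicator_of_notMem]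
      simpa using hm'.symm
    · simp
  simp only [expBitAcc, h]
  rw [integral_finsetSum _ fun m' _ => (integrable_const _).indicator (hms m')]
  refine Finset.sum_congr rfl fun m' _ => ?_
  rw [integral_indicator (hms m'), setIntegral_const, smul_eq_mul, mul_comm]

lemma ΓClose.abs_expBitAcc_sub_le [IsProbabilityMeasure P] (h : ΓClose P w w₀ θ)
    {dec : (Fin K → ℝ) → Message K} (hdec : Measurable dec) (m : Message K) :
    |expBitAcc P dec w m - expBitAcc P dec w₀ m| ≤ 2 ^ K * θ := by
  rw [expBitAcc_eq hdec, expBitAcc_eq hdec, ← Finset.sum_sub_distrib]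
  refine (Finset.abs_sum_le_sum_abs _ _).trans ((Finset.sum_le_sum (g := fun _ => θ)
    fun m' _ => ?_).trans (by simp))
  obtain ⟨h0, h1⟩ := bitAcc_mem_Icc m' m
  have h2 := h.alt m _ (hdec (measurableSet_singleton m'))
  rw [← mul_sub, abs_mul, abs_of_nonneg h0]
  exact (mul_le_of_le_one_left (abs_nonneg _) h1).trans h2

lemma measurable_signDec : Measurable (signDec (K := K)) := by
  refine measurable_pi_lambda _ fun k => ?_
  exact Measurable.ite (measurableSet_le measurable_const (measurable_pi_apply k))
    measurable_const measurable_const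

end Metrics

/-! ### The error level and the final estimate -/

section ErrorLevel

variable {D d K : ℕ} {B : Matrix (Fin D) (Fin d) ℝ} {SZ : Matrix (Fin d) (Fin d) ℝ} {σ β L : ℝ}
  {V : ℝ → ℝ}

lemma trace_imageCov_pos (hSZ : SZ.PosSemidef) (hσ : 0 < σ) (hD : 0 < D) :
    0 < (imageCov B SZ σ).trace := by
  have h1 : 0 ≤ (B * SZ * Bᵀ).trace := by
    have := (hSZ.mul_mul_conjTranspose_same B).trace_nonneg
    rwa [Matrix.conjTranspose_eq_transpose_of_trivial] at this
  rw [imageCov, Matrix.trace_add, Matrix.trace_smul, Matrix.trace_one, Fintype.card_fin]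
  have : (0 : ℝ) < D := by exact_mod_cast hD
  have : 0 < σ ^ 2 • (D : ℝ) := by rw [smul_eq_mul]; positivity
  linarith

lemma HingeOrLogistic.apply_one_lt (hV : HingeOrLogistic V σ β) : V 1 < V 0 := by
  rcases hV with ⟨rfl, -, -⟩ | ⟨rfl, -, -⟩
  · norm_num [hinge]
  · exact Real.log_lt_log (by positivity) (by gcongr; norm_num)

lemma HingeOrLogistic.radius_pos (hV : HingeOrLogistic V σ β) (hβ : 0 < β) (hK : 0 < K) :
    0 < radius K V β := by
  have hbdd : BddBelow (Set.range V) := ⟨0, by rintro _ ⟨x, rfl⟩; exact hV.regularLoss.nonneg x⟩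
  have h1 := ciInf_le hbdd 1
  have h2 := hV.apply_one_lt
  have h3 : 0 < V 0 - ⨅ t, V t := by linarith
  have : (0 : ℝ) < K := by exact_mod_cast hK
  exact Real.sqrt_pos.2 (by positivity)

/-- Only the `1 / √n` part of the level is kept. Beyond the assumed upper bound by the threshold,
this lower bound is all that the proof uses about `epsN`. -/
lemma exists_le_epsN (hSZ : SZ.PosSemidef) (hV : HingeOrLogistic V σ β) (hσ : 0 < σ) (hβ : 0 < β)
    (hL : 0 < L) (hK : 0 < K) (hD : 0 < D) :
    ∃ a > 0, ∀ n : ℕ, 1 ≤ n → ∀ δ : ℝ, 0 < δ → δ < 1 →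
      a * (1 + Real.sqrt (Real.log (4 / δ))) / Real.sqrt n ≤ epsN K B SZ σ β V L n δ := by
  have hK' : (0 : ℝ) < K := by exact_mod_cast hK
  have ha : 0 < L * radius K V β * Real.sqrt (K * (imageCov B SZ σ).trace) :=
    mul_pos (mul_pos hL (hV.radius_pos hβ hK))
      (Real.sqrt_pos.2 (mul_pos hK' (trace_imageCov_pos hSZ hσ hD)))
  refine ⟨_, ha, fun n hn δ hδ hδ1 => ?_⟩
  rw [mul_div_assoc, epsN]
  refine mul_le_mul_of_nonneg_left ?_ ha.le
  have hn' : (1 : ℝ) ≤ n := by exact_mod_cast hn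
  have h1 : 0 ≤ Real.log (4 / δ) := Real.log_nonneg (by rw [le_div_iff₀ hδ]; linarith)
  have h2 : 0 ≤ Real.log (4 * n / δ) := Real.log_nonneg (by rw [le_div_iff₀ hδ]; linarith)
  have h3 : 0 ≤ Real.log (2 * Real.exp 1) :=
    Real.log_nonneg (by linarith [Real.add_one_le_exp (1 : ℝ)])
  have h4 : 0 ≤ Real.log 2 := Real.log_nonneg one_le_two
  have h5 : 0 ≤ 75 * Real.log (2 * Real.exp 1) / (2 * Real.log 2) *
      (Real.log (4 * n / δ) * Real.log (4 / δ) / n) := by positivity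
  refine le_add_of_le_of_nonneg ?_ h5
  have := Real.sqrt_nonneg (Real.log (4 / δ))
  gcongr
  · norm_num
  · linarith

/-- It suffices that `M n ε / c` dominate `log C + p log n + log (1 / δ)`. The lower bound on `ε`
gives `n ε ≥ a √n`, which beats `log n`, and, since `ε ≤ 1`, also `n ε ≥ n ε² ≥ a² (1 + log (4 /
δ))`. The three summands of `M` pay for the three logarithms. -/
lemma exists_exponential_tail_le {a C c : ℝ} (ha : 0 < a) (hC : 0 < C) (hc : 0 < c) (p : ℕ) :
    ∃ M > 0, ∀ n : ℕ, 1 ≤ n → ∀ δ ε : ℝ, 0 < δ → δ < 1 → ε ≤ 1 →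
      a * (1 + Real.sqrt (Real.log (4 / δ))) / Real.sqrt n ≤ ε →
      C * (n : ℝ) ^ p * Real.exp (-(n * (M * ε)) / c) ≤ δ := by
  refine ⟨c * (|Real.log C| / a ^ 2 + p * (2 / a) + 1 / a ^ 2), by positivity,
    fun n hn δ ε hδ hδ1 hε h => ?_⟩
  have hn' : (1 : ℝ) ≤ n := by exact_mod_cast hn
  have hn0 : (0 : ℝ) < n := by linarith
  have hs : 0 < Real.sqrt n := Real.sqrt_pos.2 hn0
  have hss : Real.sqrt n * Real.sqrt n = n := Real.mul_self_sqrt hn0.le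
  set l := Real.log (4 / δ) with hl
  have hl0 : 0 ≤ l := Real.log_nonneg (by rw [le_div_iff₀ hδ]; linarith)
  have hq := Real.sqrt_nonneg l
  have hql : Real.sqrt l * Real.sqrt l = l := Real.mul_self_sqrt hl0
  rw [div_le_iff₀ hs] at h
  have hε0 : 0 < ε := by
    by_contra! h0
    nlinarith [mul_pos ha (by linarith : 0 < 1 + Real.sqrt l)]
  have h1 : a * Real.sqrt n ≤ n * ε := by
    have h2 : a * Real.sqrt n ≤ ε * Real.sqrt n * Real.sqrt n := by
      gcongr
      nlinarith
    rwa [mul_assoc, hss, mul_comm ε] at h2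
  have h2 : a ^ 2 * (1 + l) ≤ n * ε := by
    have h3 : (a * (1 + Real.sqrt l)) ^ 2 ≤ (ε * Real.sqrt n) ^ 2 := by gcongr
    have h4 : (ε * Real.sqrt n) ^ 2 = n * ε * ε := by
      rw [mul_pow, Real.sq_sqrt hn0.le]; ring
    have h5 : n * ε * ε ≤ n * ε := mul_le_of_le_one_right (by positivity) hε
    have h6 : a ^ 2 * (1 + l) ≤ (a * (1 + Real.sqrt l)) ^ 2 := by
      rw [mul_pow]
      gcongr
      nlinarith
    linarith
  have hlogn : Real.log n ≤ 2 / a * (n * ε) := by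
    have h3 := Real.log_le_sub_one_of_pos hs
    rw [Real.log_sqrt hn0.le] at h3
    have h4 : Real.sqrt n ≤ 1 / a * (n * ε) := by
      rw [one_div_mul_eq_div, le_div_iff₀ ha]; linarith
    have h5 : 2 / a * (n * ε) = 2 * (1 / a * (n * ε)) := by ring
    linarith
  have hx : 1 + l ≤ 1 / a ^ 2 * (n * ε) := by
    rw [one_div_mul_eq_div, le_div_iff₀ (by positivity)]; linarith
  have hlogC : Real.log C ≤ |Real.log C| / a ^ 2 * (n * ε) := by
    have h3 : |Real.log C| / a ^ 2 * (n * ε) = |Real.log C| * (1 / a ^ 2 * (n * ε)) := by ring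
    rw [h3]
    exact (le_abs_self _).trans (le_mul_of_one_le_right (abs_nonneg _) (by linarith))
  have hlogδ : -Real.log δ ≤ 1 / a ^ 2 * (n * ε) := by
    have h3 : l = Real.log 4 - Real.log δ := Real.log_div (by norm_num) hδ.ne'
    have h4 : 0 ≤ Real.log 4 := Real.log_nonneg (by norm_num)
    linarith
  rw [← Real.log_le_log_iff (by positivity) hδ, Real.log_mul (by positivity) (by positivity),
    Real.log_mul hC.ne' (by positivity), Real.log_pow, Real.log_exp]
  have h3 : -(n * (c * (|Real.log C| / a ^ 2 + p * (2 / a) + 1 / a ^ 2) * ε)) / c =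
      -(|Real.log C| / a ^ 2 * (n * ε) + p * (2 / a * (n * ε)) + 1 / a ^ 2 * (n * ε)) := by
    field_simp
  rw [h3]
  have h4 : (p : ℝ) * Real.log n ≤ p * (2 / a * (n * ε)) := by gcongr
  linarith

/-- The lower bound gives `1 / n ≤ ε² / a²`, so the discretization error is no larger in order than
the deviation `√ε`. -/
lemma one_div_le_of_le_epsN {a ε δ : ℝ} {n : ℕ} (ha : 0 < a) (hn : 1 ≤ n) (hε : ε ≤ 1)
    (h : a * (1 + Real.sqrt (Real.log (4 / δ))) / Real.sqrt n ≤ ε) :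
    0 < ε ∧ (1 : ℝ) / n ≤ 1 / a ^ 2 * Real.sqrt ε := by
  have hn0 : (0 : ℝ) < n := by exact_mod_cast hn
  have hs : 0 < Real.sqrt n := Real.sqrt_pos.2 hn0
  have hq := Real.sqrt_nonneg (Real.log (4 / δ))
  have h1 : a / Real.sqrt n ≤ ε := by
    refine le_trans ?_ h
    gcongr
    nlinarith
  have hε0 : 0 < ε := lt_of_lt_of_le (by positivity) h1
  refine ⟨hε0, ?_⟩
  have h2 : (a / Real.sqrt n) ^ 2 ≤ ε ^ 2 := by gcongr
  rw [div_pow, Real.sq_sqrt hn0.le] at h2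
  have h3 : ε ^ 2 ≤ Real.sqrt ε := by
    refine Real.le_sqrt_of_sq_le ?_
    calc (ε ^ 2) ^ 2 = ε ^ 4 := by ring
      _ ≤ ε := pow_le_of_le_one hε0.le hε (by norm_num)
  have h4 : (1 : ℝ) / n = 1 / a ^ 2 * (a ^ 2 / n) := by field_simp
  rw [h4]
  gcongr
  exact h2.trans h3

end ErrorLevel

/-! ### Minimizers of the empirical objective. -/

section Minimizer

variable {D d K : ℕ} {B : Matrix (Fin D) (Fin d) ℝ} {SZ : Matrix (Fin d) (Fin d) ℝ} {σ β : ℝ}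
  {V : ℝ → ℝ}

/-- Comparison with the zero watermark, whose objective is at most `K * V 0`, bounds the regularizer
since the losses are nonnegative. -/
lemma sq_norm_le_of_isMinOn_empLoss {n : ℕ} (hV : ∀ x, 0 ≤ V x) (hβ : 0 < β)
    {x : Fin n → Img D} {w : Fin K → Img D} (hw : IsMinOn (empLoss V β x) Set.univ w) (k : Fin K) :
    ‖w k‖ ^ 2 ≤ K * V 0 / β := by
  have h0 : empLoss V β x w ≤ empLoss V β x 0 := hw (Set.mem_univ _)
  have h1 : empLoss V β x (0 : Fin K → Img D) ≤ K * V 0 := by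
    have h2 : (1 / (2 : ℝ) ^ K) * ∑ _m : Message K, ∑ _k : Fin K, V 0 = K * V 0 := by
      simp
    simp only [empLoss, Pi.zero_apply, inner_zero_left, mul_zero, norm_zero]
    rw [h2]
    simp only [Finset.sum_const, Finset.card_univ, Fintype.card_fin, nsmul_eq_mul]
    have h3 : 0 ≤ K * V 0 := mul_nonneg (by positivity) (hV 0)
    rcases Nat.eq_zero_or_pos n with rfl | hn
    · simpa using h3
    · have : (0 : ℝ) < n := by exact_mod_cast hn
      field_simp
      simp
  have h2 : β * ∑ k, ‖w k‖ ^ 2 ≤ empLoss V β x w := by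
    refine le_add_of_nonneg_left (mul_nonneg (by positivity) (Finset.sum_nonneg fun i _ =>
      mul_nonneg (by positivity) (Finset.sum_nonneg fun m _ => Finset.sum_nonneg fun k _ => hV _)))
  have h3 : ‖w k‖ ^ 2 ≤ ∑ k, ‖w k‖ ^ 2 :=
    Finset.single_le_sum (f := fun k => ‖w k‖ ^ 2) (fun _ _ => by positivity) (Finset.mem_univ k)
  rw [le_div_iff₀ hβ]
  nlinarith

/-- A consequence of quadratic growth. The constants are built from one minimizer, and this
identifies it with whichever minimizer the oracle watermark uses. -/
lemma HingeOrLogistic.isMinOn_hPop_unique (hV : HingeOrLogistic V σ β) (hσ : 0 < σ) {r s : ℝ}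
    (hr : 0 < r) (hs : 0 < s) (hmr : IsMinOn (hPop V σ β) (Set.Ici 0) r)
    (hms : IsMinOn (hPop V σ β) (Set.Ici 0) s) : s = r := by
  obtain ⟨κ, hκ, h⟩ := hV.exists_growth hσ hr hmr hs
  have h1 := h s hs.le le_rfl
  have h2 : hPop V σ β s ≤ hPop V σ β r := hms hr.le
  have h3 : (s - r) ^ 2 ≤ 0 := by
    by_contra! h3
    nlinarith [mul_pos hκ h3]
  exact sub_eq_zero.1 (pow_eq_zero_iff two_ne_zero |>.1 (le_antisymm h3 (sq_nonneg _)))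

lemma rpow_le_rate {ε : ℝ} (hε : 0 ≤ ε) : ε ^ (1 / 4 : ℝ) ≤ rate ε := by
  have := Real.rpow_nonneg hε (1 / 2)
  rw [rate]; linarith

lemma exists_ΓClose_event {L : ℝ} (hSZ : SZ.PosSemidef) (hV : HingeOrLogistic V σ β) (hσ : 0 < σ)
    (hβ : 0 < β) (hL : 0 < L) (hK : 0 < K) (hD : 0 < D) {r : ℝ} (hr : 0 < r)
    (hmin : IsMinOn (hPop V σ β) (Set.Ici 0) r) :
    ∃ τ > (0 : ℝ), ∃ C > (0 : ℝ), ∀ n : ℕ, 1 ≤ n → ∀ δ : ℝ, 0 < δ → δ < 1 →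
      epsN K B SZ σ β V L n δ ≤ τ →
      0 < epsN K B SZ σ β V L n δ ∧
      ∃ E : Set (Fin n → Img D), MeasurableSet E ∧
        ENNReal.ofReal (1 - δ) ≤ Measure.pi (fun _ : Fin n => imageLaw B SZ σ) E ∧
        ∀ x ∈ E, ∀ wn : Fin K → Img D, IsMinOn (empLoss V β x) Set.univ wn →
          ∀ w : Fin K → Img D, IsOracle B r w →
            ΓClose (imageLaw B SZ σ) wn w (C * rate (epsN K B SZ σ β V L n δ)) := by
  have hVr := hV.regularLoss
  -- Chosen so that both the empirical minimizers and the oracle watermarks lie in the cube where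
  -- the uniform deviation holds.
  set R : ℝ := max (K * V 0 / β) r with hR
  have hR0 : 0 < R := lt_max_of_lt_right hr
  obtain ⟨ρ, hρ⟩ := exists_nat_ge (Real.sqrt R)
  obtain ⟨a, ha, h_eps⟩ := exists_le_epsN (B := B) (L := L) hSZ hV hσ hβ hL hK hD
  obtain ⟨Cu, hCu, c, hc, h_dev⟩ :=
    exists_uniform_deviation (B := B) (σ := σ) hSZ hVr.lipschitz β K ρ
  obtain ⟨M, hM, h_tail⟩ := exists_exponential_tail_le ha hCu hc (K * D)
  obtain ⟨Ce, hCe, e₀, he₀, h_exc⟩ := exists_excess_bounds (B := B) hSZ hV hσ hr hmin K hR0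
  obtain ⟨CΓ, hCΓ, h_close⟩ := exists_ΓClose_of_bounds (B := B) hSZ hσ hr K
  set Q : ℝ := 2 * (Cu * (Real.sqrt M + 1 / a ^ 2)) with hQ
  have hQ0 : 0 < Q := by positivity
  -- The threshold ensures `ε ≤ 1`, a deviation `√(M ε) ≤ 1`, and an excess bound `Q √ε ≤ e₀`.
  refine ⟨min 1 (min (1 / M) ((e₀ / Q) ^ 2)), by positivity, CΓ * (Ce * Real.sqrt Q),
    by positivity, fun n hn δ hδ hδ1 hε => ?_⟩
  have hlow := h_eps n hn δ hδ hδ1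
  set ε := epsN K B SZ σ β V L n δ with hεdef
  obtain ⟨hε1, hε⟩ := le_min_iff.1 hε
  obtain ⟨hε2, hε3⟩ := le_min_iff.1 hε
  obtain ⟨hε0, hn1⟩ := one_div_le_of_le_epsN ha hn hε1 hlow
  refine ⟨hε0, ?_⟩
  have ht1 : Real.sqrt (M * ε) ≤ 1 := by
    rw [Real.sqrt_le_one]
    rw [le_div_iff₀ hM] at hε2
    linarith
  obtain ⟨E, hEm, hEp, hE⟩ := h_dev n hn _ (Real.sqrt_nonneg (M * ε)) ht1
  refine ⟨E, hEm, le_trans ?_ hEp, fun x hx wn hwn w hw => ?_⟩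
  · refine ENNReal.ofReal_le_ofReal ?_
    rw [Real.sq_sqrt (by positivity)]
    linarith [h_tail n hn δ ε hδ hδ1 hε1 hlow]
  have hcoord : ∀ v : Fin K → Img D, (∀ k, ‖v k‖ ^ 2 ≤ R) → ∀ k i, |v k i| ≤ ρ := by
    intro v hv k i
    rw [← Real.norm_eq_abs]
    exact (PiLp.norm_apply_le (v k) i).trans ((Real.le_sqrt_of_sq_le (hv k)).trans hρ)
  have hwnR : ∀ k, ‖wn k‖ ^ 2 ≤ R := fun k =>
    (sq_norm_le_of_isMinOn_empLoss hVr.nonneg hβ hwn k).trans (le_max_left _ _)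
  have hwR : ∀ k, ‖w k‖ ^ 2 ≤ R := fun k => (hw.sq_norm k).le.trans (le_max_right _ _)
  have h1 := (abs_le.1 (hE x hx wn (hcoord wn hwnR))).1
  have h2 := (abs_le.1 (hE x hx w (hcoord w hwR))).2
  rw [popLoss_oracle hSZ hVr.lipschitz hw] at h2
  have h3 : empLoss V β x wn ≤ empLoss V β x w := hwn (Set.mem_univ _)
  -- The empirical objective at `wn` does not exceed that at the oracle, so the population excess is
  -- at most two deviations; hence the factor 2 in `Q`.
  have hexc : popLoss V β (imageLaw B SZ σ) wn - K * hPop V σ β r ≤ Q * Real.sqrt ε := by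
    have h4 : Cu * (Real.sqrt (M * ε) + 1 / n) ≤
        Cu * (Real.sqrt M * Real.sqrt ε + 1 / a ^ 2 * Real.sqrt ε) := by
      rw [Real.sqrt_mul hM.le]; gcongr
    have h5 : Q * Real.sqrt ε =
        2 * (Cu * (Real.sqrt M * Real.sqrt ε + 1 / a ^ 2 * Real.sqrt ε)) := by
      rw [hQ]; ring
    linarith
  have he : Q * Real.sqrt ε ≤ e₀ := by
    have h4 : Real.sqrt ε ≤ e₀ / Q := Real.sqrt_le_iff.2 ⟨by positivity, hε3⟩
    rw [le_div_iff₀ hQ0] at h4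
    linarith
  have hroot : Real.sqrt (Q * Real.sqrt ε) = Real.sqrt Q * ε ^ (1 / 4 : ℝ) := by
    rw [Real.sqrt_mul hQ0.le, Real.sqrt_eq_rpow (Real.sqrt ε), Real.sqrt_eq_rpow ε,
      ← Real.rpow_mul hε0.le]
    norm_num
  have hfinal := h_close wn w _ hw (by positivity) (h_exc wn hwnR _ he hexc)
  refine hfinal.mono ?_
  rw [hroot, mul_assoc CΓ, mul_assoc Ce]
  gcongr
  exact rpow_le_rate hε0.le

end Minimizer

end Watermark

theorem theorem9 (K D d : ℕ) (hK : 0 < K) (hd : 0 < d) (hD : d + K < D)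
    (B : Matrix (Fin D) (Fin d) ℝ) (hB : B.rank = d)
    (SZ : Matrix (Fin d) (Fin d) ℝ) (hSZ : SZ.PosDef)
    (σ β : ℝ) (hσ : 0 < σ) (hβ : 0 < β)
    (V : ℝ → ℝ) (hV : Watermark.HingeOrLogistic V σ β)
    (L : ℝ) (hL : 0 < L) (hVL : Watermark.SlopeBound V L) :
    -- the constants depend on the data above only
    ∃ τ₁ > (0 : ℝ), ∃ C > (0 : ℝ), ∀ n : ℕ, 1 ≤ n → ∀ δ : ℝ, 0 < δ → δ < 1 →
      Watermark.epsN K B SZ σ β V L n δ ≤ τ₁ →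
      -- an event of probability at least `1 - δ` over the i.i.d. training sample
      ∃ E : Set (Fin n → Watermark.Img D), MeasurableSet E ∧
        ENNReal.ofReal (1 - δ) ≤
          MeasureTheory.Measure.pi (fun _ : Fin n => Watermark.imageLaw B SZ σ) E ∧
        ∀ x ∈ E,
          -- any minimizer of the finite-sample objective, and any oracle watermark
          ∀ wn : Fin K → Watermark.Img D,
            IsMinOn (Watermark.empLoss V β x) Set.univ wn →
          ∀ r : ℝ, IsMinOn (Watermark.hPop V σ β) (Set.Ici 0) r →
          ∀ w : Fin K → Watermark.Img D, Watermark.IsOracle B r w →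
          -- (i) detection without dictionary
          (∀ s : ℝ,
            |Watermark.fpr (Watermark.imageLaw B SZ σ) wn s
                - Watermark.fpr (Watermark.imageLaw B SZ σ) w s|
              ≤ C * Watermark.rate (Watermark.epsN K B SZ σ β V L n δ) ∧
            |Watermark.tpr (Watermark.imageLaw B SZ σ) wn s
                - Watermark.tpr (Watermark.imageLaw B SZ σ) w s|
              ≤ C * Watermark.rate (Watermark.epsN K B SZ σ β V L n δ)) ∧
          -- (ii) detection with a dictionary
          (∀ (𝒟 : Finset (Watermark.Message K)) (h𝒟 : 𝒟.Nonempty) (t : ℝ),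
            |Watermark.fprD (Watermark.imageLaw B SZ σ) 𝒟 h𝒟 wn t
                - Watermark.fprD (Watermark.imageLaw B SZ σ) 𝒟 h𝒟 w t|
              ≤ C * Watermark.rate (Watermark.epsN K B SZ σ β V L n δ) ∧
            |Watermark.tprD (Watermark.imageLaw B SZ σ) 𝒟 h𝒟 wn t
                - Watermark.tprD (Watermark.imageLaw B SZ σ) 𝒟 h𝒟 w t|
              ≤ C * Watermark.rate (Watermark.epsN K B SZ σ β V L n δ)) ∧
          -- (iii) bit accuracy of the sign decoder and of the dictionary decoder
          (⨆ m : Watermark.Message K,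
            |Watermark.expBitAcc (Watermark.imageLaw B SZ σ) Watermark.signDec wn m
                - Watermark.expBitAcc (Watermark.imageLaw B SZ σ) Watermark.signDec w m|)
              ≤ C * Watermark.rate (Watermark.epsN K B SZ σ β V L n δ) ∧
          (∀ (𝒟 : Finset (Watermark.Message K)), 𝒟.Nonempty →
            ∀ dec : (Fin K → ℝ) → Watermark.Message K, Watermark.IsDictDec 𝒟 dec →
            (⨆ m : 𝒟,
              |Watermark.expBitAcc (Watermark.imageLaw B SZ σ) dec wn m.1
                  - Watermark.expBitAcc (Watermark.imageLaw B SZ σ) dec w m.1|)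
                ≤ C * Watermark.rate (Watermark.epsN K B SZ σ β V L n δ)) := by
  open Watermark in
  have hSZ' := hSZ.posSemidef
  -- Without a positive minimizer there is no oracle watermark, and the claim is vacuous on the full
  -- sample space.
  by_cases hex : ∃ r, IsMinOn (hPop V σ β) (Set.Ici 0) r ∧ 0 < r
  swap
  · refine ⟨1, one_pos, 1, one_pos, fun n _ δ hδ _ _ => ⟨Set.univ, MeasurableSet.univ, ?_,
      fun x _ wn _ r hr w hw => absurd ⟨r, hr, hw.r_pos⟩ hex⟩⟩
    rw [measure_univ]
    exact ENNReal.ofReal_le_one.2 (by linarith)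
  obtain ⟨r₀, hmin, hr₀⟩ := hex
  obtain ⟨τ, hτ, C, hC, h⟩ := exists_ΓClose_event (B := B) (K := K) hSZ' hV hσ hβ hL hK
    (by omega) hr₀ hmin
  -- The factor `2 ^ K` is needed only for the bit accuracies.
  refine ⟨τ, hτ, 2 ^ K * C, by positivity, fun n hn δ hδ hδ1 hε => ?_⟩
  obtain ⟨hε0, E, hEm, hEp, hE⟩ := h n hn δ hδ hδ1 hε
  refine ⟨E, hEm, hEp, fun x hx wn hwn r hr w hw => ?_⟩
  obtain rfl := hV.isMinOn_hPop_unique hσ hr₀ hw.r_pos hmin hr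
  have hclose := hE x hx wn hwn w hw
  have hrate : 0 ≤ C * rate (epsN K B SZ σ β V L n δ) :=
    mul_nonneg hC.le ((Real.rpow_nonneg hε0.le _).trans (rpow_le_rate hε0.le))
  have hbig := hclose.mono (le_mul_of_one_le_left hrate
    (one_le_pow₀ (one_le_two (α := ℝ)) (n := K)))
  rw [← mul_assoc] at hbig
  refine ⟨fun s => ⟨hbig.abs_fpr_sub_le s, hbig.abs_tpr_sub_le s⟩,
    fun 𝒟 h𝒟 t => ⟨hbig.abs_fprD_sub_le 𝒟 h𝒟 t, hbig.abs_tprD_sub_le 𝒟 h𝒟 t⟩,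
    ciSup_le fun m => ?_, fun 𝒟 h𝒟 dec hdec => ?_⟩
  · rw [mul_assoc]
    exact hclose.abs_expBitAcc_sub_le measurable_signDec m
  · have : Nonempty 𝒟 := h𝒟.to_subtype
    refine ciSup_le fun m => ?_
    rw [mul_assoc]
    exact hclose.abs_expBitAcc_sub_le hdec.measurable m.1
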